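/- Let $n,N\ge 1$, let $\lambda_0\in\mathbb C$ with $\Re\lambda_0=0$, $\Im\lambda_0\neq 0$, and put $$\zeta=\frac{2\,\Im\lambda_0}{n+1},\quad \omega_j=\frac{j\pi}{n+1},\quad a_j=\zeta\csc\omega_j,\quad b_j=\zeta\cot\omega_j-2\Re\lambda_0\quad(1\le j\le n),\qquad z_0=2\Re\lambda_0+\mathrm i\zeta .$$ Let $q_j^{\mathrm{bg}}=a_j\mathrm e^{\mathrm i\theta_j}$, $\theta_j=b_jx-(\tfrac12 b_j^2-\|\mathbf a\|_2^2)t$, be the plane wave, $\mathbf G=\mathrm{diag}(1,\mathrm e^{\mathrm i\theta_1},\dots,\mathrm e^{\mathrm i\theta_n})$, and $$\mathbf H(\lambda)=\begin{pmatrix}\lambda&\mathbf a^\dagger\\ \mathbf a&-\lambda\mathbb I_n-\mathbf b\end{pmatrix},\qquad \mathbf b=\mathrm{diag}(b_1,\dots,b_n).$$ Let $f(z)=2\lambda_0\prod_{s=1}^n(z+b_s)$ and, for $k=0,\dots,n$ and $z$ near $z_0$, $$g_k(z)=|f(z)|^{\frac1{n+1}}\,\mathrm e^{\mathrm i[\arg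 f(z)+2k\pi]/(n+1)},$$ where $\arg f(z)$ is the determination that is continuous near $z_0$ and satisfies $\arg f(z_0)\in(-\pi,\pi]$. Write $\lambda(\epsilon)=\lambda_0(1+\epsilon^{n+1})$ for $\epsilon\in\mathbb C$. (1) There are functions $\mu_0,\dots,\mu_n$, holomorphic near $\epsilon=0$, such that $\mu_0(\epsilon),\dots,\mu_n(\epsilon)$ are the eigenvalues, counted with multiplicity, of $\mathbf H(\lambda(\epsilon))+\lambda(\epsilon)\mathbb I_{n+1}$ for all small $\epsilon$, numbered so that $\mu_s'(0)=g_s(z_0)$. All such functions satisfy, for $s=0,\dots,n$, $$\mu_s(0)=z_0,\qquad \mu_s^{(i)}(0)=\frac{\mathrm d^{\,i-1}g_s^i(z)}{\mathrm dz^{i-1}}\Big|_{z=z_0}\quad(i\ge1).$$ Given such $\mu_s$, let, with $\lambda=\lambda(\epsilon)$, $\Phi_0(\epsilon)=(\mathbf h(\mu_0),\dots,\mathbf h(\mu_n))$, $$\mathbf h(z)=\mathbf G\Big(1,\frac{a_1}{z+b_1},\dots,\frac{a_n}{z+b_n}\Big)^{\mathrm T}\mathrm e^{\mathrm i(z-\lambda)[x+(z+\lambda)t/2]-\mathrm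 i(\|\mathbf a\|_2^2+\lambda^2/2)t}.$$ Let $\mathbf R_k=(g_0(z_0)^k,\dots,g_n(z_0)^k)^\dagger$, $\mathbf R=(\mathbf R_0,\dots,\mathbf R_n)$, $\mathbf E=\mathrm{diag}(1,\epsilon^{-1},\dots,\epsilon^{-n})$, and let $\widehat\Phi_s$ be the $(n+1)\times(n+1)$ matrix with columns $$\frac{\Phi_0^{(sn+s+k)}(0)}{(sn+s+k)!}\mathbf R_k,\qquad k=0,\dots,n .$$ Let $\boldsymbol\gamma_0,\dots,\boldsymbol\gamma_{N-1}\in\mathbb C^{(n+1)\times(n+1)}$ and $\boldsymbol\beta\in\mathbb C^{n+1}$ be constant with $\boldsymbol\gamma_0\boldsymbol\beta\ne0$, and put $$\widetilde\Phi_k=\sum_{s=0}^k\widehat\Phi_s\boldsymbol\gamma_{k-s}\boldsymbol\beta,\qquad \widetilde\Phi(\epsilon)=\Phi_0(\epsilon)\mathbf R\mathbf E\Big(\sum_{s=0}^{N-1}\boldsymbol\gamma_s\epsilon^{s(n+1)}\Big)\boldsymbol\beta ,\qquad \mathbf Y=(\widetilde\Phi_0,\dots,\widetilde\Phi_{N-1}),$$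 with $\mathbf Y_j$ the $j$-th row of $\mathbf Y$, and $\mathbf M=(M_{m,k})_{0\le m,k\le N-1}$, $$M_{m,k}=\frac1{\mathrm i(n+1)\zeta}\sum_{s=0}^m\sum_{l=0}^k\Big(-\frac12\Big)^{s+l}\binom{s+l}{l}\widetilde\Phi_{m-s}^\dagger\widetilde\Phi_{k-l}.$$ (2) For all small $\epsilon\neq0$ the columns of $\Phi_0(\epsilon)$ and the vector $\widetilde\Phi(\epsilon)$ solve, at $\lambda=\lambda(\epsilon)$ and $\mathbf q=\mathbf q^{\mathrm{bg}}$, the Lax pair $\Phi_x=\mathrm i(\lambda\sigma_3+\mathbf Q)\Phi$, $\Phi_t=\mathrm i(\lambda^2\sigma_3+\lambda\mathbf Q-\tfrac12\sigma_3\mathbf Q^2-\tfrac{\mathrm i}2\sigma_3\mathbf Q_x)\Phi$, where $\sigma_3=\mathrm{diag}(1,-\mathbb I_n)$ and $\mathbf Q=\begin{pmatrix}0&\mathbf q^\dagger\\ \mathbf q&0\end{pmatrix}$; and for all $x,t$ $$\widetilde\Phi(\epsilon)=\sum_{k=0}^{N-1}\widetilde\Phi_k\epsilon^{k(n+1)}+\mathcal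 O(\epsilon^{N(n+1)})\qquad(\epsilon\to0).$$ (3) $\det\mathbf M\ne0$ for all $(x,t)\in\mathbb R^2$. The $N$-th order vector rational rogue wave, that is, the limit as $\epsilon_1,\dots,\epsilon_N\to0$ ($\epsilon_i\ne0$, with $\lambda_i=\lambda(\epsilon_i)$ pairwise distinct) of the $N$-fold Darboux transforms $\mathbf q^{\mathrm{bg}}-2\widehat{\mathbf Y}_{2..n+1}\widehat{\mathbf M}^{-1}\widehat{\mathbf Y}_1^\dagger$ of the plane wave, where $\widehat{\mathbf Y}=(\widetilde\Phi(\epsilon_1),\dots,\widetilde\Phi(\epsilon_N))$ and $\widehat M_{m,k}=\widetilde\Phi(\epsilon_m)^\dagger\widetilde\Phi(\epsilon_k)/(\lambda_k-\lambda_m^*)$, exists for all $(x,t)$ and is $$q_j^{[N]}(x,t)=q_j^{\mathrm{bg}}+2\,\frac{\det\begin{pmatrix}\mathbf M&\mathbf Y_1^\dagger\\ \mathbf Y_{j+1}&0\end{pmatrix}}{\det\mathbf M},\qquad j=1,\dots,n .$$ It is a smooth solution on $\mathbb R^2$ of the $n$-component NLS equations $\mathrm i\mathbf q_t+\frac12\mathbf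 q_{xx}+\|\mathbf q\|_2^2\mathbf q=0$. The ratios $q_j^{[N]}/q_j^{\mathrm{bg}}$ are rational functions of $(x,t)$ with a common denominator that has no zero on $\mathbb R^2$. (4) With the principal logarithm, $\ln\det\mathbf M$ is smooth on $\mathbb R^2$, and $$\|\mathbf q^{[N]}\|_2^2=\|\mathbf a\|_2^2+\frac{\partial^2}{\partial x^2}\ln(\det\mathbf M).$$ -/

import Mathlib

open Filter Topology Asymptotics
open scoped Matrix ContDiff

noncomputable section

namespace NNLS

/-! ## The system and its Lax pair -/

/-- `q(x,t) ∈ ℂⁿ` is a smooth solution on `ℝ²` of `i q_t + (1/2) q_xx + ‖q‖₂² q = 0`. -/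
def IsSolution {n : ℕ} (q : ℝ → ℝ → EuclideanSpace ℂ (Fin n)) : Prop :=
  ContDiff ℝ ∞ (fun p : ℝ × ℝ => q p.1 p.2) ∧
  ∀ x t : ℝ,
    Complex.I • deriv (fun τ => q x τ) t
      + (1 / 2 : ℂ) • iteratedDeriv 2 (fun y => q y t) x
      + ((‖q x t‖ ^ 2 : ℝ) : ℂ) • q x t = 0

/-- `σ₃ = diag(1, -1, …, -1)`. -/
def sigma3 (n : ℕ) : Matrix (Fin (n + 1)) (Fin (n + 1)) ℂ :=
  Matrix.diagonal (Matrix.vecCons 1 fun _ : Fin n => -1)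

/-- `Q = [[0, q†], [q, 0]]`. -/
def potential {n : ℕ} (q : EuclideanSpace ℂ (Fin n)) :
    Matrix (Fin (n + 1)) (Fin (n + 1)) ℂ :=
  Matrix.of (Matrix.vecCons (Matrix.vecCons 0 fun k : Fin n => star (q k))
    fun j : Fin n => Matrix.vecCons (q j) fun _ : Fin n => 0)

/-- `U = i (λ σ₃ + Q)`. -/
def laxU {n : ℕ} (q : ℝ → ℝ → EuclideanSpace ℂ (Fin n)) (lam : ℂ) (x t : ℝ) :
    Matrix (Fin (n + 1)) (Fin (n + 1)) ℂ :=
  Complex.I • (lam • sigma3 n + potential (q x t))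

/-- `V = i (λ² σ₃ + λ Q - (1/2) σ₃ Q² - (i/2) σ₃ Q_x)`. -/
def laxV {n : ℕ} (q : ℝ → ℝ → EuclideanSpace ℂ (Fin n)) (lam : ℂ) (x t : ℝ) :
    Matrix (Fin (n + 1)) (Fin (n + 1)) ℂ :=
  Complex.I • (lam ^ 2 • sigma3 n + lam • potential (q x t)
    - (1 / 2 : ℂ) • (sigma3 n * potential (q x t) ^ 2)
    - (Complex.I / 2) • (sigma3 n * potential (deriv (fun y => q y t) x)))

/-- `Φ_x = U Φ` and `Φ_t = V Φ` on `ℝ²`, for a vector function `Φ`. -/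
def IsLaxSolution {n : ℕ} (q : ℝ → ℝ → EuclideanSpace ℂ (Fin n)) (lam : ℂ)
    (Φ : ℝ → ℝ → Fin (n + 1) → ℂ) : Prop :=
  ∀ x t : ℝ,
    HasDerivAt (fun y => Φ y t) (laxU q lam x t *ᵥ Φ x t) x ∧
    HasDerivAt (fun τ => Φ x τ) (laxV q lam x t *ᵥ Φ x t) t

/-- The matrix `(φ_m† φ_k / (λ_k - λ_m^*))_{m,k}` of the `N`-fold Darboux transformation. -/
def darbouxMatrix {n N : ℕ} (lam : Fin N → ℂ) (φ : Fin N → Fin (n + 1) → ℂ) :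
    Matrix (Fin N) (Fin N) ℂ :=
  Matrix.of fun m k => (star (φ m) ⬝ᵥ φ k) / (lam k - star (lam m))

/-- The classical `N`-fold Darboux transformation (simple poles) of the potential `q`, at one point
of the plane, where `φ_k` is the value there of the Lax pair solution at the spectral parameter
`λ_k`: the `j`-th component is `q_j - 2 Y_{j+1} M̂⁻¹ Y_1†` with `Y = (φ_1, …, φ_N)`. -/
def darboux {n N : ℕ} (q : EuclideanSpace ℂ (Fin n)) (lam : Fin N → ℂ)
    (φ : Fin N → Fin (n + 1) → ℂ) : EuclideanSpace ℂ (Fin n) :=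
  WithLp.toLp 2 fun j : Fin n =>
    q j - 2 * ((fun m => φ m j.succ) ⬝ᵥ ((darbouxMatrix lam φ)⁻¹ *ᵥ fun k => star (φ k 0)))

/-! ## The plane-wave background

Rows and columns of `(n+1) × (n+1)` matrices are indexed by `Fin (n + 1)` from `0`; the components
`1, …, n` of a vector in `ℂⁿ` are indexed by `j : Fin n` from `0`, so that `j : Fin n` stands for
the component number `j + 1`. -/

/-- `ζ = 2 Im(λ₀) / (n+1)`. -/
def zeta (n : ℕ) (lam0 : ℂ) : ℝ := 2 * lam0.im / (n + 1)

/-- `ω_j = j π / (n+1)`, `j = 1, …, n`. -/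
def omega (n : ℕ) (j : Fin n) : ℝ := ((j : ℝ) + 1) * Real.pi / (n + 1)

/-- `a_j = ζ csc ω_j`. -/
def amp (n : ℕ) (lam0 : ℂ) : EuclideanSpace ℝ (Fin n) :=
  WithLp.toLp 2 fun j => zeta n lam0 / Real.sin (omega n j)

/-- `b_j = ζ cot ω_j - 2 Re(λ₀)`. -/
def wave (n : ℕ) (lam0 : ℂ) (j : Fin n) : ℝ :=
  zeta n lam0 * Real.cot (omega n j) - 2 * lam0.re

/-- `θ_j = b_j x - (b_j² / 2 - ‖a‖₂²) t`. -/
def phase (n : ℕ) (lam0 : ℂ) (j : Fin n) (x t : ℝ) : ℝ :=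
  wave n lam0 j * x - (wave n lam0 j ^ 2 / 2 - ‖amp n lam0‖ ^ 2) * t

/-- `q_j^bg = a_j exp(i θ_j)`. -/
def background (n : ℕ) (lam0 : ℂ) (x t : ℝ) : EuclideanSpace ℂ (Fin n) :=
  WithLp.toLp 2 fun j =>
    (amp n lam0 j : ℂ) * Complex.exp (Complex.I * (phase n lam0 j x t : ℂ))

/-- `z₀ = 2 Re(λ₀) + i ζ`. -/
def z0 (n : ℕ) (lam0 : ℂ) : ℂ := 2 * (lam0.re : ℂ) + Complex.I * (zeta n lam0 : ℂ)

/-- `H = [[λ, a†], [a, -λ I - b]]`, `b = diag(b_1, …, b_n)`. -/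
def matH (n : ℕ) (lam0 lam : ℂ) : Matrix (Fin (n + 1)) (Fin (n + 1)) ℂ :=
  Matrix.of (Matrix.vecCons (Matrix.vecCons lam fun k : Fin n => (amp n lam0 k : ℂ))
    fun j : Fin n => Matrix.vecCons (amp n lam0 j : ℂ)
      fun k : Fin n => if j = k then -lam - (wave n lam0 j : ℂ) else 0)

/-- `λ = λ₀ (1 + ε^{n+1})`. -/
def lamEps (n : ℕ) (lam0 ε : ℂ) : ℂ := lam0 * (1 + ε ^ (n + 1))

/-! ## The root branches and the eigenvalues -/

/-- `f(z) = 2 λ₀ ∏_s (z + b_s)`. -/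
def f (n : ℕ) (lam0 z : ℂ) : ℂ := 2 * lam0 * ∏ s : Fin n, (z + (wave n lam0 s : ℂ))

/-- The determination of `arg f(z)` that is continuous near `z₀` and takes its value in `(-π, π]`
at `z₀`. -/
def argF (n : ℕ) (lam0 z : ℂ) : ℝ :=
  (f n lam0 (z0 n lam0)).arg + (f n lam0 z / f n lam0 (z0 n lam0)).arg

/-- `g_k(z) = |f(z)|^{1/(n+1)} exp(i (arg f(z) + 2 k π) / (n+1))`. -/
def g (n : ℕ) (lam0 : ℂ) (k : Fin (n + 1)) (z : ℂ) : ℂ :=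
  ((‖f n lam0 z‖ ^ (1 / ((n : ℝ) + 1)) : ℝ) : ℂ) *
    Complex.exp (Complex.I * (((argF n lam0 z + 2 * (k : ℝ) * Real.pi) / ((n : ℝ) + 1) : ℝ) : ℂ))

/-- Near `ε = 0` the functions `μ_0, …, μ_n` are holomorphic and are the `n + 1` eigenvalues, with
multiplicity, of `H + λ I` at `λ = λ₀ (1 + ε^{n+1})`; they are numbered by `μ_s'(0) = g_s(z₀)`. -/
structure IsEigenvalueBranches (n : ℕ) (lam0 : ℂ) (μ : Fin (n + 1) → ℂ → ℂ) : Prop where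
  analytic : ∀ s, AnalyticAt ℂ (μ s) 0
  eigenvalues : ∀ᶠ ε in 𝓝 (0 : ℂ),
    (matH n lam0 (lamEps n lam0 ε) + lamEps n lam0 ε • 1).charpoly.roots
      = (Finset.univ : Finset (Fin (n + 1))).val.map fun s => μ s ε
  numbering : ∀ s, deriv (μ s) 0 = g n lam0 s (z0 n lam0)

/-! ## The vector solutions and their expansions -/

/-- `h(z) = G (1, a_1/(z+b_1), …, a_n/(z+b_n))ᵀ
exp(i (z-λ) (x + (z+λ) t/2) - i (‖a‖² + λ²/2) t)`, `G = diag(1, e^{iθ_1}, …, e^{iθ_n})`. -/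
def h (n : ℕ) (lam0 lam z : ℂ) (x t : ℝ) : Fin (n + 1) → ℂ :=
  Complex.exp (Complex.I * (z - lam) * ((x : ℂ) + (z + lam) * (t : ℂ) / 2)
      - Complex.I * (((‖amp n lam0‖ ^ 2 : ℝ) : ℂ) + lam ^ 2 / 2) * (t : ℂ)) •
    (Matrix.diagonal
        (Matrix.vecCons 1 fun j : Fin n => Complex.exp (Complex.I * (phase n lam0 j x t : ℂ))) *ᵥ
      Matrix.vecCons 1 fun j : Fin n => (amp n lam0 j : ℂ) / (z + (wave n lam0 j : ℂ)))

/-- `Φ₀(ε) = (h(μ_0(ε)), …, h(μ_n(ε)))`. -/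
def Phi0 (n : ℕ) (lam0 : ℂ) (μ : Fin (n + 1) → ℂ → ℂ) (x t : ℝ) (ε : ℂ) :
    Matrix (Fin (n + 1)) (Fin (n + 1)) ℂ :=
  Matrix.of fun i s => h n lam0 (lamEps n lam0 ε) (μ s ε) x t i

/-- `Φ₀^{(j)}(0)`, the `j`-th derivative in `ε`, entry by entry. -/
def Phi0Deriv (n : ℕ) (lam0 : ℂ) (μ : Fin (n + 1) → ℂ → ℂ) (j : ℕ) (x t : ℝ) :
    Matrix (Fin (n + 1)) (Fin (n + 1)) ℂ :=
  Matrix.of fun i s => iteratedDeriv j (fun ε => Phi0 n lam0 μ x t ε i s) 0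

/-- `R = (R_0, …, R_n)`, with columns `R_k = (g_0(z₀)^k, …, g_n(z₀)^k)†`. -/
def matR (n : ℕ) (lam0 : ℂ) : Matrix (Fin (n + 1)) (Fin (n + 1)) ℂ :=
  Matrix.of fun s k => star (g n lam0 s (z0 n lam0) ^ (k : ℕ))

/-- `Φ̂_s`, the matrix whose `k`-th column is `Φ₀^{(sn+s+k)}(0) R_k / (sn+s+k)!`,
`k = 0, …, n`. -/
def PhiHat (n : ℕ) (lam0 : ℂ) (μ : Fin (n + 1) → ℂ → ℂ) (s : ℕ) (x t : ℝ) :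
    Matrix (Fin (n + 1)) (Fin (n + 1)) ℂ :=
  Matrix.of fun i k =>
    (Phi0Deriv n lam0 μ (s * n + s + k) x t *ᵥ fun r => matR n lam0 r k) i
      / ((s * n + s + k).factorial : ℂ)

/-- `Φ̃_k = ∑_{s=0}^k Φ̂_s γ_{k-s} β`. -/
def PhiTilde (n : ℕ) (lam0 : ℂ) (μ : Fin (n + 1) → ℂ → ℂ)
    (γ : ℕ → Matrix (Fin (n + 1)) (Fin (n + 1)) ℂ) (β : Fin (n + 1) → ℂ)
    (k : ℕ) (x t : ℝ) : Fin (n + 1) → ℂ :=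
  ∑ s ∈ Finset.range (k + 1), PhiHat n lam0 μ s x t *ᵥ (γ (k - s) *ᵥ β)

/-- `Φ̃(ε) = Φ₀(ε) R E(ε) (∑_{s<N} γ_s ε^{s(n+1)}) β`, `E(ε) = diag(1, ε⁻¹, …, ε⁻ⁿ)`. -/
def PhiTildeFun (n N : ℕ) (lam0 : ℂ) (μ : Fin (n + 1) → ℂ → ℂ)
    (γ : ℕ → Matrix (Fin (n + 1)) (Fin (n + 1)) ℂ) (β : Fin (n + 1) → ℂ)
    (ε : ℂ) (x t : ℝ) : Fin (n + 1) → ℂ :=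
  Phi0 n lam0 μ x t ε *ᵥ (matR n lam0 *ᵥ
    (Matrix.diagonal (fun k : Fin (n + 1) => (ε ^ (k : ℕ))⁻¹) *ᵥ
      ((∑ s ∈ Finset.range N, ε ^ (s * (n + 1)) • γ s) *ᵥ β)))

/-! ## The determinant formula -/

/-- `Y = (Φ̃_0, …, Φ̃_{N-1})`. -/
def matY (n N : ℕ) (lam0 : ℂ) (μ : Fin (n + 1) → ℂ → ℂ)
    (γ : ℕ → Matrix (Fin (n + 1)) (Fin (n + 1)) ℂ) (β : Fin (n + 1) → ℂ) (x t : ℝ) :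
    Matrix (Fin (n + 1)) (Fin N) ℂ :=
  Matrix.of fun i k => PhiTilde n lam0 μ γ β k x t i

/-- `M_{m,k} = (1/(i(n+1)ζ)) ∑_{s≤m} ∑_{l≤k} (-1/2)^{s+l} C(s+l,l) Φ̃_{m-s}† Φ̃_{k-l}`,
`0 ≤ m, k ≤ N-1`. -/
def matM (n N : ℕ) (lam0 : ℂ) (μ : Fin (n + 1) → ℂ → ℂ)
    (γ : ℕ → Matrix (Fin (n + 1)) (Fin (n + 1)) ℂ) (β : Fin (n + 1) → ℂ) (x t : ℝ) :
    Matrix (Fin N) (Fin N) ℂ :=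
  Matrix.of fun m k =>
    1 / (Complex.I * ((n : ℂ) + 1) * (zeta n lam0 : ℂ)) *
      ∑ s ∈ Finset.range ((m : ℕ) + 1), ∑ l ∈ Finset.range ((k : ℕ) + 1),
        (-1 / 2 : ℂ) ^ (s + l) * ((s + l).choose l : ℂ) *
          (star (PhiTilde n lam0 μ γ β (m - s) x t) ⬝ᵥ PhiTilde n lam0 μ γ β (k - l) x t)

/-- `q_j^{[N]} = q_j^bg + 2 det [[M, Y_1†], [Y_{j+1}, 0]] / det M`. -/
def rogueWave (n N : ℕ) (lam0 : ℂ) (μ : Fin (n + 1) → ℂ → ℂ)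
    (γ : ℕ → Matrix (Fin (n + 1)) (Fin (n + 1)) ℂ) (β : Fin (n + 1) → ℂ) (x t : ℝ) :
    EuclideanSpace ℂ (Fin n) :=
  WithLp.toLp 2 fun j : Fin n =>
    background n lam0 x t j +
      2 * (Matrix.fromBlocks (matM n N lam0 μ γ β x t)
            (Matrix.replicateCol Unit fun k => star (matY n N lam0 μ γ β x t 0 k))
            (Matrix.replicateRow Unit fun k => matY n N lam0 μ γ β x t j.succ k)
            (0 : Matrix Unit Unit ℂ)).det
        / (matM n N lam0 μ γ β x t).det

end NNLS

end

/-!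
The proof rests on three facts.

*The spectrum collapses to one point.* With `Re λ₀ = 0` one has `2λ₀ = i(n+1)ζ` and `z₀ = iζ`, the
numbers `-b_j` are the zeros of `((z + iζ)^{n+1} - (z - iζ)^{n+1}) / (2i(n+1)ζ)`, and
`a_j² = ζ² + b_j²`. Partial fractions then give `charpoly_matH`: at `λ = λ₀(1 + ε^{n+1})` the
characteristic polynomial of `H + λ` is `(z - z₀)^{n+1} - ε^{n+1} f(z)`. Its roots near `z₀` are
the solutions of the `n + 1` equations `μ - z₀ = ε g_s(μ)` (`IsEigenvalueBranches.equation`), each of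
which has one holomorphic solution, with Taylor coefficients given by Lagrange inversion
(`iteratedDeriv_lagrange`). As `g_s = ω^s g_0` with `ω = e^{2πi/(n+1)}`, the branches are rotations
of each other, and summation against the columns of `R` picks out the powers of `ε` in one residue
class modulo `n + 1`; hence `Φ̃(ε)` is a germ in `ε^{n+1}` with the coefficients `Φ̃_k`
(`IsEigenvalueBranches.exists_germ_PhiTildeFun`). Expansion of the Lax pair in powers of `ε^{n+1}`
yields the confluent system `Y_x = i(σ₃YΛ + QY)` with the Jordan block `Λ = λ₀(1 + shift)`.

*`M` is the solution of the Sylvester equation `MΛ - ΛᴴM = YᴴY`* (`matM_sylvester`), which has only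
one solution. Therefore `Mᴴ = -M`, and the kernel of `M` is a `Λ`-invariant subspace of the kernel
of `Y`; if it were not zero, `Φ̃_0` would vanish, which a count of zeros of a polynomial of degree at
most `n` excludes (`IsEigenvalueBranches.PhiTilde_zero_ne_zero`). So `det M ≠ 0`. The same equation,
written in the Newton basis of the points `ε_k^{n+1}`, holds for the matrices of the Darboux
transforms at simple poles. There the multiplication matrix is bidiagonal and tends to the Jordan
block, and the Newton coefficients are divided differences and tend to Taylor coefficients; this is
the confluent limit (`IsEigenvalueBranches.tendsto_darboux`).

*Dressing.* Put `S = iσ₃`, `K = iQ` and `P = Y M⁻¹ Yᴴ`. By a Schur complement the rogue wave is the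
potential with `iQ^{[N]} = K + [S, P]`. The Sylvester equation gives `M_x = YᴴSY` and with it
closed formulas for `P_x` and `P_t`, from which the NLS equation follows by an identity in a free
algebra (`dressing_identity`). By Jacobi's formula `(ln det M)_x = tr(SP)`, and the derivative of
this trace is `‖q^{[N]}‖² - ‖a‖²`. Finally all entries of `Y` are polynomials up to exponential
factors that cancel in `q_j^{[N]}/q_j^{bg}`, and `det M` keeps its direction in `ℂ` because `M` is
skew-hermitian; hence rationality and smoothness, also of the principal logarithm.
-/

namespace NNLS

/-! ### The plane wave with a root of maximal multiplicity -/

lemma zeta_ne_zero (n : ℕ) {lam0 : ℂ} (him : lam0.im ≠ 0) : zeta n lam0 ≠ 0 := by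
  unfold zeta
  positivity

lemma omega_pos (n : ℕ) (j : Fin n) : 0 < omega n j := by
  unfold omega
  positivity

lemma omega_lt_pi (n : ℕ) (j : Fin n) : omega n j < Real.pi := by
  unfold omega
  rw [div_lt_iff₀ (by positivity), mul_comm]
  have : (j : ℝ) + 1 < n + 1 := by
    have := j.2
    exact_mod_cast Nat.succ_lt_succ this
  exact mul_lt_mul_of_pos_left this Real.pi_pos

lemma sin_omega_pos (n : ℕ) (j : Fin n) : 0 < Real.sin (omega n j) :=
  Real.sin_pos_of_pos_of_lt_pi (omega_pos n j) (omega_lt_pi n j)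

lemma wave_eq {n : ℕ} {lam0 : ℂ} (hre : lam0.re = 0) (j : Fin n) :
    wave n lam0 j = zeta n lam0 * (Real.cos (omega n j) / Real.sin (omega n j)) := by
  simp [wave, hre, Real.cot_eq_cos_div_sin]

lemma two_mul_lam0 (n : ℕ) {lam0 : ℂ} (hre : lam0.re = 0) :
    2 * lam0 = Complex.I * (n + 1) * zeta n lam0 := by
  have h : ((n : ℂ) + 1) ≠ 0 := by exact_mod_cast Nat.succ_ne_zero n
  have h' : lam0 = lam0.im * Complex.I := by
    apply Complex.ext <;> simp [hre]
  unfold zeta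
  push_cast
  field_simp
  linear_combination h'

lemma z0_eq {n : ℕ} {lam0 : ℂ} (hre : lam0.re = 0) :
    z0 n lam0 = Complex.I * zeta n lam0 := by
  simp [z0, hre]

lemma wave_injective {n : ℕ} {lam0 : ℂ} (hre : lam0.re = 0) (him : lam0.im ≠ 0) :
    Function.Injective (wave n lam0) := by
  intro j k h
  rw [wave_eq hre, wave_eq hre] at h
  have h1 := mul_left_cancel₀ (zeta_ne_zero n him) h
  rw [div_eq_div_iff (sin_omega_pos n j).ne' (sin_omega_pos n k).ne'] at h1
  have h2 : Real.sin (omega n k - omega n j) = 0 := by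
    rw [Real.sin_sub]; linarith
  have h3 := (Real.sin_eq_zero_iff_of_lt_of_lt
    (by linarith [omega_pos n k, omega_lt_pi n j])
    (by linarith [omega_pos n j, omega_lt_pi n k])).1 h2
  have h4 : omega n k = omega n j := by linarith
  unfold omega at h4
  have h5 : ((k : ℝ) + 1) * Real.pi = (j + 1) * Real.pi := by
    field_simp at h4
    rw [h4]
  have h6 := mul_right_cancel₀ Real.pi_ne_zero h5
  apply Fin.ext
  have : (k : ℝ) = j := by linarith
  exact_mod_cast this.symm

/-- The numbers `b_j` are antisymmetric under `j ↦ n + 1 - j`, because `ω_{n+1-j} = π - ω_j`. -/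
lemma sum_wave {n : ℕ} {lam0 : ℂ} (hre : lam0.re = 0) : ∑ j, wave n lam0 j = 0 := by
  have key : ∀ j : Fin n, wave n lam0 (Fin.rev j) = - wave n lam0 j := by
    intro j
    have : omega n (Fin.rev j) = Real.pi - omega n j := by
      unfold omega
      rw [Fin.val_rev, Nat.cast_sub (by have := j.2; omega)]
      field_simp
      push_cast
      ring
    rw [wave_eq hre, wave_eq hre, this, Real.cos_pi_sub, Real.sin_pi_sub]
    ring
  have h1 : ∑ j, wave n lam0 (Fin.rev j) = ∑ j, wave n lam0 j :=
    Equiv.sum_comp Fin.revPerm (wave n lam0)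
  simp only [key, Finset.sum_neg_distrib] at h1
  linarith

lemma amp_sq {n : ℕ} {lam0 : ℂ} (hre : lam0.re = 0) (j : Fin n) :
    amp n lam0 j ^ 2 = zeta n lam0 ^ 2 + wave n lam0 j ^ 2 := by
  have hs := (sin_omega_pos n j).ne'
  rw [wave_eq hre]
  simp only [amp]
  field_simp
  linear_combination -(zeta n lam0 ^ 2) * Real.sin_sq_add_cos_sq (omega n j)

lemma amp_ne_zero {n : ℕ} {lam0 : ℂ} (him : lam0.im ≠ 0) (j : Fin n) :
    amp n lam0 j ≠ 0 := by
  simp only [amp]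
  exact div_ne_zero (zeta_ne_zero n him) (sin_omega_pos n j).ne'

/-- De Moivre: `-b_j ± iζ = -(ζ / sin ω_j) e^{∓iω_j}`, and `(n + 1) ω_j` is a multiple of `π`. -/
lemma neg_wave_pow {n : ℕ} {lam0 : ℂ} (hre : lam0.re = 0) (j : Fin n) :
    (-(wave n lam0 j : ℂ) + Complex.I * zeta n lam0) ^ (n + 1)
      = (-(wave n lam0 j : ℂ) - Complex.I * zeta n lam0) ^ (n + 1) := by
  have hs : (Real.sin (omega n j) : ℂ) ≠ 0 := by exact_mod_cast (sin_omega_pos n j).ne'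
  have h1 : (-(wave n lam0 j : ℂ) + Complex.I * zeta n lam0)
      = (-(zeta n lam0 : ℂ) / Real.sin (omega n j)) *
        (Complex.cos (-(omega n j : ℂ)) + Complex.sin (-(omega n j : ℂ)) * Complex.I) := by
    rw [wave_eq hre, Complex.cos_neg, Complex.sin_neg]
    push_cast at hs ⊢
    field_simp
    ring
  have h2 : (-(wave n lam0 j : ℂ) - Complex.I * zeta n lam0)
      = (-(zeta n lam0 : ℂ) / Real.sin (omega n j)) *
        (Complex.cos (omega n j : ℂ) + Complex.sin (omega n j : ℂ) * Complex.I) := by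
    rw [wave_eq hre]
    push_cast at hs ⊢
    field_simp
    ring
  have h3 : Complex.sin (((n + 1 : ℕ) : ℂ) * (omega n j : ℂ)) = 0 := by
    have : ((n + 1 : ℕ) : ℝ) * omega n j = ((j + 1 : ℕ) : ℝ) * Real.pi := by
      unfold omega
      push_cast
      field_simp
    have h4 := Real.sin_nat_mul_pi (j + 1)
    rw [← this] at h4
    exact_mod_cast congrArg (fun r : ℝ => (r : ℂ)) h4
  rw [h1, h2, mul_pow, mul_pow, Complex.cos_add_sin_mul_I_pow, Complex.cos_add_sin_mul_I_pow,
    mul_neg, Complex.cos_neg, Complex.sin_neg, h3]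
  simp

/-- The `-b_j` are the `n` zeros of the monic polynomial on the right, by `neg_wave_pow`. -/
lemma prod_add_wave {n : ℕ} {lam0 : ℂ} (hre : lam0.re = 0) (him : lam0.im ≠ 0) (z : ℂ) :
    ∏ s, (z + (wave n lam0 s : ℂ))
      = ((z + Complex.I * zeta n lam0) ^ (n + 1) - (z - Complex.I * zeta n lam0) ^ (n + 1))
        / (2 * Complex.I * (n + 1) * zeta n lam0) := by
  have hζ : (zeta n lam0 : ℂ) ≠ 0 := by exact_mod_cast zeta_ne_zero n him
  have hn : ((n : ℂ) + 1) ≠ 0 := by exact_mod_cast Nat.succ_ne_zero n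
  set c : ℂ := Complex.I * zeta n lam0 with hc
  set d : ℂ := 2 * Complex.I * (n + 1) * zeta n lam0 with hd
  have hd0 : d ≠ 0 := by simp [hd, hζ, hn]
  let p : Polynomial ℂ := ∏ s : Fin n, (Polynomial.X + Polynomial.C (wave n lam0 s : ℂ))
  let q : Polynomial ℂ := Polynomial.C d⁻¹ *
    ((Polynomial.X + Polynomial.C c) ^ (n + 1) - (Polynomial.X + Polynomial.C (-c)) ^ (n + 1))
  have hpm : p.Monic := Polynomial.monic_prod_of_monic _ _ fun s _ => Polynomial.monic_X_add_C _
  have hpd : p.natDegree = n := by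
    rw [Polynomial.natDegree_prod_of_monic _ _ fun s _ => Polynomial.monic_X_add_C _]
    simp
  -- The difference has degree less than `n`, since the leading coefficients agree, and it vanishes
  -- at the `n` distinct points `-b_j`.
  have hpq : p = q := by
    refine Polynomial.eq_of_degree_sub_lt_of_eval_index_eq (s := Finset.univ)
      (v := fun j : Fin n => -(wave n lam0 j : ℂ)) ?_ ?_ ?_
    · intro j _ k _ h
      have : wave n lam0 j = wave n lam0 k := by exact_mod_cast neg_injective h
      exact wave_injective hre him this
    · rw [Polynomial.degree_lt_iff_coeff_zero]
      intro m hm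
      simp only [Finset.card_univ, Fintype.card_fin] at hm
      rw [Polynomial.coeff_sub, sub_eq_zero]
      simp only [q, Polynomial.coeff_C_mul, Polynomial.coeff_sub, Polynomial.coeff_X_add_C_pow]
      rcases hm.eq_or_lt with rfl | hlt
      · rw [← hpd, hpm.coeff_natDegree, hpd]
        simp only [Nat.add_sub_cancel_left, Nat.choose_succ_self_right, pow_one]
        push_cast
        field_simp
        rw [hd, hc]
        ring
      · rw [Polynomial.coeff_eq_zero_of_natDegree_lt (by omega)]
        rcases (Nat.succ_le_of_lt hlt).eq_or_lt with h | h
        · simp only [Nat.succ_eq_add_one] at h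
          rw [← h]
          simp
        · rw [Nat.choose_eq_zero_of_lt h]
          simp
    · intro j _
      have h1 : p.eval (-(wave n lam0 j : ℂ)) = 0 := by
        simp only [p, Polynomial.eval_prod]
        exact Finset.prod_eq_zero (Finset.mem_univ j) (by simp)
      have h2 : q.eval (-(wave n lam0 j : ℂ)) = 0 := by
        simp only [q, Polynomial.eval_mul, Polynomial.eval_C, Polynomial.eval_sub,
          Polynomial.eval_pow, Polynomial.eval_add, Polynomial.eval_X]
        rw [neg_wave_pow hre, sub_eq_add_neg (-(wave n lam0 j : ℂ))]
        simp [hc]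
      rw [h1, h2]
  have h := congrArg (Polynomial.eval z) hpq
  simp only [p, q, Polynomial.eval_prod, Polynomial.eval_mul, Polynomial.eval_C,
    Polynomial.eval_sub, Polynomial.eval_pow, Polynomial.eval_add, Polynomial.eval_X] at h
  rw [h, sub_eq_add_neg z, div_eq_inv_mul]

lemma hasDerivAt_prod_add_wave {n : ℕ} {lam0 z : ℂ} (hz : ∀ j, z + (wave n lam0 j : ℂ) ≠ 0) :
    HasDerivAt (fun z : ℂ => ∏ s, (z + (wave n lam0 s : ℂ)))
      ((∏ s, (z + (wave n lam0 s : ℂ))) * ∑ j, 1 / (z + (wave n lam0 j : ℂ))) z := by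
  have h := HasDerivAt.fun_finsetProd (u := Finset.univ)
    (f := fun (s : Fin n) (z : ℂ) => z + (wave n lam0 s : ℂ)) (f' := fun _ => (1 : ℂ)) (x := z)
    (fun s _ => (hasDerivAt_id z).add_const _)
  refine h.congr_deriv ?_
  rw [Finset.mul_sum]
  refine Finset.sum_congr rfl fun j _ => ?_
  rw [← Finset.mul_prod_erase _ _ (Finset.mem_univ j)]
  have := hz j
  simp only [smul_eq_mul]
  field_simp

/-- The choice of the background makes the characteristic polynomial of `H(λ₀) + λ₀ I` a pure
power: divided by `∏ (z + b_s)`, it reads `z - 2 λ₀ - ∑ a_j² / (z + b_j)`. -/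
lemma sum_amp_sq_div {n : ℕ} {lam0 z : ℂ} (hre : lam0.re = 0) (him : lam0.im ≠ 0)
    (hz : ∀ j, z + (wave n lam0 j : ℂ) ≠ 0) :
    ∑ j, (amp n lam0 j : ℂ) ^ 2 / (z + (wave n lam0 j : ℂ))
      = z - 2 * lam0 - (z - z0 n lam0) ^ (n + 1) / ∏ s, (z + (wave n lam0 s : ℂ)) := by
  have hζ : (zeta n lam0 : ℂ) ≠ 0 := by exact_mod_cast zeta_ne_zero n him
  have hn : ((n : ℂ) + 1) ≠ 0 := by exact_mod_cast Nat.succ_ne_zero n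
  set c : ℂ := Complex.I * zeta n lam0 with hc
  have hc2 : c ^ 2 = -(zeta n lam0 : ℂ) ^ 2 := by
    rw [hc, mul_pow, Complex.I_sq]; ring
  have hP : ∏ s, (z + (wave n lam0 s : ℂ)) ≠ 0 := Finset.prod_ne_zero_iff.2 fun j _ => hz j
  have hd := hasDerivAt_prod_add_wave hz
  have hfun : (fun z : ℂ => ∏ s, (z + (wave n lam0 s : ℂ))) = fun z : ℂ =>
      ((z + c) ^ (n + 1) - (z - c) ^ (n + 1)) / (2 * Complex.I * (n + 1) * zeta n lam0) :=
    funext fun z => prod_add_wave hre him z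
  have hd2 : HasDerivAt (fun z : ℂ =>
      ((z + c) ^ (n + 1) - (z - c) ^ (n + 1)) / (2 * Complex.I * (n + 1) * zeta n lam0))
      (((n + 1) * (z + c) ^ n - (n + 1) * (z - c) ^ n)
        / (2 * Complex.I * (n + 1) * zeta n lam0)) z := by
    have h1 := (((hasDerivAt_id z).add_const c).pow (n + 1)).sub
      (((hasDerivAt_id z).sub_const c).pow (n + 1))
    have h2 := h1.div_const (2 * Complex.I * (n + 1) * zeta n lam0)
    refine h2.congr_deriv ?_
    simp
  rw [hfun] at hd
  have hu := hd.unique hd2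
  have hPz := prod_add_wave (n := n) hre him z
  rw [← hc] at hPz
  -- The sum reduces to that of `1 / (z + b_j)`, the logarithmic derivative of `∏ (z + b_j)`, which
  -- the closed form of the product gives.
  have hterm : ∀ j : Fin n, (amp n lam0 j : ℂ) ^ 2 / (z + (wave n lam0 j : ℂ))
      = (z ^ 2 - c ^ 2) * (1 / (z + (wave n lam0 j : ℂ))) - (z - wave n lam0 j) := by
    intro j
    have ha : (amp n lam0 j : ℂ) ^ 2 = (zeta n lam0 : ℂ) ^ 2 + (wave n lam0 j : ℂ) ^ 2 := by
      exact_mod_cast congrArg (fun r : ℝ => (r : ℂ)) (amp_sq hre j)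
    rw [ha, hc2]
    have := hz j
    field_simp
    ring
  have hsw : ∑ j, (wave n lam0 j : ℂ) = 0 := by
    exact_mod_cast congrArg (fun r : ℝ => (r : ℂ)) (sum_wave (n := n) hre)
  simp only [hterm, Finset.sum_sub_distrib, ← Finset.mul_sum, hsw]
  rw [z0_eq hre, ← hc, two_mul_lam0 n hre]
  set S := ∑ j, 1 / (z + (wave n lam0 j : ℂ)) with hS
  set D := ∏ s, (z + (wave n lam0 s : ℂ)) with hD
  have e1 : D * S * (2 * c) = (z + c) ^ n - (z - c) ^ n := by
    rw [hu, hc]; field_simp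
  have e2 : D * (2 * c * (n + 1)) = (z + c) ^ (n + 1) - (z - c) ^ (n + 1) := by
    rw [hPz, hc]; field_simp
  have hc0 : (2 * c) ≠ 0 := by simp [hc, hζ]
  have : D * ((z ^ 2 - c ^ 2) * S - n * z) = D * (z - (n + 1) * c) - (z - c) ^ (n + 1) := by
    apply mul_left_cancel₀ hc0
    linear_combination (z ^ 2 - c ^ 2) * e1 - (z - c) * e2
  simp only [Finset.sum_const, Finset.card_univ, Fintype.card_fin, nsmul_eq_mul, sub_zero]
  rw [show Complex.I * ((n : ℂ) + 1) * zeta n lam0 = (n + 1) * c by rw [hc]; ring]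
  field_simp
  linear_combination this

/-- The determinant of a matrix that is diagonal outside its first row and column: Schur complement
with respect to the diagonal block. -/
lemma det_arrowhead {n : ℕ} (A : Matrix (Fin (n + 1)) (Fin (n + 1)) ℂ)
    (hoff : ∀ j k : Fin n, j ≠ k → A j.succ k.succ = 0) (hd : ∀ j : Fin n, A j.succ j.succ ≠ 0) :
    A.det = (∏ j : Fin n, A j.succ j.succ) *
      (A 0 0 - ∑ j : Fin n, A 0 j.succ * A j.succ 0 / A j.succ j.succ) := by
  let e : Fin n ⊕ PUnit.{1} ≃ Fin (n + 1) :=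
    (Equiv.optionEquivSumPUnit (Fin n)).symm.trans (finSuccEquiv n).symm
  have hl : ∀ j, e (Sum.inl j) = j.succ := fun j => by simp [e]
  have hr : ∀ u, e (Sum.inr u) = 0 := fun u => by simp [e]
  rw [← Matrix.det_submatrix_equiv_self e A]
  have hb : A.submatrix e e = Matrix.fromBlocks (Matrix.diagonal fun j => A j.succ j.succ)
      (Matrix.of fun j _ => A j.succ 0) (Matrix.of fun _ k => A 0 k.succ)
      (Matrix.of fun _ _ => A 0 0) := by
    ext i k
    rcases i with i | i <;> rcases k with k | k <;>
      simp [hl, hr, Matrix.diagonal_apply]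
    split_ifs with h
    · rw [h]
    · exact hoff i k h
  have hD : (Matrix.diagonal fun j : Fin n => A j.succ j.succ)
      * Matrix.diagonal (fun j : Fin n => (A j.succ j.succ)⁻¹) = 1 := by
    rw [Matrix.diagonal_mul_diagonal, ← Matrix.diagonal_one]
    congr 1
    exact funext fun j => mul_inv_cancel₀ (hd j)
  let hI : Invertible (Matrix.diagonal fun j : Fin n => A j.succ j.succ) :=
    ⟨_, mul_eq_one_comm.1 hD, hD⟩
  rw [hb, Matrix.det_fromBlocks₁₁, Matrix.det_diagonal, Matrix.det_unique,
    invOf_eq_right_inv hD]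
  congr 1
  simp only [Matrix.sub_apply, Matrix.of_apply, Matrix.mul_apply,
    Matrix.diagonal_apply]
  congr 1
  refine Finset.sum_congr rfl fun j _ => ?_
  simp
  ring

lemma f_z0_ne_zero {n : ℕ} {lam0 : ℂ} (him : lam0.im ≠ 0) : f n lam0 (z0 n lam0) ≠ 0 := by
  unfold f
  refine mul_ne_zero (mul_ne_zero two_ne_zero ?_) (Finset.prod_ne_zero_iff.2 fun j _ => ?_)
  · rintro rfl
    simp at him
  · intro h
    have := congrArg Complex.im h
    simp [z0] at this
    exact zeta_ne_zero n him this

lemma z0_add_wave_ne_zero {n : ℕ} {lam0 : ℂ} (him : lam0.im ≠ 0) (j : Fin n) :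
    z0 n lam0 + (wave n lam0 j : ℂ) ≠ 0 := by
  intro h
  have := congrArg Complex.im h
  simp [z0] at this
  exact zeta_ne_zero n him this

lemma analyticAt_f (n : ℕ) (lam0 z : ℂ) : AnalyticAt ℂ (f n lam0) z := by
  unfold f
  refine AnalyticAt.mul analyticAt_const (Finset.analyticAt_fun_prod _ fun s _ => ?_)
  exact analyticAt_id.add analyticAt_const

/-- The eigenvalue equation of `H(λ) + λ I` at `λ = λ₀ (1 + ε^{n+1})` is
`(z - z₀)^{n+1} = ε^{n+1} f(z)`. -/
lemma charpoly_matH {n : ℕ} {lam0 : ℂ} (hre : lam0.re = 0) (him : lam0.im ≠ 0) (ε : ℂ) :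
    (matH n lam0 (lamEps n lam0 ε) + lamEps n lam0 ε • 1).charpoly
      = (Polynomial.X - Polynomial.C (z0 n lam0)) ^ (n + 1)
        - Polynomial.C (ε ^ (n + 1) * (2 * lam0)) *
          ∏ s : Fin n, (Polynomial.X + Polynomial.C (wave n lam0 s : ℂ)) := by
  -- The two polynomials are compared off the poles `-b_j`, where the arrowhead formula applies.
  refine Polynomial.eq_of_infinite_eval_eq _ _ ?_
  have hfin : (Set.range fun j : Fin n => -(wave n lam0 j : ℂ)).Finite := Set.finite_range _
  refine hfin.infinite_compl.mono fun z hz => ?_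
  have hz' : ∀ j : Fin n, z + (wave n lam0 j : ℂ) ≠ 0 := by
    intro j h
    exact hz ⟨j, (eq_neg_of_add_eq_zero_left h).symm⟩
  have hP : ∏ s, (z + (wave n lam0 s : ℂ)) ≠ 0 := Finset.prod_ne_zero_iff.2 fun j _ => hz' j
  simp only [Set.mem_ofPred_eq, Polynomial.eval_sub, Polynomial.eval_mul, Polynomial.eval_pow,
    Polynomial.eval_X, Polynomial.eval_C, Polynomial.eval_prod, Polynomial.eval_add]
  have hdiag : ∀ j : Fin n, (Matrix.scalar (Fin (n + 1)) z
      - (matH n lam0 (lamEps n lam0 ε) + lamEps n lam0 ε • 1)) j.succ j.succ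
      = z + (wave n lam0 j : ℂ) := by
    intro j
    simp [matH]
    ring
  rw [Matrix.eval_charpoly, det_arrowhead]
  · simp only [hdiag]
    have h0 : ∀ j : Fin n, (Matrix.scalar (Fin (n + 1)) z
      - (matH n lam0 (lamEps n lam0 ε) + lamEps n lam0 ε • 1)) 0 j.succ *
        (Matrix.scalar (Fin (n + 1)) z
      - (matH n lam0 (lamEps n lam0 ε) + lamEps n lam0 ε • 1)) j.succ 0
      = (amp n lam0 j : ℂ) ^ 2 := by
      intro j
      simp [matH, (Fin.succ_ne_zero j).symm]
      ring
    simp only [h0, sum_amp_sq_div hre him hz']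
    simp [matH, lamEps]
    field_simp
    ring
  · intro j k hjk
    simp [matH, hjk]
  · intro j
    rw [hdiag]
    exact hz' j

/-! ### Taylor series at the origin -/

/-- The Taylor series of `u` at `0`, as a formal power series. -/
noncomputable def taylor (u : ℂ → ℂ) : PowerSeries ℂ :=
  PowerSeries.mk fun j => iteratedDeriv j u 0 / (j.factorial : ℂ)

lemma coeff_taylor (u : ℂ → ℂ) (j : ℕ) :
    PowerSeries.coeff j (taylor u) = iteratedDeriv j u 0 / (j.factorial : ℂ) := by
  simp [taylor]

lemma taylor_congr {u v : ℂ → ℂ} (h : u =ᶠ[𝓝 0] v) : taylor u = taylor v := by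
  ext j
  rw [coeff_taylor, coeff_taylor, (h.iteratedDeriv j).eq_of_nhds]

lemma taylor_mul {u v : ℂ → ℂ} (hu : AnalyticAt ℂ u 0) (hv : AnalyticAt ℂ v 0) :
    taylor (fun ε => u ε * v ε) = taylor u * taylor v := by
  ext j
  rw [coeff_taylor, iteratedDeriv_fun_mul hu.contDiffAt hv.contDiffAt, PowerSeries.coeff_mul,
    Finset.Nat.sum_antidiagonal_eq_sum_range_succ_mk, Finset.sum_div]
  refine Finset.sum_congr rfl fun i hi => ?_
  have hij : i ≤ j := Nat.lt_succ_iff.1 (Finset.mem_range.1 hi)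
  rw [coeff_taylor, coeff_taylor, Nat.cast_choose ℂ hij]
  have h1 : (i.factorial : ℂ) ≠ 0 := by exact_mod_cast i.factorial_ne_zero
  have h2 : ((j - i).factorial : ℂ) ≠ 0 := by exact_mod_cast (j - i).factorial_ne_zero
  have h3 : (j.factorial : ℂ) ≠ 0 := by exact_mod_cast j.factorial_ne_zero
  field_simp

lemma taylor_add {u v : ℂ → ℂ} (hu : AnalyticAt ℂ u 0) (hv : AnalyticAt ℂ v 0) :
    taylor (fun ε => u ε + v ε) = taylor u + taylor v := by
  ext j
  rw [coeff_taylor, iteratedDeriv_fun_add hu.contDiffAt hv.contDiffAt, map_add, coeff_taylor,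
    coeff_taylor, add_div]

lemma taylor_const_mul (c : ℂ) (u : ℂ → ℂ) :
    taylor (fun ε => c * u ε) = PowerSeries.C c * taylor u := by
  ext j
  rw [coeff_taylor, PowerSeries.coeff_C_mul, coeff_taylor, iteratedDeriv_const_mul_field,
    mul_div_assoc]

lemma taylor_sum {ι : Type*} (s : Finset ι) {u : ι → ℂ → ℂ} (hu : ∀ i ∈ s, AnalyticAt ℂ (u i) 0) :
    taylor (fun ε => ∑ i ∈ s, u i ε) = ∑ i ∈ s, taylor (u i) := by
  ext j
  rw [coeff_taylor, iteratedDeriv_fun_sum fun i hi => (hu i hi).contDiffAt, map_sum,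
    Finset.sum_div]
  simp only [coeff_taylor]

lemma taylor_id : taylor (fun ε => ε) = PowerSeries.X := by
  ext j
  rw [coeff_taylor, PowerSeries.coeff_X]
  rcases j with _ | _ | j
  · simp
  · simp [iteratedDeriv_one]
  · have : deriv (fun ε : ℂ => ε) = fun _ => 1 := by ext; simp
    rw [iteratedDeriv_succ', this, iteratedDeriv_const]
    simp

lemma taylor_pow (m : ℕ) : taylor (fun ε => ε ^ m) = PowerSeries.X ^ m := by
  induction m with
  | zero =>
    ext j
    simp only [pow_zero, coeff_taylor, iteratedDeriv_const, PowerSeries.coeff_one]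
    split_ifs with h
    · simp [h]
    · simp
  | succ m ih =>
    have h := taylor_mul (u := fun ε : ℂ => ε ^ m) (v := fun ε => ε)
      (analyticAt_id.pow m) analyticAt_id
    simpa only [← pow_succ, ih, taylor_id] using h

lemma iteratedDeriv_succ_id_mul {v : ℂ → ℂ} (hv : AnalyticAt ℂ v 0) (i : ℕ) :
    iteratedDeriv (i + 1) (fun ε => ε * v ε) 0 = (i + 1) * iteratedDeriv i v 0 := by
  have h := congrArg (PowerSeries.coeff (i + 1)) (taylor_mul (u := fun ε => ε) analyticAt_id hv)
  rw [taylor_id, coeff_taylor, PowerSeries.coeff_succ_X_mul, coeff_taylor] at h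
  have h1 : (i.factorial : ℂ) ≠ 0 := by exact_mod_cast i.factorial_ne_zero
  have h2 : ((i : ℂ) + 1) ≠ 0 := by exact_mod_cast i.succ_ne_zero
  rw [Nat.factorial_succ] at h
  push_cast at h
  field_simp at h
  linear_combination h

lemma hasSum_taylor {u : ℂ → ℂ} (hu : AnalyticAt ℂ u 0) :
    ∀ᶠ ε in 𝓝 (0 : ℂ), HasSum (fun j => ε ^ j * PowerSeries.coeff j (taylor u)) (u ε) := by
  have h := hasFPowerSeriesAt_iff.1 hu.hasFPowerSeriesAt
  filter_upwards [h] with ε hε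
  simpa [FormalMultilinearSeries.coeff_ofScalars, coeff_taylor] using hε

/-! ### Lagrange inversion -/

/-- The Lagrange inversion formula for the solution `μ` of `μ - a = ε g(μ)`, in the form that
carries the induction: differentiating the equation gives
`(k ∘ μ) μ' = (k g) ∘ μ + ε ((g' k) ∘ μ) μ'`, which lowers the order by one. -/
lemma iteratedDeriv_comp_mul_deriv {g μ : ℂ → ℂ} {a : ℂ} (hg : AnalyticAt ℂ g a)
    (hμ : AnalyticAt ℂ μ 0) (h0 : μ 0 = a) (hμg : ∀ᶠ ε in 𝓝 (0 : ℂ), μ ε - a = ε * g (μ ε))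
    (i : ℕ) : ∀ k : ℂ → ℂ, AnalyticAt ℂ k a →
      iteratedDeriv i (fun ε => k (μ ε) * deriv μ ε) 0
        = iteratedDeriv i (fun z => k z * g z ^ (i + 1)) a := by
  have hcomp : ∀ k : ℂ → ℂ, AnalyticAt ℂ k a → AnalyticAt ℂ (fun ε => k (μ ε)) 0 := fun k hk =>
    AnalyticAt.fun_comp (by rwa [h0]) hμ
  have hev : ∀ k : ℂ → ℂ, AnalyticAt ℂ k a → ∀ᶠ ε in 𝓝 (0 : ℂ), AnalyticAt ℂ k (μ ε) :=
    fun k hk => hμ.continuousAt.tendsto.eventually (by rw [h0]; exact hk.eventually_analyticAt)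
  have hd : ∀ᶠ ε in 𝓝 (0 : ℂ), deriv μ ε = g (μ ε) + ε * (deriv g (μ ε) * deriv μ ε) := by
    filter_upwards [hμg.eventually_nhds, hμ.eventually_analyticAt, hev g hg] with ε h1 h2 h3
    have e1 : deriv (fun ε => μ ε - a) ε = deriv (fun ε => ε * g (μ ε)) ε :=
      Filter.EventuallyEq.deriv_eq h1
    have e2 : HasDerivAt (fun ε => ε * g (μ ε))
        (1 * g (μ ε) + ε * (deriv g (μ ε) * deriv μ ε)) ε :=
      (hasDerivAt_id ε).mul
        (HasDerivAt.comp ε h3.differentiableAt.hasDerivAt h2.differentiableAt.hasDerivAt)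
    rwa [e2.deriv, deriv_sub_const, one_mul] at e1
  induction i with
  | zero =>
    intro k _
    have := hd.self_of_nhds
    simp only [iteratedDeriv_zero, zero_add, pow_one]
    rw [h0] at this ⊢
    rw [this]
    ring
  | succ i ih =>
    intro k hk
    have hkg : AnalyticAt ℂ (fun z => k z * g z) a := hk.mul hg
    have hgk : AnalyticAt ℂ (fun z => deriv g z * k z) a := hg.deriv.mul hk
    have hv : AnalyticAt ℂ (fun ε => deriv g (μ ε) * k (μ ε) * deriv μ ε) 0 :=
      (hcomp _ hgk).mul hμ.deriv
    have e1 : (fun ε => k (μ ε) * deriv μ ε) =ᶠ[𝓝 0] fun ε =>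
        k (μ ε) * g (μ ε) + ε * (deriv g (μ ε) * k (μ ε) * deriv μ ε) := by
      filter_upwards [hd] with ε h
      linear_combination (k (μ ε)) * h
    have e2 : deriv (fun ε => k (μ ε) * g (μ ε)) =ᶠ[𝓝 0] fun ε =>
        deriv (fun z => k z * g z) (μ ε) * deriv μ ε := by
      filter_upwards [hμ.eventually_analyticAt, hev _ hkg] with ε h2 h3
      exact (HasDerivAt.comp ε h3.differentiableAt.hasDerivAt
        h2.differentiableAt.hasDerivAt).deriv
    have hεv : AnalyticAt ℂ (fun ε => ε * (deriv g (μ ε) * k (μ ε) * deriv μ ε)) 0 :=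
      analyticAt_id.mul hv
    have hr1 : AnalyticAt ℂ (fun z => deriv (fun z => k z * g z) z * g z ^ (i + 1)) a :=
      hkg.deriv.mul (hg.pow _)
    have hr2 : AnalyticAt ℂ (fun z => ((i : ℂ) + 1) * (deriv g z * k z * g z ^ (i + 1))) a :=
      analyticAt_const.mul (hgk.mul (hg.pow _))
    rw [(e1.iteratedDeriv (i + 1)).eq_of_nhds,
      iteratedDeriv_fun_add (hcomp _ hkg).contDiffAt hεv.contDiffAt,
      iteratedDeriv_succ_id_mul hv, iteratedDeriv_succ', (e2.iteratedDeriv i).eq_of_nhds,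
      ih _ hkg.deriv, ih _ hgk, iteratedDeriv_succ' (n := i), ← iteratedDeriv_const_mul_field,
      ← iteratedDeriv_fun_add hr1.contDiffAt hr2.contDiffAt]
    refine Filter.EventuallyEq.eq_of_nhds (Filter.EventuallyEq.iteratedDeriv ?_ i)
    filter_upwards [hk.eventually_analyticAt, hg.eventually_analyticAt] with z h1 h2
    have d1 := h1.differentiableAt.hasDerivAt
    have d2 := h2.differentiableAt.hasDerivAt
    have d3 : HasDerivAt (fun z => k z * g z) (deriv k z * g z + k z * deriv g z) z := d1.mul d2
    have d4 : HasDerivAt (fun z => k z * g z ^ (i + 1 + 1)) (deriv k z * g z ^ (i + 1 + 1)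
      + k z * (((i + 1 + 1 : ℕ) : ℂ) * g z ^ (i + 1) * deriv g z)) z := d1.mul (d2.pow (i + 1 + 1))
    rw [d3.deriv, d4.deriv]
    push_cast
    ring

lemma iteratedDeriv_lagrange {g μ : ℂ → ℂ} {a : ℂ} (hg : AnalyticAt ℂ g a)
    (hμ : AnalyticAt ℂ μ 0) (h0 : μ 0 = a) (hμg : ∀ᶠ ε in 𝓝 (0 : ℂ), μ ε - a = ε * g (μ ε))
    {i : ℕ} (hi : 1 ≤ i) :
    iteratedDeriv i μ 0 = iteratedDeriv (i - 1) (fun z => g z ^ i) a := by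
  obtain ⟨i, rfl⟩ := Nat.exists_eq_add_of_le' hi
  have h := iteratedDeriv_comp_mul_deriv hg hμ h0 hμg i (fun _ => 1) analyticAt_const
  simpa [iteratedDeriv_succ'] using h

/-- The equation `μ - a = ε G(μ)` has one and only one solution germ with `μ(0) = a`. -/
lemma exists_solution_germ {G : ℂ → ℂ} {a : ℂ} (hG : AnalyticAt ℂ G a) (hGa : G a ≠ 0) :
    ∃ μ : ℂ → ℂ, AnalyticAt ℂ μ 0 ∧ μ 0 = a ∧ (∀ᶠ ε in 𝓝 (0 : ℂ), μ ε - a = ε * G (μ ε)) ∧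
      ∀ ν : ℂ → ℂ, ContinuousAt ν 0 → ν 0 = a → (∀ᶠ ε in 𝓝 (0 : ℂ), ν ε - a = ε * G (ν ε)) →
        ν =ᶠ[𝓝 0] μ := by
  -- The equation says `φ(μ(ε)) = ε`, so `μ` is the local inverse of `φ`.
  let φ : ℂ → ℂ := fun z => (z - a) / G z
  have hφ : AnalyticAt ℂ φ a := (analyticAt_id.sub analyticAt_const).div hG hGa
  have hφ0 : φ a = 0 := by simp [φ]
  have hd : HasDerivAt φ (G a)⁻¹ a := by
    have := ((hasDerivAt_id a).sub_const a).div hG.differentiableAt.hasDerivAt hGa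
    refine this.congr_deriv ?_
    simp
    field_simp
  have hφ' : deriv φ a ≠ 0 := by rw [hd.deriv]; exact inv_ne_zero hGa
  have hs := hφ.hasStrictDerivAt
  have hGne : ∀ᶠ z in 𝓝 a, G z ≠ 0 := hG.continuousAt.eventually_ne hGa
  refine ⟨hs.localInverse φ _ a hφ', ?_, ?_, ?_, ?_⟩
  · have := hφ.analyticAt_localInverse hφ'
    rwa [hφ0] at this
  · have := (hs.eventually_left_inverse hφ').self_of_nhds
    rwa [hφ0] at this
  · have h1 := hs.eventually_right_inverse hφ'
    rw [hφ0] at h1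
    have h2 := (hs.eventually_left_inverse hφ').self_of_nhds
    rw [hφ0] at h2
    have h3 : ContinuousAt (hs.localInverse φ _ a hφ') 0 := by
      have := (hφ.analyticAt_localInverse hφ').continuousAt
      rwa [hφ0] at this
    have h4 := h3.tendsto.eventually (by rw [h2]; exact hGne)
    filter_upwards [h1, h4] with ε e1 e2
    simp only [φ] at e1
    rwa [div_eq_iff e2] at e1
  · intro ν hν hν0 hνe
    have h1 := hν.tendsto.eventually (by rw [hν0]; exact hs.eventually_left_inverse hφ')
    have h2 := hν.tendsto.eventually (by rw [hν0]; exact hGne)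
    filter_upwards [h1, h2, hνe] with ε e1 e2 e3
    have : φ (ν ε) = ε := by simp only [φ]; rw [e3, mul_div_assoc, div_self e2, mul_one]
    rw [this] at e1
    exact e1.symm

/-! ### The branches of the `(n+1)`-st root of `f` -/

/-- The primitive root of unity `exp(2πi/(n+1))`. -/
noncomputable def rot (n : ℕ) : ℂ := Complex.exp (2 * Real.pi * Complex.I / ((n + 1 : ℕ) : ℂ))

lemma isPrimitiveRoot_rot (n : ℕ) : IsPrimitiveRoot (rot n) (n + 1) :=
  Complex.isPrimitiveRoot_exp (n + 1) n.succ_ne_zero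

lemma g_eq_rot_mul (n : ℕ) (lam0 : ℂ) (k : Fin (n + 1)) (z : ℂ) :
    g n lam0 k z = rot n ^ (k : ℕ) * g n lam0 0 z := by
  have hn : ((n : ℂ) + 1) ≠ 0 := by exact_mod_cast Nat.succ_ne_zero n
  unfold g rot
  rw [← Complex.exp_nat_mul, mul_left_comm, ← Complex.exp_add]
  congr 2
  push_cast
  field_simp
  simp
  ring

lemma f_exp {n : ℕ} {lam0 z : ℂ} (him : lam0.im ≠ 0) (hz : f n lam0 z ≠ 0) :
    Complex.exp (Complex.I * argF n lam0 z) = f n lam0 z / ‖f n lam0 z‖ := by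
  have h0 := f_z0_ne_zero (n := n) him
  set a := f n lam0 (z0 n lam0) with ha
  have h2 : f n lam0 z / a ≠ 0 := div_ne_zero hz h0
  have e1 := Complex.norm_mul_exp_arg_mul_I a
  have e2 := Complex.norm_mul_exp_arg_mul_I (f n lam0 z / a)
  have n1 : (‖a‖ : ℂ) ≠ 0 := by exact_mod_cast norm_ne_zero_iff.2 h0
  have n2 : (‖f n lam0 z‖ : ℂ) ≠ 0 := by exact_mod_cast norm_ne_zero_iff.2 hz
  unfold argF
  rw [← ha]
  push_cast
  rw [mul_add, Complex.exp_add, mul_comm Complex.I (a.arg : ℂ),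
    mul_comm Complex.I ((f n lam0 z / a).arg : ℂ)]
  rw [norm_div] at e2
  push_cast at e2
  field_simp at e2 ⊢
  have e3 : Complex.exp (Complex.I * a.arg) = a / ‖a‖ := by
    rw [mul_comm Complex.I, eq_div_iff n1]
    linear_combination e1
  rw [e3]
  field_simp
  linear_combination e2

lemma g_pow {n : ℕ} {lam0 z : ℂ} (him : lam0.im ≠ 0) (hz : f n lam0 z ≠ 0) (k : Fin (n + 1)) :
    g n lam0 k z ^ (n + 1) = f n lam0 z := by
  have hn : ((n : ℝ) + 1) ≠ 0 := by positivity
  have hn' : ((n : ℂ) + 1) ≠ 0 := by exact_mod_cast hn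
  have n2 : (‖f n lam0 z‖ : ℂ) ≠ 0 := by exact_mod_cast norm_ne_zero_iff.2 hz
  unfold g
  rw [mul_pow, ← Complex.exp_nat_mul]
  have h1 : (((‖f n lam0 z‖ ^ (1 / ((n : ℝ) + 1)) : ℝ) : ℂ)) ^ (n + 1) = ‖f n lam0 z‖ := by
    rw [← Complex.ofReal_pow, ← Real.rpow_natCast, ← Real.rpow_mul (norm_nonneg _)]
    push_cast
    rw [one_div_mul_cancel hn, Real.rpow_one]
  have h2 : ((n + 1 : ℕ) : ℂ) * (Complex.I *
      (((argF n lam0 z + 2 * (k : ℝ) * Real.pi) / ((n : ℝ) + 1) : ℝ) : ℂ))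
      = Complex.I * argF n lam0 z + (k : ℕ) * (2 * Real.pi * Complex.I) := by
    push_cast
    field_simp
  rw [h1, h2, Complex.exp_add, Complex.exp_nat_mul_two_pi_mul_I, f_exp him hz]
  field_simp

lemma g_z0_ne_zero {n : ℕ} {lam0 : ℂ} (him : lam0.im ≠ 0) (k : Fin (n + 1)) :
    g n lam0 k (z0 n lam0) ≠ 0 := by
  intro h
  have := g_pow him (f_z0_ne_zero him) k
  rw [h, zero_pow n.succ_ne_zero] at this
  exact f_z0_ne_zero him this.symm

/-- Near `z₀`, `g_k` is the constant `g_k(z₀)` times `exp (log (f / f(z₀)) / (n + 1))`, with the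
principal logarithm near `1`. -/
lemma analyticAt_g {n : ℕ} {lam0 : ℂ} (him : lam0.im ≠ 0) (k : Fin (n + 1)) :
    AnalyticAt ℂ (g n lam0 k) (z0 n lam0) := by
  have h0 := f_z0_ne_zero (n := n) him
  have hn : ((n : ℝ) + 1) ≠ 0 := by positivity
  have hn' : ((n : ℂ) + 1) ≠ 0 := by exact_mod_cast hn
  set a := f n lam0 (z0 n lam0) with ha
  have hfa := analyticAt_f n lam0 (z0 n lam0)
  have hA : AnalyticAt ℂ (fun z => g n lam0 k (z0 n lam0) *
      Complex.exp (Complex.log (f n lam0 z / a) / (n + 1))) (z0 n lam0) := by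
    refine analyticAt_const.mul (((AnalyticAt.clog ?_ ?_).div analyticAt_const hn').cexp)
    · exact hfa.div analyticAt_const h0
    · rw [← ha, div_self h0]
      exact Complex.one_mem_slitPlane
  refine hA.congr ?_
  filter_upwards [hfa.continuousAt.eventually_ne h0] with z hz
  have hq : f n lam0 z / a ≠ 0 := div_ne_zero hz h0
  have harg0 : argF n lam0 (z0 n lam0) = a.arg := by
    unfold argF
    rw [← ha, div_self h0, Complex.arg_one, add_zero]
  have hargz : argF n lam0 z = a.arg + (f n lam0 z / a).arg := rfl
  have hnorm : ‖f n lam0 z‖ ^ (1 / ((n : ℝ) + 1))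
      = ‖a‖ ^ (1 / ((n : ℝ) + 1)) * Real.exp (Real.log ‖f n lam0 z / a‖ / (n + 1)) := by
    have h1 : ‖f n lam0 z‖ = ‖a‖ * ‖f n lam0 z / a‖ := by
      rw [norm_div]
      have := norm_ne_zero_iff.2 h0
      field_simp
    rw [h1, Real.mul_rpow (norm_nonneg _) (norm_nonneg _),
      Real.rpow_def_of_pos (norm_pos_iff.2 hq)]
    congr 2
    ring
  unfold g
  rw [hnorm, harg0, hargz, ← ha, Complex.log]
  push_cast
  simp only [mul_assoc, ← Complex.exp_add]
  congr 2
  field_simp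
  ring

/-! ### The eigenvalue branches -/

lemma matH_eigenvalue_eq {n : ℕ} {lam0 ε z : ℂ} (hre : lam0.re = 0) (him : lam0.im ≠ 0)
    (h : z ∈ (matH n lam0 (lamEps n lam0 ε) + lamEps n lam0 ε • 1).charpoly.roots) :
    (z - z0 n lam0) ^ (n + 1) = ε ^ (n + 1) * f n lam0 z := by
  have h1 := (Polynomial.mem_roots'.1 h).2
  rw [charpoly_matH hre him] at h1
  simp only [Polynomial.IsRoot.def, Polynomial.eval_sub, Polynomial.eval_mul, Polynomial.eval_pow,
    Polynomial.eval_X, Polynomial.eval_C, Polynomial.eval_prod, Polynomial.eval_add] at h1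
  unfold f
  linear_combination h1

/-- A holomorphic eigenvalue branch solves the scalar equation `μ - z₀ = ε g_s(μ)`: the quotient
of the two sides is an `(n+1)`-st root of unity that tends to `1`. -/
lemma IsEigenvalueBranches.equation {n : ℕ} {lam0 : ℂ} (hre : lam0.re = 0) (him : lam0.im ≠ 0)
    {μ : Fin (n + 1) → ℂ → ℂ} (hμ : IsEigenvalueBranches n lam0 μ) (s : Fin (n + 1)) :
    μ s 0 = z0 n lam0 ∧
      ∀ᶠ ε in 𝓝 (0 : ℂ), μ s ε - z0 n lam0 = ε * g n lam0 s (μ s ε) := by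
  have hE : ∀ᶠ ε in 𝓝 (0 : ℂ),
      (μ s ε - z0 n lam0) ^ (n + 1) = ε ^ (n + 1) * f n lam0 (μ s ε) := by
    filter_upwards [hμ.eigenvalues] with ε hε
    refine matH_eigenvalue_eq hre him ?_
    rw [hε]
    exact Multiset.mem_map.2 ⟨s, Finset.mem_univ s, rfl⟩
  have h0 : μ s 0 = z0 n lam0 := by
    have := hE.self_of_nhds
    rw [zero_pow n.succ_ne_zero, zero_mul] at this
    exact sub_eq_zero.1 (pow_eq_zero_iff n.succ_ne_zero |>.1 this)
  refine ⟨h0, ?_⟩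
  have hcont := (hμ.analytic s).continuousAt
  have hgc : ContinuousAt (fun ε => g n lam0 s (μ s ε)) 0 :=
    ContinuousAt.comp' (by rw [h0]; exact (analyticAt_g him s).continuousAt) hcont
  have hg0 : g n lam0 s (μ s 0) ≠ 0 := by rw [h0]; exact g_z0_ne_zero him s
  have hfne : ∀ᶠ ε in 𝓝 (0 : ℂ), f n lam0 (μ s ε) ≠ 0 :=
    hcont.tendsto.eventually (by
      rw [h0]; exact (analyticAt_f n lam0 _).continuousAt.eventually_ne (f_z0_ne_zero him))
  have hdc : ContinuousAt (dslope (μ s) 0) 0 :=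
    continuousAt_dslope_same.2 (hμ.analytic s).differentiableAt
  have hq : ContinuousAt (fun ε => dslope (μ s) 0 ε / g n lam0 s (μ s ε)) 0 := hdc.div hgc hg0
  have hq0 : dslope (μ s) 0 0 / g n lam0 s (μ s 0) = 1 := by
    rw [dslope_same, hμ.numbering s, h0, div_self (g_z0_ne_zero him s)]
  have hfin : {w : ℂ | w ^ (n + 1) = 1 ∧ w ≠ 1}.Finite := by
    refine (Polynomial.nthRoots (n + 1) (1 : ℂ)).toFinset.finite_toSet.subset fun w hw => ?_
    simpa [Polynomial.mem_nthRoots n.succ_pos] using hw.1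
  have hnear : ∀ᶠ ε in 𝓝 (0 : ℂ),
      dslope (μ s) 0 ε / g n lam0 s (μ s ε) ∉ {w : ℂ | w ^ (n + 1) = 1 ∧ w ≠ 1} :=
    hq.tendsto.eventually (hfin.isClosed.isOpen_compl.mem_nhds (by rw [hq0]; simp))
  filter_upwards [hE, hnear, hfne, hgc.eventually_ne hg0] with ε e1 e2 e3 e4
  rcases eq_or_ne ε 0 with rfl | hε
  · simp [h0]
  have hsl : μ s ε - z0 n lam0 = ε * dslope (μ s) 0 ε := by
    have := sub_smul_dslope (μ s) 0 ε
    rw [h0] at this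
    simpa using this.symm
  have hp : (dslope (μ s) 0 ε / g n lam0 s (μ s ε)) ^ (n + 1) = 1 := by
    rw [hsl, mul_pow] at e1
    rw [div_pow, mul_left_cancel₀ (pow_ne_zero _ hε) e1, g_pow him e3, div_self e3]
  have h1 : dslope (μ s) 0 ε / g n lam0 s (μ s ε) = 1 := by
    by_contra hne
    exact e2 ⟨hp, hne⟩
  rw [hsl, (div_eq_one_iff_eq e4).1 h1]

/-- The solutions of the scalar equations `μ_s - z₀ = ε g_s(μ_s)` are roots of the characteristic
polynomial; for `ε ≠ 0` they are distinct, hence all of its roots. -/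
lemma exists_isEigenvalueBranches (n : ℕ) {lam0 : ℂ} (hre : lam0.re = 0) (him : lam0.im ≠ 0) :
    ∃ μ : Fin (n + 1) → ℂ → ℂ, IsEigenvalueBranches n lam0 μ := by
  choose μ hA h0 hE _ using fun s : Fin (n + 1) =>
    exists_solution_germ (analyticAt_g him s) (g_z0_ne_zero him s)
  refine ⟨μ, hA, ?_, ?_⟩
  · have hf : ∀ᶠ ε in 𝓝 (0 : ℂ), ∀ s, f n lam0 (μ s ε) ≠ 0 :=
      eventually_all.2 fun s => (hA s).continuousAt.tendsto.eventually (by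
        rw [h0 s]; exact (analyticAt_f n lam0 _).continuousAt.eventually_ne (f_z0_ne_zero him))
    filter_upwards [eventually_all.2 hE, hf] with ε hε hf
    have hcp := charpoly_matH (n := n) hre him ε
    rcases eq_or_ne ε 0 with rfl | hne
    · rw [hcp]
      simp [h0, Polynomial.roots_X_sub_C, Polynomial.roots_pow]
      rw [Multiset.nsmul_singleton, Multiset.replicate_succ]
    · have hinj : Function.Injective fun s => μ s ε := by
        intro s r hsr
        have h1 := hε s
        have h2 := hε r
        simp only at hsr
        rw [hsr, h2] at h1
        have h3 := mul_left_cancel₀ hne h1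
        rw [g_eq_rot_mul n lam0 r, g_eq_rot_mul n lam0 s] at h3
        have h4 : g n lam0 0 (μ r ε) ≠ 0 := by
          intro h
          have := g_pow him (hf r) 0
          rw [h, zero_pow n.succ_ne_zero] at this
          exact hf r this.symm
        have h5 := mul_right_cancel₀ h4 h3
        exact Fin.ext ((isPrimitiveRoot_rot n).pow_inj s.2 r.2 h5.symm)
      have hmonic := (matH n lam0 (lamEps n lam0 ε) + lamEps n lam0 ε • 1).charpoly_monic
      have hdeg : (matH n lam0 (lamEps n lam0 ε) + lamEps n lam0 ε • 1).charpoly.natDegree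
          = n + 1 := by simp [Matrix.charpoly_natDegree_eq_dim]
      symm
      refine Multiset.eq_of_le_of_card_le ?_ ?_
      · refine (Multiset.le_iff_subset (Finset.univ.nodup.map hinj)).2 fun z hz => ?_
        obtain ⟨s, -, rfl⟩ := Multiset.mem_map.1 hz
        refine (Polynomial.mem_roots hmonic.ne_zero).2 ?_
        rw [hcp]
        simp only [Polynomial.IsRoot.def, Polynomial.eval_sub, Polynomial.eval_mul,
          Polynomial.eval_pow, Polynomial.eval_X, Polynomial.eval_C, Polynomial.eval_prod,
          Polynomial.eval_add]
        have := hε s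
        rw [this, mul_pow, g_pow him (hf s)]
        unfold f
        ring
      · refine (Polynomial.card_roots' _).trans ?_
        rw [hdeg]
        simp
  · intro s
    have := iteratedDeriv_lagrange (analyticAt_g him s) (hA s) (h0 s) (hE s) le_rfl
    simpa [iteratedDeriv_one] using this

/-- All eigenvalue branches are rotations of one of them: `μ_s(ε) = μ_0(ω^s ε)` with
`ω = exp(2πi/(n+1))`. -/
lemma IsEigenvalueBranches.rotation {n : ℕ} {lam0 : ℂ} (hre : lam0.re = 0) (him : lam0.im ≠ 0)
    {μ : Fin (n + 1) → ℂ → ℂ} (hμ : IsEigenvalueBranches n lam0 μ) (s : Fin (n + 1)) :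
    ∀ᶠ ε in 𝓝 (0 : ℂ), μ s ε = μ 0 (rot n ^ (s : ℕ) * ε) := by
  obtain ⟨L, -, -, -, hL⟩ := exists_solution_germ (analyticAt_g (n := n) him s) (g_z0_ne_zero him s)
  obtain ⟨hs0, hs⟩ := hμ.equation hre him s
  obtain ⟨h00, h0⟩ := hμ.equation hre him 0
  have ht : Tendsto (fun ε : ℂ => rot n ^ (s : ℕ) * ε) (𝓝 0) (𝓝 0) := by
    have : Continuous fun ε : ℂ => rot n ^ (s : ℕ) * ε := by fun_prop
    simpa using this.tendsto 0
  have h1 := hL (μ s) (hμ.analytic s).continuousAt hs0 hs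
  have h2 := hL (fun ε => μ 0 (rot n ^ (s : ℕ) * ε))
    (ContinuousAt.comp' (by simpa using (hμ.analytic 0).continuousAt) (by fun_prop))
    (by simpa using h00)
    (by
      filter_upwards [ht.eventually h0] with ε hε
      rw [hε, g_eq_rot_mul n lam0 s]
      ring)
  exact h1.trans h2.symm

lemma IsEigenvalueBranches.eventually_add_wave_ne_zero {n : ℕ} {lam0 : ℂ} (hre : lam0.re = 0)
    (him : lam0.im ≠ 0) {μ : Fin (n + 1) → ℂ → ℂ} (hμ : IsEigenvalueBranches n lam0 μ)
    (s : Fin (n + 1)) :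
    ∀ᶠ ε in 𝓝 (0 : ℂ), ∀ j : Fin n, μ s ε + (wave n lam0 j : ℂ) ≠ 0 := by
  refine eventually_all.2 fun j => ?_
  have hc : ContinuousAt (fun ε => μ s ε + (wave n lam0 j : ℂ)) 0 :=
    (hμ.analytic s).continuousAt.add continuousAt_const
  refine hc.eventually_ne ?_
  rw [(hμ.equation hre him s).1]
  exact z0_add_wave_ne_zero him j

/-- The eigenvalue equation in the form in which the Lax pair uses it. -/
lemma IsEigenvalueBranches.sum_amp_sq_div {n : ℕ} {lam0 : ℂ} (hre : lam0.re = 0)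
    (him : lam0.im ≠ 0) {μ : Fin (n + 1) → ℂ → ℂ} (hμ : IsEigenvalueBranches n lam0 μ)
    (s : Fin (n + 1)) :
    ∀ᶠ ε in 𝓝 (0 : ℂ), ∑ j, (amp n lam0 j : ℂ) ^ 2 / (μ s ε + (wave n lam0 j : ℂ))
      = μ s ε - 2 * lamEps n lam0 ε := by
  filter_upwards [hμ.eventually_add_wave_ne_zero hre him s, hμ.eigenvalues] with ε hz hE
  have h1 := matH_eigenvalue_eq (n := n) (z := μ s ε) hre him (by
    rw [hE]; exact Multiset.mem_map.2 ⟨s, Finset.mem_univ s, rfl⟩)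
  rw [NNLS.sum_amp_sq_div hre him hz, h1]
  have hP : ∏ s', (μ s ε + (wave n lam0 s' : ℂ)) ≠ 0 := Finset.prod_ne_zero_iff.2 fun j _ => hz j
  unfold f lamEps
  field_simp
  ring

/-! ### The Lax pair on the plane wave -/

lemma hasDerivAt_euclideanSpace {n : ℕ} {q : ℝ → EuclideanSpace ℂ (Fin n)}
    {q' : EuclideanSpace ℂ (Fin n)} {x : ℝ} :
    HasDerivAt q q' x ↔ ∀ j, HasDerivAt (fun y => q y j) (q' j) x := by
  rw [← hasDerivAt_pi (φ := fun y j => q y j) (φ' := fun j => q' j)]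
  let e := PiLp.continuousLinearEquiv 2 ℝ (fun _ : Fin n => ℂ)
  exact ⟨fun h => e.hasFDerivAt.comp_hasDerivAt x h,
    fun h => e.symm.hasFDerivAt.comp_hasDerivAt x h⟩

lemma laxU_mulVec_zero {n : ℕ} (q : ℝ → ℝ → EuclideanSpace ℂ (Fin n)) (lam : ℂ) (x t : ℝ)
    (v : Fin (n + 1) → ℂ) :
    (laxU q lam x t *ᵥ v) 0
      = Complex.I * (lam * v 0 + ∑ j, star (q x t j) * v (Fin.succ j)) := by
  simp [laxU, sigma3, potential, Matrix.mulVec, dotProduct, Fin.sum_univ_succ,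
    (Fin.succ_ne_zero _).symm, Finset.mul_sum, mul_add, mul_assoc]

lemma laxU_mulVec_succ {n : ℕ} (q : ℝ → ℝ → EuclideanSpace ℂ (Fin n)) (lam : ℂ) (x t : ℝ)
    (v : Fin (n + 1) → ℂ) (j : Fin n) :
    (laxU q lam x t *ᵥ v) j.succ
      = Complex.I * (-lam * v j.succ + q x t j * v 0) := by
  simp [laxU, sigma3, potential, Matrix.mulVec, dotProduct, Fin.sum_univ_succ,
    Matrix.diagonal_apply, Fin.succ_ne_zero]
  ring

lemma potential_mulVec_zero {n : ℕ} (q : EuclideanSpace ℂ (Fin n)) (v : Fin (n + 1) → ℂ) :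
    (potential q *ᵥ v) 0 = ∑ j, star (q j) * v (Fin.succ j) := by
  simp [potential, Matrix.mulVec, dotProduct, Fin.sum_univ_succ]

lemma potential_mulVec_succ {n : ℕ} (q : EuclideanSpace ℂ (Fin n)) (v : Fin (n + 1) → ℂ)
    (j : Fin n) : (potential q *ᵥ v) j.succ = q j * v 0 := by
  simp [potential, Matrix.mulVec, dotProduct, Fin.sum_univ_succ]

lemma sigma3_mulVec_zero {n : ℕ} (v : Fin (n + 1) → ℂ) : (sigma3 n *ᵥ v) 0 = v 0 := by
  simp [sigma3, Matrix.mulVec_diagonal]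

lemma sigma3_mulVec_succ {n : ℕ} (v : Fin (n + 1) → ℂ) (j : Fin n) :
    (sigma3 n *ᵥ v) j.succ = - v j.succ := by
  simp [sigma3, Matrix.mulVec_diagonal]

lemma laxV_mulVec_zero {n : ℕ} (q : ℝ → ℝ → EuclideanSpace ℂ (Fin n)) (lam : ℂ) (x t : ℝ)
    (v : Fin (n + 1) → ℂ) :
    (laxV q lam x t *ᵥ v) 0
      = Complex.I * (lam ^ 2 * v 0 + lam * ∑ j, star (q x t j) * v (Fin.succ j)
        - 1 / 2 * (∑ j, star (q x t j) * q x t j) * v 0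
        - Complex.I / 2 * ∑ j, star (deriv (fun y => q y t) x j) * v (Fin.succ j)) := by
  simp only [laxV, Matrix.smul_mulVec, Matrix.sub_mulVec, Matrix.add_mulVec, pow_two (potential _),
    ← Matrix.mulVec_mulVec, Pi.smul_apply, Pi.sub_apply, Pi.add_apply, sigma3_mulVec_zero,
    potential_mulVec_zero, potential_mulVec_succ, smul_eq_mul]
  simp only [← mul_assoc, ← Finset.sum_mul]

lemma laxV_mulVec_succ {n : ℕ} (q : ℝ → ℝ → EuclideanSpace ℂ (Fin n)) (lam : ℂ) (x t : ℝ)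
    (v : Fin (n + 1) → ℂ) (j : Fin n) :
    (laxV q lam x t *ᵥ v) j.succ
      = Complex.I * (-lam ^ 2 * v j.succ + lam * (q x t j * v 0)
        + 1 / 2 * (q x t j * ∑ k, star (q x t k) * v (Fin.succ k))
        + Complex.I / 2 * (deriv (fun y => q y t) x j * v 0)) := by
  simp only [laxV, Matrix.smul_mulVec, Matrix.sub_mulVec, Matrix.add_mulVec, pow_two (potential _),
    ← Matrix.mulVec_mulVec, Pi.smul_apply, Pi.sub_apply, Pi.add_apply, sigma3_mulVec_succ,
    potential_mulVec_zero, potential_mulVec_succ, smul_eq_mul]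
  ring

/-- The wave numbers of the components of `G`, the first of which is the constant `1`. -/
noncomputable def waveNumber (n : ℕ) (lam0 : ℂ) : Fin (n + 1) → ℝ :=
  Matrix.vecCons 0 fun j => wave n lam0 j

/-- The frequencies of the components of `G`. -/
noncomputable def frequency (n : ℕ) (lam0 : ℂ) : Fin (n + 1) → ℝ :=
  Matrix.vecCons 0 fun j => ‖amp n lam0‖ ^ 2 - wave n lam0 j ^ 2 / 2

/-- The constant factor of the `i`-th component of `h(z)`. -/
noncomputable def weight (n : ℕ) (lam0 : ℂ) (z : ℂ) : Fin (n + 1) → ℂ :=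
  Matrix.vecCons 1 fun j => (amp n lam0 j : ℂ) / (z + (wave n lam0 j : ℂ))

/-- The coefficient of `x` in the exponent common to all components of `h(z)`. -/
noncomputable def expX (lam z : ℂ) : ℂ := Complex.I * (z - lam)

/-- The coefficient of `t` in the exponent common to all components of `h(z)`. -/
noncomputable def expT (n : ℕ) (lam0 lam z : ℂ) : ℂ :=
  Complex.I * (z ^ 2 / 2 - lam ^ 2 - ((‖amp n lam0‖ ^ 2 : ℝ) : ℂ))

lemma h_apply (n : ℕ) (lam0 lam z : ℂ) (x t : ℝ) (i : Fin (n + 1)) :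
    h n lam0 lam z x t i = weight n lam0 z i *
      Complex.exp ((expX lam z + Complex.I * waveNumber n lam0 i) * x
        + (expT n lam0 lam z + Complex.I * frequency n lam0 i) * t) := by
  unfold h expX expT
  rw [Pi.smul_apply, Matrix.mulVec_diagonal, smul_eq_mul]
  refine Fin.cases ?_ (fun j => ?_) i
  · simp only [weight, waveNumber, frequency, Matrix.cons_val_zero, one_mul, mul_one]
    congr 1
    push_cast
    ring
  · simp only [weight, waveNumber, frequency, Matrix.cons_val_succ, phase]
    rw [← mul_assoc, ← Complex.exp_add, mul_comm]
    congr 2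
    push_cast
    ring

lemma background_apply (n : ℕ) (lam0 : ℂ) (x t : ℝ) (j : Fin n) :
    background n lam0 x t j = (amp n lam0 j : ℂ) *
      Complex.exp (Complex.I * waveNumber n lam0 j.succ * x
        + Complex.I * frequency n lam0 j.succ * t) := by
  simp only [background, phase, waveNumber, frequency, Matrix.cons_val_succ]
  congr 2
  push_cast
  ring

lemma hasDerivAt_exp_fst (c A B : ℂ) (x t : ℝ) :
    HasDerivAt (fun y : ℝ => c * Complex.exp (A * y + B * t))
      (A * (c * Complex.exp (A * x + B * t))) x := by
  have h1 : HasDerivAt (fun y : ℝ => A * (y : ℂ) + B * t) (A * 1) x :=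
    ((Complex.ofRealCLM.hasDerivAt (x := x)).const_mul A).add_const _
  exact ((h1.cexp).const_mul c).congr_deriv (by simp; ring)

lemma hasDerivAt_exp_snd (c A B : ℂ) (x t : ℝ) :
    HasDerivAt (fun τ : ℝ => c * Complex.exp (A * x + B * τ))
      (B * (c * Complex.exp (A * x + B * t))) t := by
  have h1 : HasDerivAt (fun τ : ℝ => A * (x : ℂ) + B * τ) (B * 1) t :=
    ((Complex.ofRealCLM.hasDerivAt (x := t)).const_mul B).const_add _
  exact ((h1.cexp).const_mul c).congr_deriv (by simp; ring)

lemma hasDerivAt_background_fst (n : ℕ) (lam0 : ℂ) (x t : ℝ) :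
    HasDerivAt (fun y => background n lam0 y t)
      (WithLp.toLp 2 fun j => Complex.I * waveNumber n lam0 j.succ * background n lam0 x t j) x := by
  refine hasDerivAt_euclideanSpace.2 fun j => ?_
  simp only [background_apply]
  exact hasDerivAt_exp_fst _ _ _ x t

lemma hasDerivAt_background_snd (n : ℕ) (lam0 : ℂ) (x t : ℝ) :
    HasDerivAt (fun τ => background n lam0 x τ)
      (WithLp.toLp 2 fun j => Complex.I * frequency n lam0 j.succ * background n lam0 x t j) t := by
  refine hasDerivAt_euclideanSpace.2 fun j => ?_
  simp only [background_apply]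
  exact hasDerivAt_exp_snd _ _ _ x t

lemma star_background_mul_h (n : ℕ) (lam0 lam z : ℂ) (x t : ℝ) (j : Fin n) :
    star (background n lam0 x t j) * h n lam0 lam z x t j.succ
      = (amp n lam0 j : ℂ) ^ 2 / (z + (wave n lam0 j : ℂ)) * h n lam0 lam z x t 0 := by
  rw [background_apply, h_apply, h_apply]
  simp only [weight, Matrix.cons_val_succ, Matrix.cons_val_zero, star_mul', Complex.star_def,
    Complex.conj_ofReal, ← Complex.exp_conj, map_add, map_mul, Complex.conj_I]
  have : ∀ a b c d e f : ℂ, e + f = d → a * Complex.exp e * (b / c * Complex.exp f)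
      = a * b / c * Complex.exp d := by
    intro a b c d e f h
    rw [← h, Complex.exp_add]
    ring
  rw [pow_two, one_mul]
  refine this _ _ _ _ _ _ ?_
  simp [waveNumber, frequency]
  ring

lemma star_background_mul_self (n : ℕ) (lam0 : ℂ) (x t : ℝ) (j : Fin n) :
    star (background n lam0 x t j) * background n lam0 x t j = (amp n lam0 j : ℂ) ^ 2 := by
  rw [background_apply]
  simp only [star_mul', Complex.star_def,
    Complex.conj_ofReal, ← Complex.exp_conj, map_add, map_mul, Complex.conj_I]
  have : ∀ a e f : ℂ, e + f = 0 → a * Complex.exp e * (a * Complex.exp f) = a ^ 2 := by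
    intro a e f h
    rw [mul_mul_mul_comm, ← Complex.exp_add, h, Complex.exp_zero, mul_one, pow_two]
  refine this _ _ _ ?_
  ring

lemma sum_amp_sq (n : ℕ) (lam0 : ℂ) :
    ∑ j, (amp n lam0 j : ℂ) ^ 2 = ((‖amp n lam0‖ ^ 2 : ℝ) : ℂ) := by
  rw [EuclideanSpace.norm_sq_eq]
  push_cast
  refine Finset.sum_congr rfl fun j _ => ?_
  rw [← Complex.ofReal_pow, ← Complex.ofReal_pow, Real.norm_eq_abs, sq_abs]

lemma background_mul_h_zero {n : ℕ} {lam0 lam z : ℂ} (x t : ℝ) (j : Fin n)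
    (hz : z + (wave n lam0 j : ℂ) ≠ 0) :
    background n lam0 x t j * h n lam0 lam z x t 0
      = (z + (wave n lam0 j : ℂ)) * h n lam0 lam z x t j.succ := by
  rw [background_apply, h_apply, h_apply]
  simp only [weight, Matrix.cons_val_succ, Matrix.cons_val_zero, one_mul]
  rw [mul_assoc, ← Complex.exp_add, ← mul_assoc, mul_div_cancel₀ _ hz]
  congr 2
  simp [waveNumber, frequency]
  ring

/-- If `z` is an eigenvalue of `H(λ) + λ I`, then `h(z)` solves the Lax pair on the plane wave. -/
lemma isLaxSolution_h {n : ℕ} {lam0 lam z : ℂ} (hz : ∀ j : Fin n, z + (wave n lam0 j : ℂ) ≠ 0)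
    (hE : ∑ j, (amp n lam0 j : ℂ) ^ 2 / (z + (wave n lam0 j : ℂ)) = z - 2 * lam) :
    IsLaxSolution (background n lam0) lam (h n lam0 lam z) := by
  intro x t
  have hq := (hasDerivAt_background_fst n lam0 x t).deriv
  have hI := Complex.I_mul_I
  have hs : ∑ j, star (background n lam0 x t j) * h n lam0 lam z x t (Fin.succ j)
      = (z - 2 * lam) * h n lam0 lam z x t 0 := by
    simp only [star_background_mul_h, ← Finset.sum_mul, hE]
  have hsx : ∑ j, star (Complex.I * waveNumber n lam0 j.succ * background n lam0 x t j)
      * h n lam0 lam z x t (Fin.succ j)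
      = -Complex.I * (((‖amp n lam0‖ ^ 2 : ℝ) : ℂ) - z * (z - 2 * lam))
        * h n lam0 lam z x t 0 := by
    rw [← sum_amp_sq, ← hE, Finset.mul_sum, ← Finset.sum_sub_distrib, Finset.mul_sum,
      Finset.sum_mul]
    refine Finset.sum_congr rfl fun j _ => ?_
    have := hz j
    simp only [star_mul', mul_assoc, star_background_mul_h]
    simp only [waveNumber, Matrix.cons_val_succ, Complex.star_def, Complex.conj_I,
      Complex.conj_ofReal]
    field_simp
    ring
  constructor
  · refine hasDerivAt_pi.2 fun i => ?_
    have hd : HasDerivAt (fun y => h n lam0 lam z y t i)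
        ((expX lam z + Complex.I * waveNumber n lam0 i) * h n lam0 lam z x t i) x := by
      simp only [h_apply]
      exact hasDerivAt_exp_fst _ _ _ x t
    refine hd.congr_deriv ?_
    induction i using Fin.cases with
    | zero =>
      rw [laxU_mulVec_zero, hs]
      simp [expX, waveNumber]
      ring
    | succ j =>
      rw [laxU_mulVec_succ, background_mul_h_zero x t j (hz j)]
      simp [expX, waveNumber]
      ring
  · refine hasDerivAt_pi.2 fun i => ?_
    have hd : HasDerivAt (fun τ => h n lam0 lam z x τ i)
        ((expT n lam0 lam z + Complex.I * frequency n lam0 i) * h n lam0 lam z x t i) t := by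
      simp only [h_apply]
      exact hasDerivAt_exp_snd _ _ _ x t
    refine hd.congr_deriv ?_
    induction i using Fin.cases with
    | zero =>
      rw [laxV_mulVec_zero, hs, hq]
      simp only [hsx, star_background_mul_self, sum_amp_sq]
      simp only [expT, frequency, Matrix.cons_val_zero, Complex.ofReal_zero]
      linear_combination -(1 / 2 * Complex.I * (((‖amp n lam0‖ ^ 2 : ℝ) : ℂ) - z * (z - 2 * lam))
        * h n lam0 lam z x t 0) * hI
    | succ j =>
      have e := background_mul_h_zero (lam := lam) x t j (hz j)
      rw [laxV_mulVec_succ, hs, hq]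
      simp only [expT, frequency, waveNumber, Matrix.cons_val_succ]
      push_cast
      linear_combination (-Complex.I * (lam + 1 / 2 * (z - 2 * lam)
        + 1 / 2 * Complex.I * Complex.I * wave n lam0 j)) * e
        - (1 / 2 * Complex.I * wave n lam0 j * (z + wave n lam0 j) * h n lam0 lam z x t j.succ) * hI

/-! ### Taylor coefficients of exponentials depending on parameters -/

/-- Each Taylor coefficient in `ε` at `0` of `w exp (A x + B t)` is expressed through coefficients of
lower order of functions of the same shape. This recursion makes inductions on the order possible
in which derivatives in `x` or `t` never have to be interchanged with derivatives in `ε`. -/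
lemma iteratedDeriv_succ_mul_exp {w A B : ℂ → ℂ} (hw : AnalyticAt ℂ w 0) (hA : AnalyticAt ℂ A 0)
    (hB : AnalyticAt ℂ B 0) (j : ℕ) (x t : ℂ) :
    iteratedDeriv (j + 1) (fun ε => w ε * Complex.exp (A ε * x + B ε * t)) 0
      = iteratedDeriv j (fun ε => deriv w ε * Complex.exp (A ε * x + B ε * t)) 0
        + x * iteratedDeriv j (fun ε => (w ε * deriv A ε) * Complex.exp (A ε * x + B ε * t)) 0
        + t * iteratedDeriv j (fun ε => (w ε * deriv B ε) * Complex.exp (A ε * x + B ε * t)) 0 := by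
  have he : AnalyticAt ℂ (fun ε => Complex.exp (A ε * x + B ε * t)) 0 :=
    ((hA.mul analyticAt_const).add (hB.mul analyticAt_const)).cexp
  have h1 := (hw.deriv.fun_mul he).contDiffAt (n := j)
  have h2 := (analyticAt_const (v := x)).fun_mul ((hw.fun_mul hA.deriv).fun_mul he)
  have h3 := (analyticAt_const (v := t)).fun_mul ((hw.fun_mul hB.deriv).fun_mul he)
  have e : deriv (fun ε => w ε * Complex.exp (A ε * x + B ε * t)) =ᶠ[𝓝 0] fun ε =>
      (deriv w ε * Complex.exp (A ε * x + B ε * t)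
        + x * ((w ε * deriv A ε) * Complex.exp (A ε * x + B ε * t)))
        + t * ((w ε * deriv B ε) * Complex.exp (A ε * x + B ε * t)) := by
    filter_upwards [hw.eventually_analyticAt, hA.eventually_analyticAt,
      hB.eventually_analyticAt] with ε k1 k2 k3
    have d := k1.differentiableAt.hasDerivAt.mul
      (((k2.differentiableAt.hasDerivAt.mul_const x).add
        (k3.differentiableAt.hasDerivAt.mul_const t)).cexp)
    refine (HasDerivAt.deriv d).trans ?_
    simp
    ring
  rw [iteratedDeriv_succ', (e.iteratedDeriv j).eq_of_nhds]
  rw [iteratedDeriv_fun_add (h1.add h2.contDiffAt) h3.contDiffAt,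
    iteratedDeriv_fun_add h1 h2.contDiffAt, iteratedDeriv_const_mul_field,
    iteratedDeriv_const_mul_field]

/-- Differentiation in `x` commutes with taking Taylor coefficients in `ε`. -/
lemma hasDerivAt_iteratedDeriv_exp_fst {A B : ℂ → ℂ} (hA : AnalyticAt ℂ A 0)
    (hB : AnalyticAt ℂ B 0) (j : ℕ) (x t : ℝ) : ∀ w : ℂ → ℂ, AnalyticAt ℂ w 0 →
    HasDerivAt (fun y : ℝ => iteratedDeriv j (fun ε => w ε * Complex.exp (A ε * y + B ε * t)) 0)
      (iteratedDeriv j (fun ε => A ε * (w ε * Complex.exp (A ε * x + B ε * t))) 0) x := by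
  induction j with
  | zero =>
    intro w _
    simp only [iteratedDeriv_zero]
    exact hasDerivAt_exp_fst _ _ _ x t
  | succ j ih =>
    intro w hw
    simp only [iteratedDeriv_succ_mul_exp hw hA hB]
    have hx : HasDerivAt (fun y : ℝ => (y : ℂ)) 1 x := Complex.ofRealCLM.hasDerivAt
    have h1 := ih _ hw.deriv
    have h2 := hx.mul (ih _ (hw.mul hA.deriv))
    have h3 := (ih _ (hw.mul hB.deriv)).const_mul (t : ℂ)
    refine ((h1.add h2).add h3).congr_deriv ?_
    have hAw := iteratedDeriv_succ_mul_exp (hA.mul hw) hA hB j x t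
    have e0 : (fun ε => A ε * (w ε * Complex.exp (A ε * x + B ε * t)))
        = fun ε => (A * w) ε * Complex.exp (A ε * x + B ε * t) := by
      ext ε; simp; ring
    rw [e0, hAw]
    have he : AnalyticAt ℂ (fun ε => Complex.exp (A ε * x + B ε * t)) 0 :=
      ((hA.mul analyticAt_const).add (hB.mul analyticAt_const)).cexp
    have e1 : iteratedDeriv j (fun ε => deriv (A * w) ε * Complex.exp (A ε * x + B ε * t)) 0
        = iteratedDeriv j (fun ε => (w ε * deriv A ε) * Complex.exp (A ε * x + B ε * t)) 0
          + iteratedDeriv j (fun ε => A ε * (deriv w ε * Complex.exp (A ε * x + B ε * t))) 0 := by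
      rw [← iteratedDeriv_fun_add ((hw.fun_mul hA.deriv).fun_mul he).contDiffAt
        (hA.fun_mul (hw.deriv.fun_mul he)).contDiffAt]
      refine Filter.EventuallyEq.eq_of_nhds (Filter.EventuallyEq.iteratedDeriv ?_ j)
      filter_upwards [hw.eventually_analyticAt, hA.eventually_analyticAt] with ε k1 k2
      have := (k2.differentiableAt.hasDerivAt.mul k1.differentiableAt.hasDerivAt).deriv
      rw [this]
      ring
    rw [e1]
    simp only [Pi.mul_apply, one_mul, ← mul_assoc]
    ring

lemma hasDerivAt_iteratedDeriv_exp_snd {A B : ℂ → ℂ} (hA : AnalyticAt ℂ A 0)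
    (hB : AnalyticAt ℂ B 0) (j : ℕ) (x t : ℝ) {w : ℂ → ℂ} (hw : AnalyticAt ℂ w 0) :
    HasDerivAt (fun τ : ℝ => iteratedDeriv j (fun ε => w ε * Complex.exp (A ε * x + B ε * τ)) 0)
      (iteratedDeriv j (fun ε => B ε * (w ε * Complex.exp (A ε * x + B ε * t))) 0) t := by
  have := hasDerivAt_iteratedDeriv_exp_fst hB hA j t x w hw
  simpa only [add_comm] using this

lemma exists_polynomial_iteratedDeriv_exp {A B : ℂ → ℂ} (hA : AnalyticAt ℂ A 0)
    (hB : AnalyticAt ℂ B 0) (j : ℕ) : ∀ w : ℂ → ℂ, AnalyticAt ℂ w 0 →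
    ∃ P : MvPolynomial (Fin 2) ℂ, ∀ x t : ℂ,
      iteratedDeriv j (fun ε => w ε * Complex.exp (A ε * x + B ε * t)) 0
        = MvPolynomial.eval ![x, t] P * Complex.exp (A 0 * x + B 0 * t) := by
  induction j with
  | zero =>
    intro w _
    exact ⟨MvPolynomial.C (w 0), fun x t => by simp⟩
  | succ j ih =>
    intro w hw
    obtain ⟨P₁, h1⟩ := ih _ hw.deriv
    obtain ⟨P₂, h2⟩ := ih _ (hw.mul hA.deriv)
    obtain ⟨P₃, h3⟩ := ih _ (hw.mul hB.deriv)
    refine ⟨P₁ + MvPolynomial.X 0 * P₂ + MvPolynomial.X 1 * P₃, fun x t => ?_⟩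
    rw [iteratedDeriv_succ_mul_exp hw hA hB]
    have h2' := h2 x t
    have h3' := h3 x t
    simp only [Pi.mul_apply] at h2' h3'
    rw [h1, h2', h3']
    simp
    ring

/-! ### The linear system for the vectors `Φ̃_k` -/

/-- The sequence `u` delayed by `m`, with zeros in front. -/
def delay {α : Type*} [Zero α] (m : ℕ) (u : ℕ → α) (j : ℕ) : α :=
  if m ≤ j then u (j - m) else 0

section

variable {n : ℕ} {lam0 : ℂ} {μ : Fin (n + 1) → ℂ → ℂ}

lemma analyticAt_lamEps (n : ℕ) (lam0 : ℂ) : AnalyticAt ℂ (lamEps n lam0) 0 := by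
  unfold lamEps
  exact analyticAt_const.mul (analyticAt_const.add (analyticAt_id.pow _))

lemma IsEigenvalueBranches.analyticAt_weight (hre : lam0.re = 0) (him : lam0.im ≠ 0)
    (hμ : IsEigenvalueBranches n lam0 μ) (s i : Fin (n + 1)) :
    AnalyticAt ℂ (fun ε => weight n lam0 (μ s ε) i) 0 := by
  induction i using Fin.cases with
  | zero => simpa [weight] using analyticAt_const
  | succ j =>
    simp only [weight, Matrix.cons_val_succ]
    refine analyticAt_const.fun_div ((hμ.analytic s).fun_add analyticAt_const) ?_
    exact (hμ.eventually_add_wave_ne_zero hre him s).self_of_nhds j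

lemma IsEigenvalueBranches.analyticAt_expX (hμ : IsEigenvalueBranches n lam0 μ)
    (s : Fin (n + 1)) (c : ℂ) :
    AnalyticAt ℂ (fun ε => expX (lamEps n lam0 ε) (μ s ε) + c) 0 := by
  unfold expX
  exact (analyticAt_const.mul ((hμ.analytic s).sub (analyticAt_lamEps n lam0))).add analyticAt_const

lemma IsEigenvalueBranches.analyticAt_expT (hμ : IsEigenvalueBranches n lam0 μ)
    (s : Fin (n + 1)) (c : ℂ) :
    AnalyticAt ℂ (fun ε => expT n lam0 (lamEps n lam0 ε) (μ s ε) + c) 0 := by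
  unfold expT
  exact (analyticAt_const.mul (((((hμ.analytic s).pow 2).div_const).sub
    ((analyticAt_lamEps n lam0).pow 2)).sub analyticAt_const)).add analyticAt_const

lemma IsEigenvalueBranches.analyticAt_h (hre : lam0.re = 0) (him : lam0.im ≠ 0)
    (hμ : IsEigenvalueBranches n lam0 μ) (s i : Fin (n + 1)) (x t : ℝ) :
    AnalyticAt ℂ (fun ε => h n lam0 (lamEps n lam0 ε) (μ s ε) x t i) 0 := by
  simp only [h_apply]
  exact (hμ.analyticAt_weight hre him s i).mul
    (((hμ.analyticAt_expX s _).mul analyticAt_const).add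
      ((hμ.analyticAt_expT s _).mul analyticAt_const)).cexp

/-- `h(μ_s)` solves the Lax pair on the plane wave for all `ε` near `0`. -/
lemma IsEigenvalueBranches.isLaxSolution_h (hre : lam0.re = 0) (him : lam0.im ≠ 0)
    (hμ : IsEigenvalueBranches n lam0 μ) (s : Fin (n + 1)) :
    ∀ᶠ ε in 𝓝 (0 : ℂ), IsLaxSolution (background n lam0) (lamEps n lam0 ε)
      (h n lam0 (lamEps n lam0 ε) (μ s ε)) := by
  filter_upwards [hμ.eventually_add_wave_ne_zero hre him s, hμ.sum_amp_sq_div hre him s]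
    with ε h1 h2
  exact NNLS.isLaxSolution_h h1 h2

lemma coeff_taylor_h (n : ℕ) (lam0 : ℂ) (μ : Fin (n + 1) → ℂ → ℂ) (s i : Fin (n + 1)) (x t : ℝ)
    (j : ℕ) :
    PowerSeries.coeff j (taylor fun ε => h n lam0 (lamEps n lam0 ε) (μ s ε) x t i)
      = Phi0Deriv n lam0 μ j x t i s / (j.factorial : ℂ) := by
  rw [coeff_taylor]
  rfl

/-- The Taylor coefficients of `(K₀ + ε^{n+1} K₁ + ε^{2(n+1)} K₂) h(μ_s(ε))`. -/
lemma IsEigenvalueBranches.iteratedDeriv_system (hre : lam0.re = 0) (him : lam0.im ≠ 0)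
    (hμ : IsEigenvalueBranches n lam0 μ) (s : Fin (n + 1)) (x t : ℝ)
    (K₀ K₁ K₂ : Matrix (Fin (n + 1)) (Fin (n + 1)) ℂ) (i : Fin (n + 1)) {u : ℂ → ℂ}
    (hu : ∀ᶠ ε in 𝓝 (0 : ℂ), u ε = ((K₀ + ε ^ (n + 1) • K₁ + ε ^ (2 * (n + 1)) • K₂) *ᵥ
      h n lam0 (lamEps n lam0 ε) (μ s ε) x t) i) (j : ℕ) :
    iteratedDeriv j u 0 / (j.factorial : ℂ)
      = ∑ l, (K₀ i l * (Phi0Deriv n lam0 μ j x t l s / (j.factorial : ℂ))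
        + K₁ i l * delay (n + 1)
          (fun j => Phi0Deriv n lam0 μ j x t l s / (j.factorial : ℂ)) j
        + K₂ i l * delay (2 * (n + 1))
          (fun j => Phi0Deriv n lam0 μ j x t l s / (j.factorial : ℂ)) j) := by
  have hh := fun l => hμ.analyticAt_h hre him s l x t
  have e : u =ᶠ[𝓝 0] fun ε => ∑ l, ((K₀ i l * h n lam0 (lamEps n lam0 ε) (μ s ε) x t l
      + K₁ i l * (ε ^ (n + 1) * h n lam0 (lamEps n lam0 ε) (μ s ε) x t l))
      + K₂ i l * (ε ^ (2 * (n + 1)) * h n lam0 (lamEps n lam0 ε) (μ s ε) x t l)) := by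
    filter_upwards [hu] with ε hε
    rw [hε]
    simp only [Matrix.mulVec, dotProduct, Matrix.add_apply, Matrix.smul_apply, smul_eq_mul]
    refine Finset.sum_congr rfl fun l _ => ?_
    ring
  have hp : ∀ m l, AnalyticAt ℂ
      (fun ε => ε ^ m * h n lam0 (lamEps n lam0 ε) (μ s ε) x t l) 0 :=
    fun m l => (analyticAt_id.pow m).mul (hh l)
  have h0 : ∀ l, AnalyticAt ℂ (fun ε => K₀ i l * h n lam0 (lamEps n lam0 ε) (μ s ε) x t l) 0 :=
    fun l => analyticAt_const.mul (hh l)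
  have h1 : ∀ l, AnalyticAt ℂ
      (fun ε => K₁ i l * (ε ^ (n + 1) * h n lam0 (lamEps n lam0 ε) (μ s ε) x t l)) 0 :=
    fun l => analyticAt_const.mul (hp _ l)
  have h2 : ∀ l, AnalyticAt ℂ
      (fun ε => K₂ i l * (ε ^ (2 * (n + 1)) * h n lam0 (lamEps n lam0 ε) (μ s ε) x t l)) 0 :=
    fun l => analyticAt_const.mul (hp _ l)
  rw [← coeff_taylor, taylor_congr e, taylor_sum _ fun l _ => ((h0 l).fun_add (h1 l)).fun_add (h2 l),
    map_sum]
  refine Finset.sum_congr rfl fun l _ => ?_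
  rw [taylor_add ((h0 l).fun_add (h1 l)) (h2 l), taylor_add (h0 l) (h1 l), taylor_const_mul,
    taylor_const_mul, taylor_const_mul, taylor_mul (u := fun ε => ε ^ (n + 1)) (by fun_prop) (hh l),
    taylor_mul (u := fun ε => ε ^ (2 * (n + 1))) (by fun_prop) (hh l), taylor_pow, taylor_pow]
  simp only [map_add, PowerSeries.coeff_C_mul, PowerSeries.coeff_X_pow_mul', delay,
    coeff_taylor_h]

/-- The sequence `Φ̃_k` obeys any system that holds for the Taylor coefficients of all `h(μ_s)`;
`ε^{n+1}` becomes the index shift by one. -/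
lemma hasDerivAt_PhiTilde (γ : ℕ → Matrix (Fin (n + 1)) (Fin (n + 1)) ℂ) (β : Fin (n + 1) → ℂ)
    (X T : ℝ → ℝ) (r₀ : ℝ) (K₀ K₁ K₂ : Matrix (Fin (n + 1)) (Fin (n + 1)) ℂ)
    (hD : ∀ (j : ℕ) (i s : Fin (n + 1)),
      HasDerivAt (fun r => Phi0Deriv n lam0 μ j (X r) (T r) i s / (j.factorial : ℂ))
        (∑ l, (K₀ i l * (Phi0Deriv n lam0 μ j (X r₀) (T r₀) l s / (j.factorial : ℂ))
          + K₁ i l * delay (n + 1)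
            (fun j => Phi0Deriv n lam0 μ j (X r₀) (T r₀) l s / (j.factorial : ℂ)) j
          + K₂ i l * delay (2 * (n + 1))
            (fun j => Phi0Deriv n lam0 μ j (X r₀) (T r₀) l s / (j.factorial : ℂ)) j)) r₀)
    (k : ℕ) (i : Fin (n + 1)) :
    HasDerivAt (fun r => PhiTilde n lam0 μ γ β k (X r) (T r) i)
      ((K₀ *ᵥ PhiTilde n lam0 μ γ β k (X r₀) (T r₀)
        + K₁ *ᵥ delay 1 (fun k => PhiTilde n lam0 μ γ β k (X r₀) (T r₀)) k
        + K₂ *ᵥ delay 2 (fun k => PhiTilde n lam0 μ γ β k (X r₀) (T r₀)) k) i) r₀ := by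
  have hat : ∀ (s : ℕ) (x t : ℝ) (i k : Fin (n + 1)), PhiHat n lam0 μ s x t i k
      = ∑ r, (Phi0Deriv n lam0 μ (s * n + s + k) x t i r / ((s * n + s + k).factorial : ℂ))
          * matR n lam0 r k := by
    intro s x t i k
    simp only [PhiHat, Matrix.of_apply, Matrix.mulVec, dotProduct, Finset.sum_div]
    refine Finset.sum_congr rfl fun r _ => ?_
    ring
  have hdel : ∀ (p s : ℕ) (l k : Fin (n + 1)),
      ∑ r, delay (p * (n + 1))
        (fun j => Phi0Deriv n lam0 μ j (X r₀) (T r₀) l r / (j.factorial : ℂ)) (s * n + s + k)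
          * matR n lam0 r k
      = delay p (fun s => PhiHat n lam0 μ s (X r₀) (T r₀)) s l k := by
    intro p s l k
    have hk := k.2
    unfold delay
    by_cases hps : p ≤ s
    · obtain ⟨m, rfl⟩ := Nat.exists_eq_add_of_le hps
      have h1 : p * (n + 1) ≤ (p + m) * n + (p + m) + k := by nlinarith
      have h2 : (p + m) * n + (p + m) + k - p * (n + 1) = m * n + m + k := by
        rw [Nat.sub_eq_iff_eq_add h1]; ring
      simp only [h1, if_true, hps, h2, Nat.add_sub_cancel_left, hat]
    · have h1 : ¬ p * (n + 1) ≤ s * n + s + k := by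
        have : s + 1 ≤ p := by omega
        have := Nat.mul_le_mul_right (n + 1) this
        nlinarith
      simp [h1, hps]
  have hHat : ∀ (s : ℕ) (i k : Fin (n + 1)),
      HasDerivAt (fun r => PhiHat n lam0 μ s (X r) (T r) i k)
        (∑ l, (K₀ i l * PhiHat n lam0 μ s (X r₀) (T r₀) l k
          + K₁ i l * delay 1 (fun s => PhiHat n lam0 μ s (X r₀) (T r₀)) s l k
          + K₂ i l * delay 2 (fun s => PhiHat n lam0 μ s (X r₀) (T r₀)) s l k)) r₀ := by
    intro s i k
    simp only [hat s _ _ i k]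
    refine (HasDerivAt.fun_sum fun r _ => (hD (s * n + s + k) i r).mul_const
      (matR n lam0 r k)).congr_deriv ?_
    simp only [Finset.sum_mul]
    rw [Finset.sum_comm]
    refine Finset.sum_congr rfl fun l _ => ?_
    rw [← hdel 1, ← hdel 2, hat, one_mul, Finset.mul_sum, Finset.mul_sum, Finset.mul_sum,
      ← Finset.sum_add_distrib, ← Finset.sum_add_distrib]
    refine Finset.sum_congr rfl fun r _ => ?_
    ring
  have hconv : ∀ (p k : ℕ) (l : Fin (n + 1)),
      delay p (fun k => PhiTilde n lam0 μ γ β k (X r₀) (T r₀)) k l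
        = ∑ s ∈ Finset.range (k + 1),
          ∑ m, delay p (fun s => PhiHat n lam0 μ s (X r₀) (T r₀)) s l m * (γ (k - s) *ᵥ β) m := by
    intro p k l
    unfold delay
    by_cases hpk : p ≤ k
    · obtain ⟨d, rfl⟩ := Nat.exists_eq_add_of_le hpk
      rw [if_pos hpk, add_assoc, Finset.sum_range_add]
      rw [Finset.sum_eq_zero, zero_add]
      · simp only [PhiTilde, Nat.add_sub_cancel_left, Finset.sum_apply]
        refine Finset.sum_congr rfl fun s _ => ?_
        simp [Matrix.mulVec, dotProduct, Nat.add_sub_add_left]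
      · intro s hs
        have : ¬ p ≤ s := by simpa using hs
        simp [this]
    · rw [if_neg hpk, Finset.sum_eq_zero]
      · rfl
      · intro s hs
        have : ¬ p ≤ s := by
          have := Finset.mem_range.1 hs
          omega
        simp [this]
  have hT : ∀ (k : ℕ) (l : Fin (n + 1)) (x t : ℝ), PhiTilde n lam0 μ γ β k x t l
      = ∑ s ∈ Finset.range (k + 1), ∑ m, PhiHat n lam0 μ s x t l m * (γ (k - s) *ᵥ β) m := by
    intro k l x t
    simp only [PhiTilde, Finset.sum_apply, Matrix.mulVec, dotProduct]
  simp only [hT k i]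
  refine (HasDerivAt.fun_sum fun s _ => HasDerivAt.fun_sum fun m _ =>
    (hHat s i m).mul_const ((γ (k - s) *ᵥ β) m)).congr_deriv ?_
  simp only [Pi.add_apply]
  rw [Matrix.mulVec, Matrix.mulVec, Matrix.mulVec, dotProduct, dotProduct, dotProduct]
  simp only [hconv, hT, ← Finset.sum_add_distrib]
  simp only [Finset.sum_mul, Finset.mul_sum, ← Finset.sum_add_distrib]
  symm
  rw [Finset.sum_comm]
  refine Finset.sum_congr rfl fun s _ => ?_
  rw [Finset.sum_comm]
  refine Finset.sum_congr rfl fun m _ => Finset.sum_congr rfl fun l _ => ?_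
  ring

lemma laxU_lamEps (q : ℝ → ℝ → EuclideanSpace ℂ (Fin n)) (ε : ℂ) (x t : ℝ) :
    laxU q (lamEps n lam0 ε) x t = laxU q lam0 x t
      + ε ^ (n + 1) • ((Complex.I * lam0) • sigma3 n) + ε ^ (2 * (n + 1)) • 0 := by
  unfold laxU lamEps
  module

lemma laxV_lamEps (q : ℝ → ℝ → EuclideanSpace ℂ (Fin n)) (ε : ℂ) (x t : ℝ) :
    laxV q (lamEps n lam0 ε) x t = laxV q lam0 x t
      + ε ^ (n + 1) • (Complex.I • ((2 * lam0 ^ 2) • sigma3 n + lam0 • potential (q x t)))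
      + ε ^ (2 * (n + 1)) • ((Complex.I * lam0 ^ 2) • sigma3 n) := by
  unfold laxV lamEps
  rw [mul_comm 2 (n + 1), pow_mul]
  module

lemma Phi0Deriv_apply (n : ℕ) (lam0 : ℂ) (μ : Fin (n + 1) → ℂ → ℂ) (j : ℕ) (x t : ℝ)
    (i s : Fin (n + 1)) :
    Phi0Deriv n lam0 μ j x t i s = iteratedDeriv j (fun ε => weight n lam0 (μ s ε) i *
      Complex.exp ((expX (lamEps n lam0 ε) (μ s ε) + Complex.I * waveNumber n lam0 i) * x
        + (expT n lam0 (lamEps n lam0 ε) (μ s ε) + Complex.I * frequency n lam0 i) * t)) 0 := by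
  simp only [Phi0Deriv, Phi0, Matrix.of_apply, h_apply]

/-- The coefficient of `ε^{k(n+1)}` in `Φ̃_x = U(λ(ε)) Φ̃`, where `U(λ(ε))` is of degree one in
`ε^{n+1}`. -/
lemma IsEigenvalueBranches.hasDerivAt_PhiTilde_fst (hre : lam0.re = 0) (him : lam0.im ≠ 0)
    (hμ : IsEigenvalueBranches n lam0 μ) (γ : ℕ → Matrix (Fin (n + 1)) (Fin (n + 1)) ℂ)
    (β : Fin (n + 1) → ℂ) (k : ℕ) (x t : ℝ) (i : Fin (n + 1)) :
    HasDerivAt (fun y => PhiTilde n lam0 μ γ β k y t i)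
      ((laxU (background n lam0) lam0 x t *ᵥ PhiTilde n lam0 μ γ β k x t
        + ((Complex.I * lam0) • sigma3 n) *ᵥ
          delay 1 (fun k => PhiTilde n lam0 μ γ β k x t) k) i) x := by
  have h := NNLS.hasDerivAt_PhiTilde (n := n) (lam0 := lam0) (μ := μ) γ β (fun y => y)
    (fun _ => t) x (laxU (background n lam0) lam0 x t) ((Complex.I * lam0) • sigma3 n) 0 ?_ k i
  · simpa using h
  intro j i s
  simp only [Phi0Deriv_apply n lam0 μ j _ _ i]
  refine ((hasDerivAt_iteratedDeriv_exp_fst (hμ.analyticAt_expX s _) (hμ.analyticAt_expT s _) j x t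
    _ (hμ.analyticAt_weight hre him s i)).div_const _).congr_deriv ?_
  refine hμ.iteratedDeriv_system hre him s x t _ _ _ i ?_ j
  filter_upwards [hμ.isLaxSolution_h hre him s] with ε hε
  rw [← laxU_lamEps]
  have h1 := hasDerivAt_pi.1 (hε x t).1 i
  simp only [h_apply] at h1
  exact (hasDerivAt_exp_fst _ _ _ x t).unique h1

/-- The coefficient of `ε^{k(n+1)}` in `Φ̃_t = V(λ(ε)) Φ̃`, where `V(λ(ε))` is of degree two in
`ε^{n+1}`. -/
lemma IsEigenvalueBranches.hasDerivAt_PhiTilde_snd (hre : lam0.re = 0) (him : lam0.im ≠ 0)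
    (hμ : IsEigenvalueBranches n lam0 μ) (γ : ℕ → Matrix (Fin (n + 1)) (Fin (n + 1)) ℂ)
    (β : Fin (n + 1) → ℂ) (k : ℕ) (x t : ℝ) (i : Fin (n + 1)) :
    HasDerivAt (fun τ => PhiTilde n lam0 μ γ β k x τ i)
      ((laxV (background n lam0) lam0 x t *ᵥ PhiTilde n lam0 μ γ β k x t
        + (Complex.I • ((2 * lam0 ^ 2) • sigma3 n + lam0 • potential (background n lam0 x t)) :
            Matrix (Fin (n + 1)) (Fin (n + 1)) ℂ) *ᵥ
          delay 1 (fun k => PhiTilde n lam0 μ γ β k x t) k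
        + ((Complex.I * lam0 ^ 2) • sigma3 n) *ᵥ
          delay 2 (fun k => PhiTilde n lam0 μ γ β k x t) k) i) t := by
  refine NNLS.hasDerivAt_PhiTilde (n := n) (lam0 := lam0) (μ := μ) γ β (fun _ => x)
    (fun τ => τ) t _ _ _ ?_ k i
  intro j i s
  simp only [Phi0Deriv_apply n lam0 μ j _ _ i]
  refine ((hasDerivAt_iteratedDeriv_exp_snd (hμ.analyticAt_expX s _) (hμ.analyticAt_expT s _) j x t
    (hμ.analyticAt_weight hre him s i)).div_const _).congr_deriv ?_
  refine hμ.iteratedDeriv_system hre him s x t _ _ _ i ?_ j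
  filter_upwards [hμ.isLaxSolution_h hre him s] with ε hε
  rw [← laxV_lamEps]
  have h1 := hasDerivAt_pi.1 (hε x t).2 i
  simp only [h_apply] at h1
  exact (hasDerivAt_exp_snd _ _ _ x t).unique h1

end

/-! ### The expansion of `Φ̃(ε)` in powers of `ε^{n+1}` -/

lemma analyticAt_and_taylor_eq_of_hasSum {F : ℂ → ℂ} {c : ℕ → ℂ}
    (h : ∀ᶠ E in 𝓝 (0 : ℂ), HasSum (fun m => E ^ m * c m) (F E)) :
    AnalyticAt ℂ F 0 ∧ ∀ m, PowerSeries.coeff m (taylor F) = c m := by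
  have h1 : HasFPowerSeriesAt F (FormalMultilinearSeries.ofScalars ℂ c) 0 := by
    rw [hasFPowerSeriesAt_iff]
    filter_upwards [h] with E hE
    simpa [FormalMultilinearSeries.coeff_ofScalars] using hE
  refine ⟨h1.analyticAt, fun m => ?_⟩
  have h2 := h1.analyticAt.hasFPowerSeriesAt.eq_formalMultilinearSeries h1
  have h3 := congrArg (fun p => FormalMultilinearSeries.coeff p m) h2
  simpa [FormalMultilinearSeries.coeff_ofScalars, coeff_taylor] using h3

/-- A germ all of whose exponents lie in one residue class `k` modulo `d` is `ε^k` times a germ in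
`ε^d`. -/
lemma exists_germ_in_pow {d k : ℕ} (hd : d ≠ 0) {u : ℂ → ℂ} (hu : AnalyticAt ℂ u 0)
    (hk : ∀ j, (¬ ∃ m, j = m * d + k) → PowerSeries.coeff j (taylor u) = 0) :
    ∃ F : ℂ → ℂ, AnalyticAt ℂ F 0 ∧
      (∀ m, PowerSeries.coeff m (taylor F) = PowerSeries.coeff (m * d + k) (taylor u)) ∧
      ∀ᶠ ε in 𝓝[≠] (0 : ℂ), u ε = ε ^ k * F (ε ^ d) := by
  set c : ℕ → ℂ := fun j => PowerSeries.coeff j (taylor u) with hc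
  obtain ⟨r, hr, hsum⟩ := Metric.eventually_nhds_iff.1 (hasSum_taylor hu)
  have hsub : ∀ ε : ℂ, ε ≠ 0 → dist ε 0 < r →
      HasSum (fun m => (ε ^ d) ^ m * c (m * d + k)) ((ε ^ k)⁻¹ * u ε) := by
    intro ε hε hεr
    have hinj : Function.Injective fun m : ℕ => m * d + k := by
      intro a b hab
      exact Nat.eq_of_mul_eq_mul_right (Nat.pos_of_ne_zero hd) (Nat.add_right_cancel hab)
    have h1 := (hinj.hasSum_iff (f := fun j => ε ^ j * c j) (a := u ε) (by
      intro j hj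
      have : c j = 0 := hk j (fun ⟨m, hm⟩ => hj ⟨m, hm.symm⟩)
      simp [this])).2 (hsum hεr)
    refine (h1.mul_left (ε ^ k)⁻¹).congr_fun ?_
    intro m
    simp only [Function.comp]
    have := pow_ne_zero k hε
    field_simp
    rw [pow_add, mul_comm m d]
    ring
  let F : ℂ → ℂ := fun E => ∑' m, E ^ m * c (m * d + k)
  have hF : ∀ᶠ E in 𝓝 (0 : ℂ), HasSum (fun m => E ^ m * c (m * d + k)) (F E) := by
    refine Metric.eventually_nhds_iff.2 ⟨r ^ d, pow_pos hr d, fun E hE => ?_⟩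
    refine Summable.hasSum ?_
    rcases eq_or_ne E 0 with rfl | hE0
    · refine (hasSum_single 0 fun m hm => ?_).summable
      rw [zero_pow hm, zero_mul]
    -- Convergence at `E` is that of the series of `u` at a `d`-th root of `E`.
    · obtain ⟨ε, rfl⟩ := IsAlgClosed.exists_pow_nat_eq E (Nat.pos_of_ne_zero hd)
      have hε : ε ≠ 0 := by
        rintro rfl
        exact hE0 (zero_pow hd)
      refine (hsub ε hε ?_).summable
      rw [dist_zero_right, norm_pow] at hE
      rw [dist_zero_right]
      exact lt_of_pow_lt_pow_left₀ d hr.le hE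
  obtain ⟨hFa, hFc⟩ := analyticAt_and_taylor_eq_of_hasSum hF
  refine ⟨F, hFa, hFc, ?_⟩
  rw [eventually_nhdsWithin_iff]
  refine Metric.eventually_nhds_iff.2 ⟨r, hr, fun ε hε hne => ?_⟩
  have h1 : F (ε ^ d) = (ε ^ k)⁻¹ * u ε := (hsub ε hne hε).tsum_eq
  rw [h1, mul_inv_cancel_left₀ (pow_ne_zero k hne)]

lemma iteratedDeriv_comp_mul_left (u : ℂ → ℂ) (c : ℂ) (j : ℕ) :
    iteratedDeriv j (fun ε => u (c * ε)) = fun ε => c ^ j * iteratedDeriv j u (c * ε) := by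
  induction j with
  | zero => simp
  | succ j ih =>
    ext ε
    rw [iteratedDeriv_succ, ih, deriv_const_mul_field, deriv_comp_mul_left, iteratedDeriv_succ,
      smul_eq_mul]
    ring

section

variable {n : ℕ} {lam0 : ℂ} {μ : Fin (n + 1) → ℂ → ℂ}

lemma IsEigenvalueBranches.Phi0Deriv_rotation (hre : lam0.re = 0) (him : lam0.im ≠ 0)
    (hμ : IsEigenvalueBranches n lam0 μ) (j : ℕ) (x t : ℝ) (i s : Fin (n + 1)) :
    Phi0Deriv n lam0 μ j x t i s = (rot n ^ (s : ℕ)) ^ j * Phi0Deriv n lam0 μ j x t i 0 := by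
  simp only [Phi0Deriv, Phi0, Matrix.of_apply]
  have h1 : (fun ε => h n lam0 (lamEps n lam0 ε) (μ s ε) x t i) =ᶠ[𝓝 0] fun ε =>
      (fun ε => h n lam0 (lamEps n lam0 ε) (μ 0 ε) x t i) (rot n ^ (s : ℕ) * ε) := by
    filter_upwards [hμ.rotation hre him s] with ε hε
    have : lamEps n lam0 (rot n ^ (s : ℕ) * ε) = lamEps n lam0 ε := by
      unfold lamEps
      rw [mul_pow, ← pow_mul, mul_comm (s : ℕ), pow_mul, (isPrimitiveRoot_rot n).pow_eq_one,
        one_pow, one_mul]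
    simp only [this, hε]
  refine (h1.iteratedDeriv j).eq_of_nhds.trans ?_
  refine (congrFun (iteratedDeriv_comp_mul_left
    (fun ε => h n lam0 (lamEps n lam0 ε) (μ 0 ε) x t i) (rot n ^ (s : ℕ)) j) 0).trans ?_
  simp

lemma matR_apply (n : ℕ) (lam0 : ℂ) (s k : Fin (n + 1)) :
    matR n lam0 s k = ((rot n ^ (k : ℕ))⁻¹) ^ (s : ℕ) * matR n lam0 0 k := by
  have hstar : star (rot n) = (rot n)⁻¹ := by
    have h1 : ‖rot n‖ = 1 := (isPrimitiveRoot_rot n).norm'_eq_one n.succ_ne_zero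
    rw [Complex.inv_eq_conj h1]
    rfl
  simp only [matR, Matrix.of_apply]
  rw [g_eq_rot_mul n lam0 s, mul_pow, star_mul', star_pow, star_pow, hstar]
  simp only [inv_pow]
  rw [← pow_mul, ← pow_mul, mul_comm (s : ℕ)]

open Classical in
/-- Summation over the branches filters the exponents by their residue class modulo `n + 1`. -/
lemma IsEigenvalueBranches.sum_Phi0Deriv_mul_matR (hre : lam0.re = 0) (him : lam0.im ≠ 0)
    (hμ : IsEigenvalueBranches n lam0 μ) (j : ℕ) (x t : ℝ) (i k : Fin (n + 1)) :
    ∑ s, Phi0Deriv n lam0 μ j x t i s * matR n lam0 s k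
      = if ∃ m, j = m * (n + 1) + k then
          (n + 1) * matR n lam0 0 k * Phi0Deriv n lam0 μ j x t i 0 else 0 := by
  have hprim := isPrimitiveRoot_rot n
  have hr0 : rot n ≠ 0 := hprim.ne_zero n.succ_ne_zero
  have h1 : ∀ s : Fin (n + 1), Phi0Deriv n lam0 μ j x t i s * matR n lam0 s k
      = (rot n ^ j * (rot n ^ (k : ℕ))⁻¹) ^ (s : ℕ)
        * (matR n lam0 0 k * Phi0Deriv n lam0 μ j x t i 0) := by
    intro s
    rw [hμ.Phi0Deriv_rotation hre him, matR_apply n lam0 s, mul_pow, ← pow_mul, mul_comm (s : ℕ),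
      pow_mul]
    ring
  simp only [h1, ← Finset.sum_mul]
  rw [Fin.sum_univ_eq_sum_range (fun s => (rot n ^ j * (rot n ^ (k : ℕ))⁻¹) ^ s)]
  split_ifs with hm
  · obtain ⟨m, rfl⟩ := hm
    have : rot n ^ (m * (n + 1) + k) * (rot n ^ (k : ℕ))⁻¹ = 1 := by
      rw [pow_add, mul_comm m, pow_mul, hprim.pow_eq_one, one_pow, one_mul,
        mul_inv_cancel₀ (pow_ne_zero _ hr0)]
    rw [this]
    simp
    ring
  · have hne : rot n ^ j * (rot n ^ (k : ℕ))⁻¹ ≠ 1 := by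
      intro h
      have h2 : rot n ^ j = rot n ^ (k : ℕ) :=
        (mul_inv_eq_one₀ (pow_ne_zero _ hr0)).1 h
      rw [← pow_mod_orderOf, ← hprim.eq_orderOf] at h2
      have h3 : j % (n + 1) = k := hprim.pow_inj (Nat.mod_lt _ n.succ_pos) k.2 h2
      exact hm ⟨j / (n + 1), by rw [← h3, Nat.div_add_mod' j (n + 1)]⟩
    rw [geom_sum_eq hne]
    have : (rot n ^ j * (rot n ^ (k : ℕ))⁻¹) ^ (n + 1) = 1 := by
      rw [mul_pow, inv_pow, ← pow_mul, ← pow_mul, mul_comm j, mul_comm (k : ℕ), pow_mul, pow_mul,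
        hprim.pow_eq_one]
      simp
    rw [this]
    simp

/-- The vector function `Φ̃(ε)` is holomorphic in `ε^{n+1}`, with the Taylor coefficients `Φ̃_m`
for `m < N`. -/
lemma IsEigenvalueBranches.exists_germ_PhiTildeFun (N : ℕ) (hre : lam0.re = 0) (him : lam0.im ≠ 0)
    (hμ : IsEigenvalueBranches n lam0 μ) (γ : ℕ → Matrix (Fin (n + 1)) (Fin (n + 1)) ℂ)
    (β : Fin (n + 1) → ℂ) (x t : ℝ) (i : Fin (n + 1)) :
    ∃ F : ℂ → ℂ, AnalyticAt ℂ F 0 ∧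
      (∀ m < N, PowerSeries.coeff m (taylor F) = PhiTilde n lam0 μ γ β m x t i) ∧
      ∀ᶠ ε in 𝓝[≠] (0 : ℂ), PhiTildeFun n N lam0 μ γ β ε x t i = F (ε ^ (n + 1)) := by
  have hh := fun s => hμ.analyticAt_h hre him s i x t
  have hterm : ∀ k s : Fin (n + 1), AnalyticAt ℂ
      (fun ε => matR n lam0 s k * h n lam0 (lamEps n lam0 ε) (μ s ε) x t i) 0 :=
    fun k s => analyticAt_const.fun_mul (hh s)
  have hu : ∀ k, AnalyticAt ℂ
      (fun ε => ∑ s, matR n lam0 s k * h n lam0 (lamEps n lam0 ε) (μ s ε) x t i) 0 :=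
    fun k => Finset.analyticAt_fun_sum _ fun s _ => hterm k s
  have hcoeff : ∀ (k : Fin (n + 1)) (j : ℕ), PowerSeries.coeff j
      (taylor fun ε => ∑ s, matR n lam0 s k * h n lam0 (lamEps n lam0 ε) (μ s ε) x t i)
      = (∑ s, Phi0Deriv n lam0 μ j x t i s * matR n lam0 s k) / (j.factorial : ℂ) := by
    intro k j
    rw [taylor_sum _ fun s _ => hterm k s, map_sum, Finset.sum_div]
    refine Finset.sum_congr rfl fun s _ => ?_
    rw [taylor_const_mul, PowerSeries.coeff_C_mul, coeff_taylor_h]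
    ring
  have hex := fun k : Fin (n + 1) => exists_germ_in_pow (d := n + 1) (k := k) n.succ_ne_zero (hu k)
    (by
      intro j hj
      rw [hcoeff, hμ.sum_Phi0Deriv_mul_matR hre him, if_neg hj, zero_div])
  choose F hFa hFc hFe using hex
  let Γ : Fin (n + 1) → ℂ → ℂ := fun k E => ∑ s ∈ Finset.range N, (γ s *ᵥ β) k * E ^ s
  have hΓt : ∀ k, ∀ s ∈ Finset.range N, AnalyticAt ℂ (fun E => (γ s *ᵥ β) k * E ^ s) 0 :=
    fun k s _ => by fun_prop
  have hΓa : ∀ k, AnalyticAt ℂ (Γ k) 0 := fun k => Finset.analyticAt_fun_sum _ (hΓt k)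
  have hΓc : ∀ k, ∀ m < N, PowerSeries.coeff m (taylor (Γ k)) = (γ m *ᵥ β) k := by
    intro k m hm
    simp only [Γ]
    rw [taylor_sum _ (hΓt k), map_sum]
    simp only [taylor_const_mul, taylor_pow, PowerSeries.coeff_C_mul, PowerSeries.coeff_X_pow]
    simp [hm]
  refine ⟨fun E => ∑ k, F k E * Γ k E,
    Finset.analyticAt_fun_sum _ fun k _ => (hFa k).fun_mul (hΓa k), ?_, ?_⟩
  · intro m hm
    rw [taylor_sum _ fun k _ => (hFa k).fun_mul (hΓa k), map_sum]
    have hmv : ∀ s, (PhiHat n lam0 μ s x t *ᵥ (γ (m - s) *ᵥ β)) i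
        = ∑ k, PhiHat n lam0 μ s x t i k * (γ (m - s) *ᵥ β) k := fun _ => rfl
    simp only [PhiTilde, Finset.sum_apply, hmv]
    rw [Finset.sum_comm]
    refine Finset.sum_congr rfl fun k _ => ?_
    rw [taylor_mul (hFa k) (hΓa k), PowerSeries.coeff_mul,
      Finset.Nat.sum_antidiagonal_eq_sum_range_succ_mk]
    refine Finset.sum_congr rfl fun s hs => ?_
    rw [hΓc k _ (by omega), hFc, hcoeff]
    have : s * (n + 1) + k = s * n + s + k := by ring
    simp only [PhiHat, Matrix.of_apply, Matrix.mulVec, dotProduct, this]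
  · filter_upwards [eventually_all.2 hFe, self_mem_nhdsWithin] with ε hε hne
    have hmv : PhiTildeFun n N lam0 μ γ β ε x t i
        = ∑ k, (Phi0 n lam0 μ x t ε * matR n lam0) i k *
          (Matrix.diagonal (fun k : Fin (n + 1) => (ε ^ (k : ℕ))⁻¹) *ᵥ
            ((∑ s ∈ Finset.range N, ε ^ (s * (n + 1)) • γ s) *ᵥ β)) k := by
      rw [PhiTildeFun, Matrix.mulVec_mulVec]
      rfl
    rw [hmv]
    refine Finset.sum_congr rfl fun k _ => ?_
    have h1 : (Phi0 n lam0 μ x t ε * matR n lam0) i k = ε ^ (k : ℕ) * F k (ε ^ (n + 1)) := by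
      rw [← hε k, Matrix.mul_apply]
      refine Finset.sum_congr rfl fun s _ => ?_
      simp only [Phi0, Matrix.of_apply]
      ring
    have h2 : ((∑ s ∈ Finset.range N, ε ^ (s * (n + 1)) • γ s) *ᵥ β) k = Γ k (ε ^ (n + 1)) := by
      simp only [Γ, Matrix.sum_mulVec, Finset.sum_apply, Matrix.smul_mulVec, Pi.smul_apply,
        smul_eq_mul]
      refine Finset.sum_congr rfl fun s _ => ?_
      rw [mul_comm s, pow_mul]
      ring
    have h3 : ε ^ (k : ℕ) ≠ 0 := pow_ne_zero _ hne
    rw [Matrix.mulVec_diagonal, h1, h2]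
    field_simp

lemma IsEigenvalueBranches.isBigO_PhiTildeFun (N : ℕ) (hre : lam0.re = 0) (him : lam0.im ≠ 0)
    (hμ : IsEigenvalueBranches n lam0 μ) (γ : ℕ → Matrix (Fin (n + 1)) (Fin (n + 1)) ℂ)
    (β : Fin (n + 1) → ℂ) (x t : ℝ) :
    (fun ε : ℂ => PhiTildeFun n N lam0 μ γ β ε x t
        - ∑ k ∈ Finset.range N, ε ^ (k * (n + 1)) • PhiTilde n lam0 μ γ β k x t)
      =O[𝓝[≠] (0 : ℂ)] fun ε : ℂ => ε ^ (N * (n + 1)) := by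
  refine isBigO_pi.2 fun i => ?_
  obtain ⟨F, hFa, hFc, hFe⟩ := hμ.exists_germ_PhiTildeFun N hre him γ β x t i
  have h1 := hFa.hasFPowerSeriesAt.isBigO_sub_partialSum_pow N
  have ht : Tendsto (fun ε : ℂ => ε ^ (n + 1)) (𝓝[≠] 0) (𝓝 0) := by
    have : Tendsto (fun ε : ℂ => ε ^ (n + 1)) (𝓝 0) (𝓝 (0 ^ (n + 1))) :=
      (continuous_pow (n + 1)).tendsto 0
    rw [zero_pow n.succ_ne_zero] at this
    exact this.mono_left nhdsWithin_le_nhds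
  have h2 := h1.comp_tendsto ht
  refine (h2.congr' ?_ ?_).trans (isBigO_refl _ _).norm_left
  · filter_upwards [hFe] with ε hε
    simp only [Function.comp, zero_add, Pi.sub_apply, Finset.sum_apply, Pi.smul_apply, smul_eq_mul,
      FormalMultilinearSeries.partialSum, hε]
    congr 1
    refine Finset.sum_congr rfl fun k hk => ?_
    rw [← hFc k (Finset.mem_range.1 hk), coeff_taylor, mul_comm k, pow_mul]
    simp [FormalMultilinearSeries.ofScalars, mul_comm]
  · refine Eventually.of_forall fun ε => ?_
    simp only [Function.comp]
    rw [← norm_pow, ← pow_mul, mul_comm N]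

end

/-! ### Linear combinations of Lax pair solutions -/

lemma IsLaxSolution.sum {n : ℕ} {ι : Type*} (I : Finset ι)
    {q : ℝ → ℝ → EuclideanSpace ℂ (Fin n)} {lam : ℂ} {Φ : ι → ℝ → ℝ → Fin (n + 1) → ℂ}
    (hΦ : ∀ s ∈ I, IsLaxSolution q lam (Φ s)) (c : ι → ℂ) :
    IsLaxSolution q lam fun x t => ∑ s ∈ I, c s • Φ s x t := by
  intro x t
  simp only [Matrix.mulVec_sum, Matrix.mulVec_smul]
  exact ⟨HasDerivAt.fun_sum fun s hs => (hΦ s hs x t).1.const_smul (c s),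
    HasDerivAt.fun_sum fun s hs => (hΦ s hs x t).2.const_smul (c s)⟩

section

variable {n : ℕ} {lam0 : ℂ} {μ : Fin (n + 1) → ℂ → ℂ}

lemma isLaxSolution_PhiTildeFun (N : ℕ) (γ : ℕ → Matrix (Fin (n + 1)) (Fin (n + 1)) ℂ)
    (β : Fin (n + 1) → ℂ) {ε : ℂ} (hε : ∀ s, IsLaxSolution (background n lam0) (lamEps n lam0 ε)
      (h n lam0 (lamEps n lam0 ε) (μ s ε))) :
    IsLaxSolution (background n lam0) (lamEps n lam0 ε) (PhiTildeFun n N lam0 μ γ β ε) := by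
  have h1 := IsLaxSolution.sum Finset.univ (fun s _ => hε s) (matR n lam0 *ᵥ
    (Matrix.diagonal (fun k : Fin (n + 1) => (ε ^ (k : ℕ))⁻¹) *ᵥ
      ((∑ s ∈ Finset.range N, ε ^ (s * (n + 1)) • γ s) *ᵥ β)))
  have h2 : PhiTildeFun n N lam0 μ γ β ε = fun x t => ∑ s, (matR n lam0 *ᵥ
    (Matrix.diagonal (fun k : Fin (n + 1) => (ε ^ (k : ℕ))⁻¹) *ᵥ
      ((∑ s ∈ Finset.range N, ε ^ (s * (n + 1)) • γ s) *ᵥ β))) s •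
        h n lam0 (lamEps n lam0 ε) (μ s ε) x t := by
    ext x t i
    simp only [PhiTildeFun, Finset.sum_apply, Pi.smul_apply, smul_eq_mul]
    rw [Matrix.mulVec, dotProduct]
    refine Finset.sum_congr rfl fun s _ => ?_
    rw [mul_comm]
    rfl
  rw [h2]
  exact h1

/-! ### The leading coefficient does not vanish -/

/-- A combination `∑ c_i w_i(μ_0(ε))` of the weights that vanishes to order `n + 1` is trivial:
multiplied by `∏ (z + b_s)` it is a polynomial of degree at most `n` with a zero of order `n + 1`
at `z₀`. -/
lemma IsEigenvalueBranches.weight_combination_eq_zero (hre : lam0.re = 0) (him : lam0.im ≠ 0)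
    (hμ : IsEigenvalueBranches n lam0 μ) (c : Fin (n + 1) → ℂ) {χ : ℂ → ℂ} (hχ : ContinuousAt χ 0)
    (h : ∀ᶠ ε in 𝓝 (0 : ℂ), ∑ i, c i * weight n lam0 (μ 0 ε) i = ε ^ (n + 1) * χ ε) : c = 0 := by
  classical
  let A : Polynomial ℂ := ∏ s : Fin n, (Polynomial.X + Polynomial.C (wave n lam0 s : ℂ))
  let p : Polynomial ℂ := Polynomial.C (c 0) * A + ∑ j : Fin n,
    Polynomial.C (c j.succ * amp n lam0 j) *
      ∏ s ∈ Finset.univ.erase j, (Polynomial.X + Polynomial.C (wave n lam0 s : ℂ))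
  have hdeg : p.natDegree ≤ n := by
    refine Polynomial.natDegree_add_le_of_degree_le ?_ ?_
    · refine (Polynomial.natDegree_C_mul_le _ _).trans ((Polynomial.natDegree_prod_le _ _).trans ?_)
      simp
    · refine Polynomial.natDegree_sum_le_of_forall_le _ _ fun j _ => ?_
      refine (Polynomial.natDegree_C_mul_le _ _).trans ((Polynomial.natDegree_prod_le _ _).trans ?_)
      simp
  have hpe : ∀ z : ℂ, (∀ j : Fin n, z + (wave n lam0 j : ℂ) ≠ 0) →
      p.eval z = A.eval z * ∑ i, c i * weight n lam0 z i := by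
    intro z hz
    simp only [p, A, Polynomial.eval_add, Polynomial.eval_mul, Polynomial.eval_C,
      Polynomial.eval_prod, Polynomial.eval_X, Polynomial.eval_finsetSum, Fin.sum_univ_succ,
      weight, Matrix.cons_val_zero, Matrix.cons_val_succ]
    rw [mul_add, Finset.mul_sum]
    congr 1
    · ring
    · refine Finset.sum_congr rfl fun j _ => ?_
      rw [← Finset.mul_prod_erase _ _ (Finset.mem_univ j)]
      have := hz j
      field_simp
  obtain ⟨h0, hE⟩ := hμ.equation hre him 0
  have hμc := (hμ.analytic 0).continuousAt
  -- If `p = (z - z₀)^m q` with `m ≤ n` and `q(z₀) ≠ 0`, then `p(μ_0(ε))` vanishes to order exactly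
  -- `m`, because `μ_0 - z₀ = ε g_0(μ_0)` and `g_0(z₀) ≠ 0`.
  have hp0 : p = 0 := by
    by_contra hne
    obtain ⟨q, hq, hq0⟩ := Polynomial.exists_eq_pow_rootMultiplicity_mul_and_not_dvd p hne
      (z0 n lam0)
    set m := p.rootMultiplicity (z0 n lam0) with hm
    have hmn : m ≤ n := by
      have := Polynomial.natDegree_le_of_dvd (Polynomial.pow_rootMultiplicity_dvd p (z0 n lam0)) hne
      rw [Polynomial.natDegree_pow, Polynomial.natDegree_X_sub_C, mul_one] at this
      omega
    have hqz : q.eval (z0 n lam0) ≠ 0 := fun h => hq0 (Polynomial.dvd_iff_isRoot.2 h)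
    have hl : ContinuousAt (fun ε => g n lam0 0 (μ 0 ε) ^ m * q.eval (μ 0 ε)) 0 := by
      refine ContinuousAt.mul (ContinuousAt.pow ?_ m) ?_
      · exact ContinuousAt.comp' (by rw [h0]; exact (analyticAt_g him 0).continuousAt) hμc
      · exact ContinuousAt.comp' q.continuous.continuousAt hμc
    have hr : ContinuousAt (fun ε => ε ^ (n + 1 - m) * (A.eval (μ 0 ε) * χ ε)) 0 := by
      refine ContinuousAt.mul (continuousAt_id.pow _) (ContinuousAt.mul ?_ hχ)
      exact ContinuousAt.comp' A.continuous.continuousAt hμc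
    have heq : (fun ε => g n lam0 0 (μ 0 ε) ^ m * q.eval (μ 0 ε)) =ᶠ[𝓝[≠] 0]
        fun ε => ε ^ (n + 1 - m) * (A.eval (μ 0 ε) * χ ε) := by
      have hall := (h.and (hE.and (hμ.eventually_add_wave_ne_zero hre him 0))).filter_mono
        (nhdsWithin_le_nhds (s := {(0 : ℂ)}ᶜ))
      filter_upwards [hall, self_mem_nhdsWithin] with ε h1 hε
      obtain ⟨e1, e2, e3⟩ := h1
      have e4 := hpe _ e3
      rw [e1, hq] at e4
      simp only [Polynomial.eval_mul, Polynomial.eval_pow, Polynomial.eval_sub, Polynomial.eval_X,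
        Polynomial.eval_C] at e4
      rw [e2, mul_pow] at e4
      apply mul_left_cancel₀ (pow_ne_zero m hε)
      rw [← mul_assoc, e4, ← mul_assoc (ε ^ m), ← pow_add, Nat.add_sub_of_le (by omega)]
      ring
    have hlim := tendsto_nhds_unique_of_eventuallyEq
      (hl.tendsto.mono_left nhdsWithin_le_nhds) (hr.tendsto.mono_left nhdsWithin_le_nhds) heq
    rw [h0, zero_pow (by omega), zero_mul] at hlim
    exact (mul_ne_zero (pow_ne_zero m (g_z0_ne_zero him 0)) hqz) hlim
  have hA : A ≠ 0 := (Polynomial.monic_prod_of_monic _ _ fun s _ =>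
    Polynomial.monic_X_add_C _).ne_zero
  -- At `-b_j` only the term of `c_j` survives.
  have hs : ∀ j : Fin n, c j.succ = 0 := by
    intro j
    have h1 := congrArg (Polynomial.eval (-(wave n lam0 j : ℂ))) hp0
    simp only [p, A, Polynomial.eval_add, Polynomial.eval_mul, Polynomial.eval_C,
      Polynomial.eval_prod, Polynomial.eval_X, Polynomial.eval_finsetSum,
      Polynomial.eval_zero] at h1
    rw [Finset.prod_eq_zero (Finset.mem_univ j) (neg_add_cancel _), mul_zero, zero_add,
      Finset.sum_eq_single j] at h1
    · have h2 : ∏ s ∈ Finset.univ.erase j, (-(wave n lam0 j : ℂ) + wave n lam0 s) ≠ 0 := by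
        refine Finset.prod_ne_zero_iff.2 fun s hs hh => ?_
        have : (wave n lam0 s : ℂ) = wave n lam0 j := by linear_combination hh
        exact (Finset.mem_erase.1 hs).1 (wave_injective hre him (by exact_mod_cast this))
      have h3 : (amp n lam0 j : ℂ) ≠ 0 := by exact_mod_cast amp_ne_zero him j
      simpa [h2, h3] using h1
    · intro k _ hk
      rw [Finset.prod_eq_zero (Finset.mem_erase.2 ⟨hk.symm, Finset.mem_univ j⟩) (neg_add_cancel _),
        mul_zero]
    · exact fun hj => absurd (Finset.mem_univ j) hj
  have hc0 : c 0 = 0 := by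
    have : p = Polynomial.C (c 0) * A := by simp [p, hs]
    rw [this] at hp0
    simpa [hA] using hp0
  ext i
  induction i using Fin.cases with
  | zero => exact hc0
  | succ j => exact hs j

/-- The columns of `Φ̂_0` are, up to nonzero factors, the Taylor coefficients of `h(μ_0(ε))` of order
`0, …, n`; a vector in the left kernel gives a combination of the entries of `h(μ_0(ε))` that
vanishes to order `n + 1`. -/
lemma IsEigenvalueBranches.det_PhiHat_ne_zero (hre : lam0.re = 0) (him : lam0.im ≠ 0)
    (hμ : IsEigenvalueBranches n lam0 μ) (x t : ℝ) : (PhiHat n lam0 μ 0 x t).det ≠ 0 := by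
  intro hdet
  obtain ⟨v, hv, hv0⟩ := Matrix.exists_vecMul_eq_zero_iff.2 hdet
  have hψ : AnalyticAt ℂ (fun ε => ∑ i, v i * h n lam0 (lamEps n lam0 ε) (μ 0 ε) x t i) 0 :=
    Finset.analyticAt_fun_sum _ fun i _ => analyticAt_const.fun_mul (hμ.analyticAt_h hre him 0 i x t)
  have hn : ((n : ℂ) + 1) ≠ 0 := by exact_mod_cast n.succ_ne_zero
  have horder : ((n + 1 : ℕ) : ℕ∞) ≤
      analyticOrderAt (fun ε => ∑ i, v i * h n lam0 (lamEps n lam0 ε) (μ 0 ε) x t i) 0 := by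
    rw [natCast_le_analyticOrderAt_iff_iteratedDeriv_eq_zero hψ]
    intro k hk
    have h1 := congrFun hv0 ⟨k, hk⟩
    simp only [Matrix.vecMul, dotProduct, PhiHat, Matrix.of_apply, Matrix.mulVec, zero_mul,
      zero_add, Pi.zero_apply] at h1
    simp only [hμ.sum_Phi0Deriv_mul_matR hre him k x t _ ⟨k, hk⟩] at h1
    rw [iteratedDeriv_fun_sum fun i _ =>
      (analyticAt_const.fun_mul (hμ.analyticAt_h hre him 0 i x t)).contDiffAt]
    simp only [iteratedDeriv_const_mul_field]
    have hR : matR n lam0 0 ⟨k, hk⟩ ≠ 0 := by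
      simp only [matR, Matrix.of_apply]
      exact star_ne_zero.2 (pow_ne_zero _ (g_z0_ne_zero him 0))
    have hf : (k.factorial : ℂ) ≠ 0 := by exact_mod_cast k.factorial_ne_zero
    have hex : ∃ m, k = m * (n + 1) + k := ⟨0, by simp⟩
    simp only [hex, if_true] at h1
    have h2 : ((n : ℂ) + 1) * matR n lam0 0 ⟨k, hk⟩ / (k.factorial : ℂ) *
        ∑ i, v i * iteratedDeriv k (fun ε => h n lam0 (lamEps n lam0 ε) (μ 0 ε) x t i) 0 = 0 := by
      refine Eq.trans ?_ h1
      rw [Finset.mul_sum]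
      refine Finset.sum_congr rfl fun i _ => ?_
      simp only [Phi0Deriv, Phi0, Matrix.of_apply]
      ring
    exact (mul_eq_zero.1 h2).resolve_left (div_ne_zero (mul_ne_zero hn hR) hf)
  obtain ⟨χ, hχ, hχe⟩ := (natCast_le_analyticOrderAt hψ).1 horder
  -- The exponential factors are split off, so that only the weights depend on `ε` on the left.
  let eps : ℂ → ℂ := fun ε => Complex.exp (expX (lamEps n lam0 ε) (μ 0 ε) * x
    + expT n lam0 (lamEps n lam0 ε) (μ 0 ε) * t)
  have heps : ContinuousAt eps 0 := by
    have h1 := hμ.analyticAt_expX 0 0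
    have h2 := hμ.analyticAt_expT 0 0
    simp only [add_zero] at h1 h2
    exact ((h1.mul analyticAt_const).add (h2.mul analyticAt_const)).cexp.continuousAt
  let c : Fin (n + 1) → ℂ := fun i => v i * Complex.exp (Complex.I * waveNumber n lam0 i * x
    + Complex.I * frequency n lam0 i * t)
  have hc := hμ.weight_combination_eq_zero hre him c (χ := fun ε => (eps ε)⁻¹ * χ ε)
    ((heps.inv₀ (Complex.exp_ne_zero _)).mul hχ.continuousAt) (by
      filter_upwards [hχe] with ε hε
      have h1 : ∑ i, c i * weight n lam0 (μ 0 ε) i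
          = (eps ε)⁻¹ * ∑ i, v i * h n lam0 (lamEps n lam0 ε) (μ 0 ε) x t i := by
        rw [Finset.mul_sum]
        refine Finset.sum_congr rfl fun i _ => ?_
        rw [h_apply, add_mul, add_mul, add_add_add_comm, Complex.exp_add]
        have : Complex.exp (expX (lamEps n lam0 ε) (μ 0 ε) * x
          + expT n lam0 (lamEps n lam0 ε) (μ 0 ε) * t) ≠ 0 := Complex.exp_ne_zero _
        simp only [eps, c]
        field_simp
      rw [h1, hε]
      simp
      ring)
  apply hv
  ext i
  have := congrFun hc i
  simpa [c, Complex.exp_ne_zero] using this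

lemma IsEigenvalueBranches.PhiTilde_zero_ne_zero (hre : lam0.re = 0) (him : lam0.im ≠ 0)
    (hμ : IsEigenvalueBranches n lam0 μ) {γ : ℕ → Matrix (Fin (n + 1)) (Fin (n + 1)) ℂ}
    {β : Fin (n + 1) → ℂ} (hγ : γ 0 *ᵥ β ≠ 0) (x t : ℝ) : PhiTilde n lam0 μ γ β 0 x t ≠ 0 := by
  intro h
  simp only [PhiTilde, zero_add, Finset.sum_range_one] at h
  exact hμ.det_PhiHat_ne_zero hre him x t (Matrix.exists_mulVec_eq_zero_iff.1 ⟨_, hγ, h⟩)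

end

/-! ### The Sylvester equation for `M` -/

/-- The nilpotent shift, with ones above the diagonal. -/
def shift (N : ℕ) : Matrix (Fin N) (Fin N) ℂ :=
  Matrix.of fun j k => if (j : ℕ) + 1 = k then 1 else 0

/-- The Jordan block that plays the role of the diagonal matrix of the spectral parameters. -/
def jordan (N : ℕ) (lam0 : ℂ) : Matrix (Fin N) (Fin N) ℂ := lam0 • (1 + shift N)

lemma mul_shift_apply {ι : Type*} {N : ℕ} (u : ι → ℕ → ℂ) (i : ι) (k : Fin N) :
    ((Matrix.of fun i (k : Fin N) => u i k) * shift N) i k = delay 1 (u i) k := by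
  rw [Matrix.mul_apply, delay]
  simp only [shift, Matrix.of_apply, mul_ite, mul_one, mul_zero]
  split_ifs with hk
  · rw [Finset.sum_eq_single ⟨(k : ℕ) - 1, by omega⟩]
    · simp [Nat.sub_add_cancel hk]
    · intro j _ hj
      rw [if_neg]
      intro h
      apply hj
      apply Fin.ext
      simp [← h]
    · exact fun h => absurd (Finset.mem_univ _) h
  · refine Finset.sum_eq_zero fun j _ => if_neg ?_
    omega

lemma shift_conjTranspose_mul_apply {N : ℕ} (u : ℕ → ℕ → ℂ) (m k : Fin N) :
    ((shift N)ᴴ * Matrix.of fun m k : Fin N => u m k) m k = delay 1 (fun m => u m k) m := by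
  rw [Matrix.mul_apply, delay]
  simp only [shift, Matrix.conjTranspose_apply, Matrix.of_apply, apply_ite star, star_one,
    star_zero, ite_mul, one_mul, zero_mul]
  split_ifs with hk
  · rw [Finset.sum_eq_single ⟨(m : ℕ) - 1, by omega⟩]
    · simp [Nat.sub_add_cancel hk]
    · intro j _ hj
      rw [if_neg]
      intro h
      apply hj
      apply Fin.ext
      simp [← h]
    · exact fun h => absurd (Finset.mem_univ _) h
  · refine Finset.sum_eq_zero fun j _ => if_neg ?_
    omega

lemma shift_mulVec_apply {N : ℕ} (v : Fin N → ℂ) (j : Fin N) :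
    (shift N *ᵥ v) j = if h : (j : ℕ) + 1 < N then v ⟨j + 1, h⟩ else 0 := by
  rw [Matrix.mulVec, dotProduct]
  simp only [shift, Matrix.of_apply, ite_mul, one_mul, zero_mul]
  split_ifs with h
  · rw [Finset.sum_eq_single ⟨(j : ℕ) + 1, h⟩]
    · simp
    · intro k _ hk
      rw [if_neg]
      intro hh
      exact hk (Fin.ext hh.symm)
    · exact fun h => absurd (Finset.mem_univ _) h
  · refine Finset.sum_eq_zero fun k _ => if_neg ?_
    have := k.2
    omega

/-- The equation reads `2 X_{m,k} = -X_{m,k-1} - X_{m-1,k}`, which determines `X` by induction on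
`m + k`. -/
lemma eq_zero_of_shift_sylvester {N : ℕ} {X : Matrix (Fin N) (Fin N) ℂ}
    (h : (2 : ℂ) • X + X * shift N + (shift N)ᴴ * X = 0) : X = 0 := by
  let u : ℕ → ℕ → ℂ := fun m k => if h : m < N ∧ k < N then X ⟨m, h.1⟩ ⟨k, h.2⟩ else 0
  have hX : X = Matrix.of fun m k : Fin N => u m k := by
    ext m k
    simp [u]
  have hrec : ∀ m k : Fin N,
      2 * u m k + delay 1 (u m) k + delay 1 (fun m => u m k) m = 0 := by
    intro m k
    have h1 := congrFun (congrFun h m) k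
    rw [hX] at h1
    simp only [Matrix.add_apply, shift_conjTranspose_mul_apply, Matrix.smul_apply,
      smul_eq_mul, Matrix.zero_apply] at h1
    rw [mul_shift_apply (fun (m : Fin N) k => u m k)] at h1
    exact h1
  have key : ∀ d : ℕ, ∀ m k : Fin N, (m : ℕ) + k = d → u m k = 0 := by
    intro d
    induction d using Nat.strong_induction_on with
    | _ d ih =>
      intro m k hmk
      have h1 : delay 1 (u m) k = 0 := by
        unfold delay
        split_ifs with hk
        · exact ih ((m : ℕ) + (k - 1)) (by omega) m ⟨k - 1, by omega⟩ rfl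
        · rfl
      have h2 : delay 1 (fun m => u m k) m = 0 := by
        unfold delay
        split_ifs with hk
        · exact ih ((m : ℕ) - 1 + k) (by omega) ⟨m - 1, by omega⟩ k rfl
        · rfl
      have h3 := hrec m k
      rw [h1, h2] at h3
      simpa using h3
  rw [hX]
  ext m k
  exact key _ m k rfl

lemma jordan_sylvester {N : ℕ} {lam0 : ℂ} (hre : lam0.re = 0) (X : Matrix (Fin N) (Fin N) ℂ) :
    X * jordan N lam0 - (jordan N lam0)ᴴ * X
      = lam0 • ((2 : ℂ) • X + X * shift N + (shift N)ᴴ * X) := by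
  have hs : star lam0 = -lam0 := by
    apply Complex.ext <;> simp [hre]
  unfold jordan
  rw [Matrix.conjTranspose_smul, hs, Matrix.conjTranspose_add, Matrix.conjTranspose_one,
    Matrix.mul_smul, Matrix.smul_mul, mul_add, add_mul, mul_one, one_mul]
  module

lemma eq_zero_of_jordan_sylvester {N : ℕ} {lam0 : ℂ} (hre : lam0.re = 0) (him : lam0.im ≠ 0)
    {X : Matrix (Fin N) (Fin N) ℂ} (h : X * jordan N lam0 - (jordan N lam0)ᴴ * X = 0) : X = 0 := by
  rw [jordan_sylvester hre] at h
  refine eq_zero_of_shift_sylvester ((smul_eq_zero.1 h).resolve_left ?_)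
  rintro rfl
  simp at him

/-- The generating function of the numbers `K(s,l) = (-1/2)^{s+l} C(s+l,l)` is
`2 / (2 + u + v)`. -/
lemma kernel_rec (s l : ℕ) :
    2 * ((-1 / 2 : ℂ) ^ (s + l) * ((s + l).choose l : ℂ))
      + delay 1 (fun l => (-1 / 2 : ℂ) ^ (s + l) * ((s + l).choose l : ℂ)) l
      + delay 1 (fun s => (-1 / 2 : ℂ) ^ (s + l) * ((s + l).choose l : ℂ)) s
      = if s = 0 ∧ l = 0 then 2 else 0 := by
  unfold delay
  rcases s with _ | s <;> rcases l with _ | l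
  · simp
  · simp [pow_succ]; ring
  · simp [pow_succ]; ring
  · have h : (s + 1 + (l + 1)).choose (l + 1)
        = (s + 1 + l).choose l + (s + (l + 1)).choose (l + 1) := by
      rw [show s + 1 + (l + 1) = (s + 1 + l) + 1 by ring, Nat.choose_succ_succ,
        show s + (l + 1) = s + 1 + l by ring]
    simp only [h, le_add_iff_nonneg_left, zero_le, if_true, Nat.add_sub_cancel, Nat.succ_ne_zero,
      false_and, if_false, Nat.cast_add]
    rw [show s + 1 + (l + 1) = (s + 1 + l) + 1 by ring, pow_succ,
      show s + (l + 1) = s + 1 + l by ring]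
    ring

lemma sum_delay_mul (a c : ℕ → ℂ) (k : ℕ) :
    delay 1 (fun k => ∑ l ∈ Finset.range (k + 1), a l * c (k - l)) k
      = ∑ l ∈ Finset.range (k + 1), delay 1 a l * c (k - l) := by
  rcases k with _ | k
  · simp [delay]
  · rw [Finset.sum_range_succ' _ (k + 1)]
    simp [delay]

/-- The explicit double sum defining `M` solves the equation `2 M + M S + Sᴴ M = 2 c T`. -/
lemma kernel_sum_sylvester (T : ℕ → ℕ → ℂ) (m k : ℕ) :
    let G : ℕ → ℕ → ℂ := fun m k => ∑ s ∈ Finset.range (m + 1), ∑ l ∈ Finset.range (k + 1),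
      (-1 / 2 : ℂ) ^ (s + l) * ((s + l).choose l : ℂ) * T (m - s) (k - l)
    2 * G m k + delay 1 (G m) k + delay 1 (fun m => G m k) m = 2 * T m k := by
  intro G
  have h1 : delay 1 (G m) k = ∑ s ∈ Finset.range (m + 1), ∑ l ∈ Finset.range (k + 1),
      delay 1 (fun l => (-1 / 2 : ℂ) ^ (s + l) * ((s + l).choose l : ℂ)) l
        * T (m - s) (k - l) := by
    simp only [← sum_delay_mul]
    unfold delay
    split_ifs
    · rfl
    · simp
  have h2 : delay 1 (fun m => G m k) m = ∑ s ∈ Finset.range (m + 1), ∑ l ∈ Finset.range (k + 1),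
      delay 1 (fun s => (-1 / 2 : ℂ) ^ (s + l) * ((s + l).choose l : ℂ)) s
        * T (m - s) (k - l) := by
    rw [Finset.sum_comm]
    have h' : ∀ l, ∑ s ∈ Finset.range (m + 1),
        delay 1 (fun s => (-1 / 2 : ℂ) ^ (s + l) * ((s + l).choose l : ℂ)) s * T (m - s) (k - l)
        = delay 1 (fun m => ∑ s ∈ Finset.range (m + 1),
          (-1 / 2 : ℂ) ^ (s + l) * ((s + l).choose l : ℂ) * T (m - s) (k - l)) m :=
      fun l => (sum_delay_mul _ (fun m => T m (k - l)) m).symm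
    simp only [h']
    unfold delay
    split_ifs
    · simp only [G]
      rw [Finset.sum_comm]
    · simp
  rw [h1, h2]
  simp only [G, Finset.mul_sum, ← Finset.sum_add_distrib]
  have h3 : ∀ s l : ℕ, 2 * ((-1 / 2 : ℂ) ^ (s + l) * ((s + l).choose l : ℂ) * T (m - s) (k - l))
      + delay 1 (fun l => (-1 / 2 : ℂ) ^ (s + l) * ((s + l).choose l : ℂ)) l * T (m - s) (k - l)
      + delay 1 (fun s => (-1 / 2 : ℂ) ^ (s + l) * ((s + l).choose l : ℂ)) s * T (m - s) (k - l)
      = if s = 0 then (if l = 0 then 2 * T m k else 0) else 0 := by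
    intro s l
    have h4 := kernel_rec s l
    rw [← mul_assoc, ← add_mul, ← add_mul, h4]
    by_cases hs : s = 0 <;> by_cases hl : l = 0 <;> simp [hs, hl]
  simp [h3]

section

variable {n N : ℕ} {lam0 : ℂ} {μ : Fin (n + 1) → ℂ → ℂ}
  {γ : ℕ → Matrix (Fin (n + 1)) (Fin (n + 1)) ℂ} {β : Fin (n + 1) → ℂ}

lemma matM_sylvester (hre : lam0.re = 0) (him : lam0.im ≠ 0) (x t : ℝ) :
    matM n N lam0 μ γ β x t * jordan N lam0 - (jordan N lam0)ᴴ * matM n N lam0 μ γ β x t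
      = (matY n N lam0 μ γ β x t)ᴴ * matY n N lam0 μ γ β x t := by
  have hl : lam0 ≠ 0 := by
    rintro rfl
    simp at him
  let T : ℕ → ℕ → ℂ := fun m k =>
    star (PhiTilde n lam0 μ γ β m x t) ⬝ᵥ PhiTilde n lam0 μ γ β k x t
  let G : ℕ → ℕ → ℂ := fun m k => ∑ s ∈ Finset.range (m + 1), ∑ l ∈ Finset.range (k + 1),
      (-1 / 2 : ℂ) ^ (s + l) * ((s + l).choose l : ℂ) * T (m - s) (k - l)
  have hM : matM n N lam0 μ γ β x t
      = (1 / (2 * lam0)) • Matrix.of fun m k : Fin N => G m k := by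
    ext m k
    rw [two_mul_lam0 n hre]
    rfl
  rw [jordan_sylvester hre, hM]
  ext m k
  have hS := kernel_sum_sylvester T m k
  simp only at hS
  simp only [Matrix.smul_apply, Matrix.add_apply, Matrix.smul_mul, Matrix.mul_smul,
    shift_conjTranspose_mul_apply, smul_eq_mul]
  rw [mul_shift_apply (fun (m : Fin N) k => G m k)]
  have hT : ((matY n N lam0 μ γ β x t)ᴴ * matY n N lam0 μ γ β x t) m k = T m k := rfl
  rw [hT]
  simp only [Matrix.of_apply]
  field_simp
  linear_combination hS

end

section

variable {N : ℕ} {lam0 : ℂ} {ι : Type*} [Fintype ι] {M : Matrix (Fin N) (Fin N) ℂ}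
  {Y : Matrix ι (Fin N) ℂ}

lemma conjTranspose_eq_neg_of_sylvester (hre : lam0.re = 0) (him : lam0.im ≠ 0)
    (h : M * jordan N lam0 - (jordan N lam0)ᴴ * M = Yᴴ * Y) : Mᴴ = -M := by
  have h1 := congrArg Matrix.conjTranspose h
  simp only [Matrix.conjTranspose_sub, Matrix.conjTranspose_mul,
    Matrix.conjTranspose_conjTranspose] at h1
  have h2 : (Mᴴ + M) * jordan N lam0 - (jordan N lam0)ᴴ * (Mᴴ + M) = 0 := by
    rw [add_mul, mul_add]
    have : Mᴴ * jordan N lam0 + M * jordan N lam0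
        - ((jordan N lam0)ᴴ * Mᴴ + (jordan N lam0)ᴴ * M)
        = (M * jordan N lam0 - (jordan N lam0)ᴴ * M)
          - ((jordan N lam0)ᴴ * Mᴴ - Mᴴ * jordan N lam0) := by abel
    rw [this, h, h1, sub_self]
  exact eq_neg_of_add_eq_zero_left (eq_zero_of_jordan_sylvester hre him h2)

open ComplexOrder in
/-- The kernel of a solution `M` of `M Λ - Λᴴ M = Yᴴ Y` lies in the kernel of `Y` and is invariant
under the nilpotent shift; if it is not zero, it contains the first basis vector, so that the first
column of `Y` is zero. -/
lemma det_ne_zero_of_sylvester (hre : lam0.re = 0) (him : lam0.im ≠ 0)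
    (h : M * jordan N lam0 - (jordan N lam0)ᴴ * M = Yᴴ * Y)
    (hY : ∀ k : Fin N, (k : ℕ) = 0 → (fun i => Y i k) ≠ 0) : M.det ≠ 0 := by
  have hl : lam0 ≠ 0 := by
    rintro rfl
    simp at him
  have hM := conjTranspose_eq_neg_of_sylvester hre him h
  have hker : ∀ v : Fin N → ℂ, M *ᵥ v = 0 → Y *ᵥ v = 0 ∧ M *ᵥ (shift N *ᵥ v) = 0 := by
    intro v hv
    have e1 : M *ᵥ (jordan N lam0 *ᵥ v) = Yᴴ *ᵥ (Y *ᵥ v) := by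
      have h1 := congrArg (fun A => A *ᵥ v) h
      simp only [Matrix.sub_mulVec, ← Matrix.mulVec_mulVec, hv, Matrix.mulVec_zero, sub_zero] at h1
      exact h1
    have e2 : star v ᵥ* M = 0 := by
      have h2 : star (Mᴴ *ᵥ v) = star v ᵥ* M := by
        rw [Matrix.star_mulVec, Matrix.conjTranspose_conjTranspose]
      rw [← h2, hM, Matrix.neg_mulVec, hv]
      simp
    have e3 : Y *ᵥ v = 0 := by
      have h3 : star (Y *ᵥ v) ⬝ᵥ (Y *ᵥ v) = 0 := by
        rw [Matrix.star_mulVec, ← Matrix.dotProduct_mulVec, ← e1, Matrix.dotProduct_mulVec, e2,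
          zero_dotProduct]
      exact dotProduct_star_self_eq_zero.1 h3
    refine ⟨e3, ?_⟩
    rw [e3, Matrix.mulVec_zero, jordan, Matrix.smul_mulVec, Matrix.add_mulVec, Matrix.one_mulVec,
      Matrix.mulVec_smul, Matrix.mulVec_add, hv, zero_add] at e1
    exact (smul_eq_zero.1 e1).resolve_left hl
  have hind : ∀ d : ℕ, ∀ v : Fin N → ℂ, M *ᵥ v = 0 → (∀ i : Fin N, d ≤ i → v i = 0) → v = 0 := by
    intro d
    induction d with
    | zero =>
      intro v _ hv
      ext i
      exact hv i (Nat.zero_le _)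
    | succ d ih =>
      intro v hv hd
      have h0 : shift N *ᵥ v = 0 := by
        refine ih _ (hker v hv).2 fun i hi => ?_
        rw [shift_mulVec_apply]
        split_ifs with h
        · exact hd _ (by simp; omega)
        · rfl
      have hpos : ∀ i : Fin N, (i : ℕ) ≠ 0 → v i = 0 := by
        intro i hi
        have h1 := congrFun h0 ⟨(i : ℕ) - 1, by omega⟩
        rw [shift_mulVec_apply] at h1
        simp only [Nat.sub_add_cancel (Nat.one_le_iff_ne_zero.2 hi), Pi.zero_apply] at h1
        simpa using h1
      ext i
      by_cases hi : (i : ℕ) = 0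
      · by_contra hvi
        refine hY i hi (funext fun r => ?_)
        have h1 := congrFun (hker v hv).1 r
        rw [Matrix.mulVec, dotProduct, Finset.sum_eq_single i] at h1
        · exact (mul_eq_zero.1 h1).resolve_right hvi
        · intro k _ hk
          rw [hpos k, mul_zero]
          intro h
          exact hk (Fin.ext (h.trans hi.symm))
        · exact fun h => absurd (Finset.mem_univ _) h
      · exact hpos i hi
  intro hdet
  obtain ⟨v, hv, hv0⟩ := Matrix.exists_mulVec_eq_zero_iff.2 hdet
  exact hv (hind N v hv0 fun i hi => absurd i.2 (by omega))

end

lemma IsEigenvalueBranches.det_matM_ne_zero {n : ℕ} (N : ℕ) {lam0 : ℂ}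
    {μ : Fin (n + 1) → ℂ → ℂ} (hre : lam0.re = 0) (him : lam0.im ≠ 0)
    (hμ : IsEigenvalueBranches n lam0 μ) {γ : ℕ → Matrix (Fin (n + 1)) (Fin (n + 1)) ℂ}
    {β : Fin (n + 1) → ℂ} (hγ : γ 0 *ᵥ β ≠ 0) (x t : ℝ) :
    (matM n N lam0 μ γ β x t).det ≠ 0 := by
  refine det_ne_zero_of_sylvester hre him (matM_sylvester hre him x t) fun k hk => ?_
  simp only [matY, Matrix.of_apply, hk]
  exact hμ.PhiTilde_zero_ne_zero hre him hγ x t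

/-! ### Newton interpolation with confluent nodes -/

section

variable {N : ℕ}

/-- The values `∏_{j<i} (E_k - E_j)` of the Newton basis polynomials at the nodes. -/
def newton (E : Fin N → ℂ) : Matrix (Fin N) (Fin N) ℂ :=
  Matrix.of fun i k => ∏ j ∈ Finset.Iio i, (E k - E j)

lemma newton_apply_eq_zero (E : Fin N → ℂ) {i k : Fin N} (h : k < i) : newton E i k = 0 :=
  Finset.prod_eq_zero (Finset.mem_Iio.2 h) (sub_self _)

lemma det_newton_ne_zero {E : Fin N → ℂ} (hE : Function.Injective E) : (newton E).det ≠ 0 := by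
  have h : (newton E).IsUpperTriangular := fun i k h => newton_apply_eq_zero E h
  rw [Matrix.det_of_isUpperTriangular h]
  refine Finset.prod_ne_zero_iff.2 fun i _ => Finset.prod_ne_zero_iff.2 fun j hj => ?_
  exact sub_ne_zero.2 fun h => (Finset.mem_Iio.1 hj).ne (hE h).symm

/-- Multiplication by the variable is bidiagonal in the Newton basis. -/
lemma newton_mul_diagonal (E : Fin N → ℂ) :
    newton E * Matrix.diagonal E = (Matrix.diagonal E + shift N) * newton E := by
  ext i k
  have h1 : (shift N * newton E) i k = (shift N *ᵥ fun i => newton E i k) i := rfl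
  rw [add_mul, Matrix.add_apply, Matrix.mul_diagonal, Matrix.diagonal_mul, h1,
    shift_mulVec_apply]
  split_ifs with h
  · have h2 : Finset.Iio (⟨(i : ℕ) + 1, h⟩ : Fin N) = insert i (Finset.Iio i) := by
      ext j
      simp only [Finset.mem_Iio, Finset.mem_insert, Fin.lt_def, Fin.ext_iff]
      omega
    simp only [newton, Matrix.of_apply]
    rw [h2, Finset.prod_insert (by simp)]
    ring
  · have h3 : (E k - E i) * newton E i k = 0 := by
      rcases eq_or_ne k i with rfl | hk
      · simp
      · rw [newton_apply_eq_zero E, mul_zero]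
        have := k.2
        have : (k : ℕ) ≠ i := fun h => hk (Fin.ext h)
        exact Fin.lt_def.2 (by omega)
    linear_combination h3

lemma newton_mul_diagonal_pow (E : Fin N → ℂ) (j : ℕ) :
    newton E * Matrix.diagonal E ^ j = (Matrix.diagonal E + shift N) ^ j * newton E := by
  induction j with
  | zero => simp
  | succ j ih => rw [pow_succ', ← mul_assoc, newton_mul_diagonal, mul_assoc, ih, ← mul_assoc,
      ← pow_succ']

lemma pow_eq_sum_newton [NeZero N] (E : Fin N → ℂ) (j : ℕ) (k : Fin N) :
    E k ^ j = ∑ i, ((Matrix.diagonal E + shift N) ^ j) 0 i * newton E i k := by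
  have h := congrFun (congrFun (newton_mul_diagonal_pow E j) 0) k
  rw [Matrix.diagonal_pow, Matrix.mul_diagonal, Matrix.mul_apply] at h
  rw [← h]
  have h0 : newton E 0 k = 1 := by
    have : Finset.Iio (0 : Fin N) = ∅ := by
      ext j
      simp
    simp [newton, this]
  simp [h0]

lemma shift_pow_apply (j : ℕ) (a b : Fin N) :
    (shift N ^ j) a b = if (a : ℕ) + j = b then 1 else 0 := by
  induction j generalizing a with
  | zero => simp [Matrix.one_apply, Fin.ext_iff]
  | succ j ih =>
    have h1 : (shift N * shift N ^ j) a b = (shift N *ᵥ fun i => (shift N ^ j) i b) a := rfl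
    rw [pow_succ', h1, shift_mulVec_apply]
    split_ifs with h h2 h2
    · rw [ih, if_pos (by simp; omega)]
    · rw [ih, if_neg (by simp; omega)]
    · have := b.2
      omega
    · rfl

lemma shift_pow_self : shift N ^ N = 0 := by
  ext a b
  rw [shift_pow_apply, if_neg (by omega)]
  rfl

/-- The powers of the matrices near a nilpotent one are uniformly bounded. -/
lemma eventually_norm_pow_le {A : Type*} [NormedRing A] {S : A} {N : ℕ} (hN : N ≠ 0)
    (hS : S ^ N = 0) : ∃ K : ℝ, ∀ᶠ B in 𝓝 S, ∀ j : ℕ, ‖B ^ j‖ ≤ K := by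
  refine ⟨∑ i ∈ Finset.range N, (‖S ^ i‖ + 1), ?_⟩
  have h1 : ∀ᶠ B in 𝓝 S, ‖B ^ N‖ < 1 := by
    have : Tendsto (fun B : A => ‖B ^ N‖) (𝓝 S) (𝓝 ‖S ^ N‖) :=
      ((continuous_pow N).norm).tendsto S
    rw [hS, norm_zero] at this
    exact this.eventually_lt_const one_pos
  have h2 : ∀ᶠ B in 𝓝 S, ∀ i ∈ Finset.range N, ‖B ^ i‖ < ‖S ^ i‖ + 1 := by
    rw [Filter.eventually_all_finset]
    intro i _
    have : Tendsto (fun B : A => ‖B ^ i‖) (𝓝 S) (𝓝 ‖S ^ i‖) :=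
      ((continuous_pow i).norm).tendsto S
    exact this.eventually_lt_const (lt_add_one _)
  filter_upwards [h1, h2] with B hB1 hB2 j
  have h3 : ∀ q i : ℕ, ‖B ^ (N * q + i)‖ ≤ ‖B ^ i‖ := by
    intro q i
    induction q with
    | zero => simp
    | succ q ih =>
      calc ‖B ^ (N * (q + 1) + i)‖ = ‖B ^ N * B ^ (N * q + i)‖ := by
            rw [← pow_add]
            ring_nf
        _ ≤ ‖B ^ N‖ * ‖B ^ (N * q + i)‖ := norm_mul_le _ _
        _ ≤ 1 * ‖B ^ (N * q + i)‖ := by gcongr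
        _ ≤ ‖B ^ i‖ := by rwa [one_mul]
  have hj : j % N ∈ Finset.range N := Finset.mem_range.2 (Nat.mod_lt _ (Nat.pos_of_ne_zero hN))
  calc ‖B ^ j‖ = ‖B ^ (N * (j / N) + j % N)‖ := by rw [Nat.div_add_mod]
    _ ≤ ‖B ^ (j % N)‖ := h3 _ _
    _ ≤ ‖S ^ (j % N)‖ + 1 := (hB2 _ hj).le
    _ ≤ _ := Finset.single_le_sum (f := fun i => ‖S ^ i‖ + 1) (fun i _ => by positivity) hj

attribute [local instance] Matrix.linftyOpNormedRing in
lemma eventually_norm_diagonal_add_shift_pow_le [NeZero N] {R : ℝ} (hR : 0 < R) :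
    ∃ K : ℝ, ∀ᶠ E in 𝓝 (0 : Fin N → ℂ), ∀ (j : ℕ) (a b : Fin N),
      ‖((Matrix.diagonal E + shift N) ^ j) a b‖ ≤ K * R ^ j := by
  have hS : (((R : ℂ)⁻¹) • shift N) ^ N = 0 := by rw [smul_pow, shift_pow_self, smul_zero]
  obtain ⟨K, hK⟩ := eventually_norm_pow_le (NeZero.ne N) hS
  refine ⟨K, ?_⟩
  have hc : Tendsto (fun E : Fin N → ℂ => (R : ℂ)⁻¹ • (Matrix.diagonal E + shift N)) (𝓝 0)
      (𝓝 (((R : ℂ)⁻¹) • shift N)) := by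
    have h1 : Continuous fun E : Fin N → ℂ => (R : ℂ)⁻¹ • (Matrix.diagonal E + shift N) :=
      ((continuous_id.matrix_diagonal).fun_add continuous_const).fun_const_smul _
    have h2 := h1.tendsto 0
    have h3 : Matrix.diagonal (0 : Fin N → ℂ) = 0 := Matrix.diagonal_zero
    rwa [h3, zero_add] at h2
  have hentry : ∀ (A : Matrix (Fin N) (Fin N) ℂ) (a b : Fin N), ‖A a b‖ ≤ ‖A‖ := by
    intro A a b
    rw [Matrix.linfty_opNorm_def, ← coe_nnnorm, NNReal.coe_le_coe]
    refine le_trans ?_ (Finset.le_sup (f := fun i => ∑ j, ‖A i j‖₊) (Finset.mem_univ a))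
    exact Finset.single_le_sum (f := fun j => ‖A a j‖₊) (fun _ _ => zero_le) (Finset.mem_univ b)
  filter_upwards [hc.eventually hK] with E hE j a b
  have h1 := (hentry _ a b).trans (hE j)
  rw [smul_pow, Matrix.smul_apply, norm_smul, norm_pow, norm_inv, Complex.norm_real,
    Real.norm_of_nonneg hR.le, inv_pow, inv_mul_le_iff₀ (by positivity)] at h1
  linarith

/-- The divided differences `F[E_0, …, E_i]` of an analytic function, written as a power series in
the multiplication matrix of the Newton basis. -/
noncomputable def dividedDiff [NeZero N] (F : ℂ → ℂ) (E : Fin N → ℂ) (i : Fin N) : ℂ :=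
  ∑' j : ℕ, PowerSeries.coeff j (taylor F) * ((Matrix.diagonal E + shift N) ^ j) 0 i

lemma exists_summable_bound [NeZero N] {F : ℂ → ℂ} (hF : AnalyticAt ℂ F 0) :
    ∃ u : ℕ → ℝ, Summable u ∧ ∀ᶠ E in 𝓝 (0 : Fin N → ℂ), ∀ (j : ℕ) (i : Fin N),
      ‖PowerSeries.coeff j (taylor F) * ((Matrix.diagonal E + shift N) ^ j) 0 i‖ ≤ u j := by
  have h1 : ∃ᶠ ε : ℂ in 𝓝[≠] 0, ε ≠ 0 :=
    (eventually_mem_nhdsWithin (a := (0 : ℂ)) (s := {0}ᶜ)).frequently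
  obtain ⟨ε, hε0, hε⟩ := (h1.and_eventually
    ((hasSum_taylor hF).filter_mono nhdsWithin_le_nhds)).exists
  obtain ⟨K, hK⟩ := eventually_norm_diagonal_add_shift_pow_le (N := N) (norm_pos_iff.2 hε0)
  refine ⟨fun j => K * ‖ε ^ j * PowerSeries.coeff j (taylor F)‖, hε.summable.norm.mul_left K, ?_⟩
  filter_upwards [hK] with E hE j i
  rw [norm_mul, norm_mul, norm_pow]
  calc _ ≤ ‖PowerSeries.coeff j (taylor F)‖ * (K * ‖ε‖ ^ j) := by
        gcongr
        exact hE j 0 i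
    _ = _ := by ring

lemma tendsto_dividedDiff [NeZero N] {F : ℂ → ℂ} (hF : AnalyticAt ℂ F 0) (i : Fin N) :
    Tendsto (fun E : Fin N → ℂ => dividedDiff F E i) (𝓝 0)
      (𝓝 (PowerSeries.coeff i (taylor F))) := by
  obtain ⟨u, hu, hb⟩ := exists_summable_bound (N := N) hF
  have h1 : ∑' j : ℕ, PowerSeries.coeff j (taylor F) * (shift N ^ j) 0 i
      = PowerSeries.coeff i (taylor F) := by
    rw [tsum_eq_single (i : ℕ)]
    · simp [shift_pow_apply]
    · intro j hj
      simp [shift_pow_apply, hj]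
  rw [← h1]
  refine tendsto_tsum_of_dominated_convergence hu (fun j => ?_)
    (hb.mono fun E hE j => hE j i)
  have h2 : Continuous fun E : Fin N → ℂ =>
      PowerSeries.coeff j (taylor F) * ((Matrix.diagonal E + shift N) ^ j) 0 i :=
    continuous_const.mul
      ((((continuous_id.matrix_diagonal).fun_add continuous_const).pow j).matrix_elem 0 i)
  have h3 := h2.tendsto 0
  have h4 : Matrix.diagonal (0 : Fin N → ℂ) = 0 := Matrix.diagonal_zero
  rwa [h4, zero_add] at h3

/-- Newton interpolation at the nodes. -/
lemma eventually_eq_sum_dividedDiff [NeZero N] {F : ℂ → ℂ} (hF : AnalyticAt ℂ F 0) :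
    ∀ᶠ E in 𝓝 (0 : Fin N → ℂ), ∀ k, F (E k) = ∑ i, dividedDiff F E i * newton E i k := by
  obtain ⟨u, hu, hb⟩ := exists_summable_bound (N := N) hF
  have h1 : ∀ᶠ E in 𝓝 (0 : Fin N → ℂ), ∀ k, HasSum (fun j =>
      E k ^ j * PowerSeries.coeff j (taylor F)) (F (E k)) := by
    rw [Filter.eventually_all]
    intro k
    exact ((continuous_apply k).tendsto (0 : Fin N → ℂ)).eventually (hasSum_taylor hF)
  filter_upwards [hb, h1] with E hE hS k
  have h2 : HasSum (fun j => ∑ i, PowerSeries.coeff j (taylor F)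
      * ((Matrix.diagonal E + shift N) ^ j) 0 i * newton E i k)
      (∑ i, dividedDiff F E i * newton E i k) :=
    hasSum_sum fun i _ =>
      ((Summable.of_norm_bounded hu fun j => hE j i).hasSum).mul_right _
  refine (hS k).unique (h2.congr_fun fun j => ?_)
  rw [pow_eq_sum_newton, Finset.sum_mul]
  exact Finset.sum_congr rfl fun i _ => by ring

end

/-! ### The confluent limit of the Darboux transformation -/

section

variable {N : ℕ}

lemma mul_shift_apply_eq_dite (X : Matrix (Fin N) (Fin N) ℂ) (m k : Fin N) :
    (X * shift N) m k = if h : 1 ≤ (k : ℕ) then X m ⟨k - 1, by omega⟩ else 0 := by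
  rw [Matrix.mul_apply]
  simp only [shift, Matrix.of_apply, mul_ite, mul_one, mul_zero]
  split_ifs with hk
  · rw [Finset.sum_eq_single ⟨(k : ℕ) - 1, by omega⟩]
    · simp [Nat.sub_add_cancel hk]
    · intro j _ hj
      rw [if_neg]
      intro h
      apply hj
      apply Fin.ext
      simp [← h]
    · exact fun h => absurd (Finset.mem_univ _) h
  · refine Finset.sum_eq_zero fun j _ => if_neg ?_
    omega

lemma shift_conjTranspose_mul_apply_eq_dite (X : Matrix (Fin N) (Fin N) ℂ) (m k : Fin N) :
    ((shift N)ᴴ * X) m k = if h : 1 ≤ (m : ℕ) then X ⟨m - 1, by omega⟩ k else 0 := by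
  have h1 := mul_shift_apply_eq_dite Xᴴ k m
  have h2 : ((shift N)ᴴ * X) m k = star ((Xᴴ * shift N) k m) := by
    rw [← Matrix.conjTranspose_apply, Matrix.conjTranspose_mul, Matrix.conjTranspose_conjTranspose]
  rw [h2, h1]
  split_ifs <;> simp

/-- The solution of the Sylvester equation depends continuously on the right-hand side and on the
spectral parameters: its entries are computed recursively. -/
lemma tendsto_of_sylvester {α : Type*} {l : Filter α} {E : α → Fin N → ℂ}
    {X T : α → Matrix (Fin N) (Fin N) ℂ} {X₀ T₀ : Matrix (Fin N) (Fin N) ℂ}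
    (hE : Tendsto E l (𝓝 0)) (hT : Tendsto T l (𝓝 T₀))
    (h : ∀ᶠ a in l, (2 : ℂ) • X a + X a * (Matrix.diagonal (E a) + shift N)
      + (Matrix.diagonal (E a) + shift N)ᴴ * X a = T a)
    (h₀ : (2 : ℂ) • X₀ + X₀ * shift N + (shift N)ᴴ * X₀ = T₀) : Tendsto X l (𝓝 X₀) := by
  have hEk : ∀ k, Tendsto (fun a => E a k) l (𝓝 0) := fun k =>
    ((continuous_apply k).tendsto (0 : Fin N → ℂ)).comp hE
  have hc : ∀ m k, Tendsto (fun a => 2 + E a k + star (E a m)) l (𝓝 2) := by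
    intro m k
    have := ((hEk k).const_add 2).add ((continuous_star.tendsto (0 : ℂ)).comp (hEk m))
    simpa using this
  have key : ∀ d : ℕ, ∀ m k : Fin N, (m : ℕ) + k = d →
      Tendsto (fun a => X a m k) l (𝓝 (X₀ m k)) := by
    intro d
    induction d using Nat.strong_induction_on with
    | _ d ih =>
      intro m k hmk
      have h1 : Tendsto (fun a => (X a * shift N) m k) l (𝓝 ((X₀ * shift N) m k)) := by
        simp only [mul_shift_apply_eq_dite]
        split_ifs with hk
        · exact ih ((m : ℕ) + (k - 1)) (by omega) m ⟨k - 1, by omega⟩ rfl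
        · exact tendsto_const_nhds
      have h2 : Tendsto (fun a => ((shift N)ᴴ * X a) m k) l (𝓝 (((shift N)ᴴ * X₀) m k)) := by
        simp only [shift_conjTranspose_mul_apply_eq_dite]
        split_ifs with hk
        · exact ih ((m : ℕ) - 1 + k) (by omega) ⟨m - 1, by omega⟩ k rfl
        · exact tendsto_const_nhds
      have hTe : Tendsto (fun a => T a m k) l (𝓝 (T₀ m k)) :=
        ((continuous_id.matrix_elem m k).tendsto T₀).comp hT
      have h3 := ((hTe.sub h1).sub h2).div (hc m k) two_ne_zero
      have h4 : (T₀ m k - (X₀ * shift N) m k - ((shift N)ᴴ * X₀) m k) / 2 = X₀ m k := by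
        rw [← h₀]
        simp only [Matrix.add_apply, Matrix.smul_apply, smul_eq_mul]
        ring
      rw [h4] at h3
      refine h3.congr' ?_
      filter_upwards [h, (hc m k).eventually_ne two_ne_zero] with a ha hne
      rw [Pi.div_apply, div_eq_iff hne, ← ha, mul_add, Matrix.conjTranspose_add, add_mul,
        Matrix.diagonal_conjTranspose]
      simp only [Matrix.add_apply, Matrix.smul_apply, smul_eq_mul, Matrix.mul_diagonal,
        Matrix.diagonal_mul, Pi.star_apply]
      ring
  exact tendsto_pi_nhds.2 fun m => tendsto_pi_nhds.2 fun k => key _ m k rfl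

variable {n : ℕ} {lam0 : ℂ}

/-- The Darboux transformation at simple poles in the Newton basis of the spectral parameters. -/
lemma darboux_eq_of_newton (hre : lam0.re = 0) (him : lam0.im ≠ 0) {E : Fin N → ℂ}
    (hE : Function.Injective E) (hE1 : ∀ k, ‖E k‖ < 1) (q : EuclideanSpace ℂ (Fin n))
    (Y : Matrix (Fin (n + 1)) (Fin N) ℂ) {φ : Fin N → Fin (n + 1) → ℂ}
    (hφ : ∀ k i, φ k i = (Y * newton E) i k) :
    ∃ X : Matrix (Fin N) (Fin N) ℂ,
      (2 : ℂ) • X + X * (Matrix.diagonal E + shift N) + (Matrix.diagonal E + shift N)ᴴ * X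
        = lam0⁻¹ • (Yᴴ * Y) ∧
      ∀ j, darboux q (fun k => lam0 * (1 + E k)) φ j = q j - 2 * (Y * X⁻¹ * Yᴴ) j.succ 0 := by
  have hl : lam0 ≠ 0 := by
    rintro rfl
    simp at him
  have hs : star lam0 = -lam0 := by
    apply Complex.ext <;> simp [hre]
  have hV : IsUnit (newton E).det := (det_newton_ne_zero hE).isUnit
  have hVH : IsUnit ((newton E)ᴴ).det := by
    rw [Matrix.det_conjTranspose]
    exact hV.star
  set V := newton E with hVdef
  set D := darbouxMatrix (fun k => lam0 * (1 + E k)) φ with hD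
  have hD1 : (2 : ℂ) • D + D * Matrix.diagonal E + (Matrix.diagonal E)ᴴ * D
      = lam0⁻¹ • ((Y * V)ᴴ * (Y * V)) := by
    ext m k
    have hne : 2 + E k + star (E m) ≠ 0 := by
      intro h
      have h3 : ‖(2 : ℂ)‖ = ‖E k + star (E m)‖ := by
        rw [add_assoc] at h
        rw [eq_neg_of_add_eq_zero_left h, norm_neg]
      have h4 := norm_add_le (E k) (star (E m))
      rw [norm_star, ← h3] at h4
      have := hE1 k
      have := hE1 m
      norm_num at h4
      linarith
    have h5 : ((Y * V)ᴴ * (Y * V)) m k = star (φ m) ⬝ᵥ φ k := by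
      rw [Matrix.mul_apply, dotProduct]
      simp only [Matrix.conjTranspose_apply, Pi.star_apply, hφ]
    have h6 : D m k = (star (φ m) ⬝ᵥ φ k) / (lam0 * (2 + E k + star (E m))) := by
      have h7 : lam0 * (1 + E k) - star (lam0 * (1 + E m)) = lam0 * (2 + E k + star (E m)) := by
        rw [star_mul', hs, star_add, star_one]
        ring
      rw [← h7]
      rfl
    rw [Matrix.diagonal_conjTranspose]
    simp only [Matrix.add_apply, Matrix.smul_apply, smul_eq_mul, Matrix.mul_diagonal,
      Matrix.diagonal_mul, Pi.star_apply, h5, h6]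
    generalize star (E m) = e at *
    generalize star (φ m) ⬝ᵥ φ k = c
    field_simp
  have hBV : (Matrix.diagonal E + shift N) * V = V * Matrix.diagonal E :=
    (newton_mul_diagonal E).symm
  have hVB : (Matrix.diagonal E + shift N) = V * Matrix.diagonal E * V⁻¹ := by
    rw [← hBV, Matrix.mul_nonsing_inv_cancel_right _ _ hV]
  refine ⟨(Vᴴ)⁻¹ * D * V⁻¹, ?_, fun j => ?_⟩
  · have e1 : (Vᴴ)⁻¹ * D * V⁻¹ * (Matrix.diagonal E + shift N)
        = (Vᴴ)⁻¹ * (D * Matrix.diagonal E) * V⁻¹ := by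
      rw [hVB]
      simp only [← Matrix.mul_assoc]
      rw [Matrix.nonsing_inv_mul_cancel_right _ _ hV]
    have e2 : (Matrix.diagonal E + shift N)ᴴ * ((Vᴴ)⁻¹ * D * V⁻¹)
        = (Vᴴ)⁻¹ * ((Matrix.diagonal E)ᴴ * D) * V⁻¹ := by
      rw [hVB, Matrix.conjTranspose_mul, Matrix.conjTranspose_mul, Matrix.conjTranspose_nonsing_inv]
      simp only [← Matrix.mul_assoc]
      rw [Matrix.mul_nonsing_inv_cancel_right _ _ hVH]
    have e3 : (Vᴴ)⁻¹ * (lam0⁻¹ • ((Y * V)ᴴ * (Y * V))) * V⁻¹ = lam0⁻¹ • (Yᴴ * Y) := by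
      rw [Matrix.mul_smul, Matrix.smul_mul, Matrix.conjTranspose_mul]
      simp only [← Matrix.mul_assoc]
      rw [Matrix.mul_nonsing_inv_cancel_right _ _ hV, Matrix.nonsing_inv_mul _ hVH, Matrix.one_mul]
    rw [e1, e2, ← e3, ← hD1, mul_add, mul_add, add_mul, add_mul, Matrix.mul_smul, Matrix.smul_mul]
  · have e4 : Y * ((Vᴴ)⁻¹ * D * V⁻¹)⁻¹ * Yᴴ = (Y * V) * D⁻¹ * (Y * V)ᴴ := by
      rw [Matrix.mul_inv_rev, Matrix.mul_inv_rev, Matrix.nonsing_inv_nonsing_inv _ hV,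
        Matrix.nonsing_inv_nonsing_inv _ hVH, Matrix.conjTranspose_mul]
      simp only [Matrix.mul_assoc]
    rw [e4, Matrix.mul_assoc (Y * V), Matrix.mul_apply]
    simp only [darboux, ← hD, dotProduct, hφ, Matrix.mulVec, Matrix.mul_apply (M := D⁻¹),
      Matrix.conjTranspose_apply]

lemma continuousAt_matrix_inv {A : Matrix (Fin N) (Fin N) ℂ} (hA : A.det ≠ 0) :
    ContinuousAt (fun B : Matrix (Fin N) (Fin N) ℂ => B⁻¹) A := by
  simp only [Matrix.inv_def, Ring.inverse_eq_inv']
  exact ((continuous_id.matrix_det.continuousAt).inv₀ hA).smul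
    continuous_id.matrix_adjugate.continuousAt

variable {μ : Fin (n + 1) → ℂ → ℂ}
  {γ : ℕ → Matrix (Fin (n + 1)) (Fin (n + 1)) ℂ} {β : Fin (n + 1) → ℂ}

/-- The bordered determinant of the rogue wave, by a Schur complement. -/
lemma rogueWave_apply {x t : ℝ} (hM : (matM n N lam0 μ γ β x t).det ≠ 0) (j : Fin n) :
    rogueWave n N lam0 μ γ β x t j = background n lam0 x t j
      - 2 * (matY n N lam0 μ γ β x t * (matM n N lam0 μ γ β x t)⁻¹
          * (matY n N lam0 μ γ β x t)ᴴ) j.succ 0 := by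
  have := Matrix.invertibleOfIsUnitDet _ hM.isUnit
  simp only [rogueWave]
  rw [Matrix.det_fromBlocks₁₁, Matrix.invOf_eq_nonsing_inv, Matrix.det_unique (n := Unit)]
  have h1 : ∀ (A : Matrix (Fin N) (Fin N) ℂ) (v w : Fin N → ℂ),
      (Matrix.replicateRow Unit v * A * Matrix.replicateCol Unit w) default default
        = ∑ k, (∑ m, v m * A m k) * w k := by
    intro A v w
    simp [Matrix.mul_apply]
  rw [Matrix.sub_apply, h1, Matrix.mul_apply]
  simp only [Matrix.mul_apply, Matrix.conjTranspose_apply, Matrix.zero_apply, zero_sub]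
  field_simp
  ring

lemma IsEigenvalueBranches.tendsto_darboux (hN : 1 ≤ N) (hre : lam0.re = 0) (him : lam0.im ≠ 0)
    (hμ : IsEigenvalueBranches n lam0 μ) (hγ : γ 0 *ᵥ β ≠ 0) (x t : ℝ) :
    Tendsto
      (fun ε : Fin N → ℂ => darboux (background n lam0 x t) (fun i => lamEps n lam0 (ε i))
        (fun i => PhiTildeFun n N lam0 μ γ β (ε i) x t))
      (𝓝[{ε : Fin N → ℂ | (∀ i, ε i ≠ 0) ∧ Function.Injective fun i => lamEps n lam0 (ε i)}] 0)
      (𝓝 (rogueWave n N lam0 μ γ β x t)) := by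
  have : NeZero N := ⟨by omega⟩
  have hl : lam0 ≠ 0 := by
    rintro rfl
    simp at him
  have hdet := hμ.det_matM_ne_zero N hre him hγ x t
  choose F hFa hFc hFe using fun i => hμ.exists_germ_PhiTildeFun N hre him γ β x t i
  set l := 𝓝[{ε : Fin N → ℂ | (∀ i, ε i ≠ 0) ∧
    Function.Injective fun i => lamEps n lam0 (ε i)}] (0 : Fin N → ℂ) with hldef
  let E : (Fin N → ℂ) → Fin N → ℂ := fun ε k => ε k ^ (n + 1)
  have hE : Tendsto E l (𝓝 0) := by
    have : Continuous E := by fun_prop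
    have h1 := (this.tendsto 0).mono_left (nhdsWithin_le_nhds (s := {ε : Fin N → ℂ |
      (∀ i, ε i ≠ 0) ∧ Function.Injective fun i => lamEps n lam0 (ε i)}))
    have h2 : E 0 = 0 := by
      ext k
      simp [E]
    rwa [h2] at h1
  let Y : (Fin N → ℂ) → Matrix (Fin (n + 1)) (Fin N) ℂ := fun ε =>
    Matrix.of fun i m => dividedDiff (F i) (E ε) m
  have hY : Tendsto Y l (𝓝 (matY n N lam0 μ γ β x t)) := by
    refine tendsto_pi_nhds.2 fun i => tendsto_pi_nhds.2 fun m => ?_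
    have h1 := (tendsto_dividedDiff (hFa i) m).comp hE
    rw [hFc i m m.2] at h1
    exact h1
  have hφ : ∀ᶠ ε in l, ∀ k i,
      PhiTildeFun n N lam0 μ γ β (ε k) x t i = (Y ε * newton (E ε)) i k := by
    rw [Filter.eventually_all]
    intro k
    rw [Filter.eventually_all]
    intro i
    have h1 : Tendsto (fun ε : Fin N → ℂ => ε k) l (𝓝[≠] 0) := by
      refine tendsto_nhdsWithin_iff.2 ⟨?_, ?_⟩
      · exact ((continuous_apply k).tendsto (0 : Fin N → ℂ)).mono_left nhdsWithin_le_nhds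
      · filter_upwards [self_mem_nhdsWithin] with ε hε using hε.1 k
    filter_upwards [h1.eventually (hFe i), hE.eventually (eventually_eq_sum_dividedDiff (hFa i))]
      with ε h2 h3
    rw [h2, Matrix.mul_apply]
    exact h3 k
  have hE1 : ∀ᶠ ε in l, ∀ k, ‖E ε k‖ < 1 := by
    rw [Filter.eventually_all]
    intro k
    have h1 : Tendsto (fun ε => ‖E ε k‖) l (𝓝 ‖(0 : ℂ)‖) :=
      (((continuous_apply k).tendsto (0 : Fin N → ℂ)).comp hE).norm
    rw [norm_zero] at h1
    exact h1.eventually_lt_const one_pos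
  let p : (Fin N → ℂ) → Matrix (Fin N) (Fin N) ℂ → Prop := fun ε X =>
      (2 : ℂ) • X + X * (Matrix.diagonal (E ε) + shift N)
        + (Matrix.diagonal (E ε) + shift N)ᴴ * X = lam0⁻¹ • ((Y ε)ᴴ * Y ε) ∧
      ∀ j, darboux (background n lam0 x t) (fun i => lamEps n lam0 (ε i))
        (fun i => PhiTildeFun n N lam0 μ γ β (ε i) x t) j
          = background n lam0 x t j - 2 * (Y ε * X⁻¹ * (Y ε)ᴴ) j.succ 0
  have hp : ∀ᶠ ε in l, ∃ X, p ε X := by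
    filter_upwards [hφ, hE1, self_mem_nhdsWithin] with ε h1 h2 h3
    refine darboux_eq_of_newton hre him (fun i j hij => h3.2 ?_) h2 _ _ h1
    have h4 : ε i ^ (n + 1) = ε j ^ (n + 1) := hij
    simp [lamEps, h4]
  let X : (Fin N → ℂ) → Matrix (Fin N) (Fin N) ℂ := fun ε => Classical.epsilon (p ε)
  have hX : ∀ᶠ ε in l, p ε (X ε) := hp.mono fun ε hε => Classical.epsilon_spec hε
  have hXlim : Tendsto X l (𝓝 (matM n N lam0 μ γ β x t)) := by
    have hT : Tendsto (fun ε => lam0⁻¹ • ((Y ε)ᴴ * Y ε)) l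
        (𝓝 (lam0⁻¹ • ((matY n N lam0 μ γ β x t)ᴴ * matY n N lam0 μ γ β x t))) := by
      have hc : Continuous fun A : Matrix (Fin (n + 1)) (Fin N) ℂ => lam0⁻¹ • (Aᴴ * A) :=
        (continuous_id.matrix_conjTranspose.matrix_mul continuous_id).fun_const_smul _
      exact (hc.tendsto _).comp hY
    refine tendsto_of_sylvester hE hT (hX.mono fun ε h => h.1) ?_
    rw [← matM_sylvester hre him, jordan_sylvester hre, smul_smul, inv_mul_cancel₀ hl, one_smul]
  have hinv := (continuousAt_matrix_inv hdet).tendsto.comp hXlim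
  have hc : Continuous fun p : Matrix (Fin (n + 1)) (Fin N) ℂ × Matrix (Fin N) (Fin N) ℂ =>
      p.1 * p.2 * p.1ᴴ :=
    (continuous_fst.matrix_mul continuous_snd).matrix_mul continuous_fst.matrix_conjTranspose
  have hP := (hc.tendsto (matY n N lam0 μ γ β x t, (matM n N lam0 μ γ β x t)⁻¹)).comp
    (hY.prodMk_nhds hinv)
  have h0 : Tendsto (fun ε => (darboux (background n lam0 x t) (fun i => lamEps n lam0 (ε i))
        (fun i => PhiTildeFun n N lam0 μ γ β (ε i) x t)).ofLp) l
      (𝓝 (rogueWave n N lam0 μ γ β x t).ofLp) := by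
    refine tendsto_pi_nhds.2 fun j => ?_
    rw [rogueWave_apply hdet]
    have h1 : Tendsto (fun ε => (Y ε * (X ε)⁻¹ * (Y ε)ᴴ) j.succ 0) l
        (𝓝 ((matY n N lam0 μ γ β x t * (matM n N lam0 μ γ β x t)⁻¹
          * (matY n N lam0 μ γ β x t)ᴴ) j.succ 0)) :=
      ((continuous_id.matrix_elem j.succ 0).tendsto _).comp hP
    refine ((h1.const_mul 2).const_sub _).congr' ?_
    filter_upwards [hX] with ε hε
    exact (hε.2 j).symm
  exact ((PiLp.continuous_toLp 2 _).tendsto _).comp h0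

end

/-! ### Differentiation of matrices entry by entry -/

/-- `A'` is the derivative of the matrix function `A` at `x`, entry by entry. -/
def HasMatDerivAt {m n : Type*} (A : ℝ → Matrix m n ℂ) (A' : Matrix m n ℂ) (x : ℝ) : Prop :=
  ∀ i j, HasDerivAt (fun y => A y i j) (A' i j) x

section

variable {l m n : Type*} {A A₁ A₂ : ℝ → Matrix m n ℂ} {A' A₁' A₂' : Matrix m n ℂ} {x : ℝ}

lemma HasMatDerivAt.unique (h₁ : HasMatDerivAt A A₁' x) (h₂ : HasMatDerivAt A A₂' x) :
    A₁' = A₂' := by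
  ext i j
  exact (h₁ i j).unique (h₂ i j)

lemma HasMatDerivAt.const (C : Matrix m n ℂ) : HasMatDerivAt (fun _ => C) 0 x :=
  fun _ _ => hasDerivAt_const _ _

lemma HasMatDerivAt.add (h₁ : HasMatDerivAt A₁ A₁' x) (h₂ : HasMatDerivAt A₂ A₂' x) :
    HasMatDerivAt (fun y => A₁ y + A₂ y) (A₁' + A₂') x :=
  fun i j => (h₁ i j).fun_add (h₂ i j)

lemma HasMatDerivAt.sub (h₁ : HasMatDerivAt A₁ A₁' x) (h₂ : HasMatDerivAt A₂ A₂' x) :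
    HasMatDerivAt (fun y => A₁ y - A₂ y) (A₁' - A₂') x :=
  fun i j => (h₁ i j).fun_sub (h₂ i j)

lemma HasMatDerivAt.const_smul (c : ℂ) (h : HasMatDerivAt A A' x) :
    HasMatDerivAt (fun y => c • A y) (c • A') x :=
  fun i j => (h i j).const_mul c

lemma HasMatDerivAt.conjTranspose (h : HasMatDerivAt A A' x) :
    HasMatDerivAt (fun y => (A y)ᴴ) A'ᴴ x :=
  fun i j => (h j i).star

lemma HasMatDerivAt.mul [Fintype m] {B : ℝ → Matrix l m ℂ} {B' : Matrix l m ℂ}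
    (hB : HasMatDerivAt B B' x) (hA : HasMatDerivAt A A' x) :
    HasMatDerivAt (fun y => B y * A y) (B' * A x + B x * A') x := by
  intro i j
  simp only [Matrix.mul_apply, Matrix.add_apply, ← Finset.sum_add_distrib]
  exact HasDerivAt.fun_sum fun k _ => (hB i k).fun_mul (hA k j)

lemma HasMatDerivAt.const_mul [Fintype m] (B : Matrix l m ℂ) (hA : HasMatDerivAt A A' x) :
    HasMatDerivAt (fun y => B * A y) (B * A') x := by
  simpa using (HasMatDerivAt.const B).mul hA

lemma HasMatDerivAt.mul_const [Fintype n] (hA : HasMatDerivAt A A' x) (B : Matrix n l ℂ) :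
    HasMatDerivAt (fun y => A y * B) (A' * B) x := by
  simpa using hA.mul (HasMatDerivAt.const B)

lemma HasMatDerivAt.trace [Fintype m] {A : ℝ → Matrix m m ℂ} {A' : Matrix m m ℂ}
    (hA : HasMatDerivAt A A' x) : HasDerivAt (fun y => (A y).trace) A'.trace x :=
  HasDerivAt.fun_sum fun i _ => hA i i

variable {N : ℕ} {M : ℝ → Matrix (Fin N) (Fin N) ℂ} {M' : Matrix (Fin N) (Fin N) ℂ}

/-- Jacobi's formula. -/
lemma HasMatDerivAt.det (hM : HasMatDerivAt M M' x) :
    HasDerivAt (fun y => (M y).det) ((M x).adjugate * M').trace x := by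
  have h1 : HasDerivAt (fun y => (M y).det)
      (∑ σ : Equiv.Perm (Fin N), ((Equiv.Perm.sign σ : ℤ) : ℂ) *
        ∑ k, (∏ j ∈ Finset.univ.erase k, M x (σ j) j) • M' (σ k) k) x := by
    simp only [Matrix.det_apply']
    exact HasDerivAt.fun_sum fun σ _ =>
      (HasDerivAt.fun_finsetProd fun j _ => hM (σ j) j).const_mul _
  convert h1 using 1
  have h2 : ∀ k, ((M x).adjugate * M') k k = ((M x).updateCol k fun i => M' i k).det := by
    intro k
    rw [← Matrix.cramer_apply, Matrix.cramer_eq_adjugate_mulVec]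
    rfl
  simp only [Matrix.trace, Matrix.diag_apply, h2, Matrix.det_apply', Finset.mul_sum]
  rw [Finset.sum_comm]
  refine Finset.sum_congr rfl fun σ _ => Finset.sum_congr rfl fun k _ => ?_
  rw [← Finset.prod_erase_mul _ _ (Finset.mem_univ k), Matrix.updateCol_self, smul_eq_mul]
  congr 2
  refine Finset.prod_congr rfl fun j hj => ?_
  rw [Matrix.updateCol_ne (Finset.ne_of_mem_erase hj)]

/-- The entries of the inverse are differentiable by the adjugate formula; the value of the derivative
comes from differentiating `M M⁻¹ = 1`. -/
lemma HasMatDerivAt.inv (hM : HasMatDerivAt M M' x) (hdet : ∀ y, (M y).det ≠ 0) :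
    HasMatDerivAt (fun y => (M y)⁻¹) (-((M x)⁻¹ * M' * (M x)⁻¹)) x := by
  have hadj : ∀ i j, ∃ d, HasDerivAt (fun y => (M y).adjugate i j) d x := by
    intro i j
    simp only [Matrix.adjugate_apply]
    have h1 : HasMatDerivAt (fun y => (M y).updateRow j (Pi.single i 1))
        (M'.updateRow j 0) x := by
      intro a b
      by_cases hab : a = j
      · subst hab
        simpa using hasDerivAt_const x _
      · simpa [Matrix.updateRow_ne hab] using hM a b
    exact ⟨_, h1.det⟩
  choose D hD using hadj
  have hinv : ∃ W' : Matrix (Fin N) (Fin N) ℂ, HasMatDerivAt (fun y => (M y)⁻¹) W' x := by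
    have h : ∀ i j, ∃ d, HasDerivAt (fun y => (M y)⁻¹ i j) d x := by
      intro i j
      simp only [Matrix.inv_def, Ring.inverse_eq_inv', Matrix.smul_apply, smul_eq_mul]
      exact ⟨_, (hM.det.fun_inv (hdet x)).fun_mul (hD i j)⟩
    choose W' hW' using h
    exact ⟨W', hW'⟩
  obtain ⟨W', hW'⟩ := hinv
  have h1 : HasMatDerivAt (fun y => M y * (M y)⁻¹) (M' * (M x)⁻¹ + M x * W') x := hM.mul hW'
  have h2 : (fun y => M y * (M y)⁻¹) = fun _ => 1 := by
    ext1 y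
    exact Matrix.mul_nonsing_inv _ (hdet y).isUnit
  rw [h2] at h1
  have h3 := h1.unique (HasMatDerivAt.const 1)
  have h4 : W' = -((M x)⁻¹ * M' * (M x)⁻¹) := by
    rw [eq_neg_iff_add_eq_zero, add_comm, Matrix.mul_assoc]
    have h5 := congrArg (fun A => (M x)⁻¹ * A) h3
    simp only [Matrix.mul_add, Matrix.mul_zero] at h5
    rwa [Matrix.nonsing_inv_mul_cancel_left _ _ (hdet x).isUnit] at h5
  rwa [← h4]

end

/-! ### The dressed potential -/

/-- The zero-curvature computation behind the Darboux transformation, in a free algebra: `S = iσ₃`,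
`K = iQ`, `P = Y M⁻¹ Yᴴ`, `P1 = Y Λ M⁻¹ Yᴴ`, and `K + [S, P]` is the dressed potential. The letters
are moved past `S` by means of their conjugates `-S P S`. -/
lemma dressing_identity {A : Type*} [Ring A] {S K Kx Kt Kxx P P1 P1x Px Pt2 Pxx : A}
    (hS : S * S = -1) (hK : S * K = -(K * S)) (hKx : S * Kx = -(Kx * S))
    (hPx : Px = S * P1 - P1 * S + (K * P - P * K) - P * (S * P - P * S))
    (hPt : Pt2 = 2 * P1x - 2 * (P * Px) + (S * (K * K - Kx) * P - P * (S * (K * K - Kx))))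
    (hPxx : Pxx = (S * P1x - P1x * S) + (Kx * P - P * Kx) + (K * Px - Px * K)
      - Px * (S * P - P * S) - P * (S * Px - Px * S))
    (hn : -2 * (S * Kt) + Kxx - 2 * (K * K * K) = 0) :
    -(S * (2 * Kt + (S * Pt2 - Pt2 * S))) + (Kxx + (S * Pxx - Pxx * S))
      - 2 * ((K + (S * P - P * S)) * (K + (S * P - P * S)) * (K + (S * P - P * S))) = 0 := by
  have hS' : ∀ r, S * (S * r) = -r := fun r => by rw [← mul_assoc, hS]; simp
  have conj : ∀ p : A, ∃ q, p * S = S * q := fun p => ⟨-(S * p * S), by simp [mul_assoc, hS']⟩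
  obtain ⟨b, hb⟩ := conj P
  obtain ⟨b1, hb1⟩ := conj P1
  obtain ⟨d, hd⟩ := conj P1x
  have symm : ∀ p q : A, p * S = S * q → q * S = S * p := by
    intro p q h
    have := congrArg (fun r => -(S * r * S)) h
    simp only [mul_assoc, hS', hS] at this
    simp only [mul_neg, neg_mul, mul_one, neg_neg] at this
    exact this.symm
  have assoc : ∀ p q : A, p * S = S * q → ∀ r, p * (S * r) = S * (q * r) := fun p q h r => by
    rw [← mul_assoc, h, mul_assoc]
  have hb' := symm _ _ hb
  have hb1' := symm _ _ hb1
  have hd' := symm _ _ hd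
  have hKS : K * S = S * (-K) := by rw [mul_neg, hK, neg_neg]
  have hKxS : Kx * S = S * (-Kx) := by rw [mul_neg, hKx, neg_neg]
  have e1 := assoc _ _ hb
  have e2 := assoc _ _ hb'
  have e3 := assoc _ _ hb1
  have e4 := assoc _ _ hb1'
  have e7 := assoc _ _ hKS
  have e8 := assoc _ _ hKxS
  have hn' : Kxx = 2 * (S * Kt) + 2 * (K * K * K) := by
    rw [← sub_eq_zero, ← hn]
    noncomm_ring
  rw [hn', hPxx, hPt, hPx]
  simp only [mul_add, add_mul, mul_sub, sub_mul, mul_assoc, hS', hb, hb1, hd, hb', hb1', hd', hKS,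
    hKxS, e1, e2, e3, e4, e7, e8, two_mul, mul_neg, neg_mul, neg_neg]
  abel

section

variable {n N : ℕ} {lam0 : ℂ}

/-- A solution of the Sylvester equation `M Λ - Λᴴ M = Yᴴ Y` is differentiated by differentiating
the equation. -/
lemma HasMatDerivAt.of_sylvester {ι : Type*} [Fintype ι] (hre : lam0.re = 0) (him : lam0.im ≠ 0)
    {M : ℝ → Matrix (Fin N) (Fin N) ℂ} {Y : ℝ → Matrix ι (Fin N) ℂ}
    {M' D : Matrix (Fin N) (Fin N) ℂ} {Y' : Matrix ι (Fin N) ℂ} {x : ℝ}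
    (h : ∀ y, M y * jordan N lam0 - (jordan N lam0)ᴴ * M y = (Y y)ᴴ * Y y)
    (hM : HasMatDerivAt M D x) (hY : HasMatDerivAt Y Y' x)
    (hM' : M' * jordan N lam0 - (jordan N lam0)ᴴ * M' = Y'ᴴ * Y x + (Y x)ᴴ * Y') :
    HasMatDerivAt M M' x := by
  have h1 := (hM.mul_const (jordan N lam0)).sub (hM.const_mul (jordan N lam0)ᴴ)
  simp only [h] at h1
  have h2 := h1.unique (hY.conjTranspose.mul hY)
  have h3 : (D - M') * jordan N lam0 - (jordan N lam0)ᴴ * (D - M') = 0 := by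
    rw [Matrix.sub_mul, Matrix.mul_sub, sub_sub_sub_comm, h2, hM', sub_self]
  rw [← sub_eq_zero.1 (eq_zero_of_jordan_sylvester hre him h3)]
  exact hM

variable {ι : Type*} [Fintype ι] {S K b : Matrix ι ι ℂ}
  {Y : ℝ → Matrix ι (Fin N) ℂ} {M : ℝ → Matrix (Fin N) (Fin N) ℂ} {x : ℝ}
  {Λ : Matrix (Fin N) (Fin N) ℂ}

lemma mul_inv_sub_inv_mul_of_sylvester {M Λ : Matrix (Fin N) (Fin N) ℂ} {Y : Matrix ι (Fin N) ℂ}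
    (h : M * Λ - Λᴴ * M = Yᴴ * Y) (hdet : M.det ≠ 0) :
    Λ * M⁻¹ - M⁻¹ * Λᴴ = M⁻¹ * (Yᴴ * Y) * M⁻¹ := by
  rw [← h, Matrix.mul_sub, Matrix.sub_mul, Matrix.nonsing_inv_mul_cancel_left _ _ hdet.isUnit,
    ← Matrix.mul_assoc M⁻¹, Matrix.mul_nonsing_inv_cancel_right _ _ hdet.isUnit]

/-- The spatial derivative of `P = Y M⁻¹ Yᴴ`. -/
lemma hasMatDerivAt_dressing_fst (hSH : Sᴴ = -S) (hKH : Kᴴ = -K)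
    (h : M x * Λ - Λᴴ * M x = (Y x)ᴴ * Y x) (hdet : ∀ y, (M y).det ≠ 0)
    (hY : HasMatDerivAt Y (S * Y x * Λ + K * Y x) x)
    (hM : HasMatDerivAt M ((Y x)ᴴ * S * Y x) x) :
    HasMatDerivAt (fun y => Y y * (M y)⁻¹ * (Y y)ᴴ)
      (S * (Y x * Λ * (M x)⁻¹ * (Y x)ᴴ) - Y x * Λ * (M x)⁻¹ * (Y x)ᴴ * S
        + (K * (Y x * (M x)⁻¹ * (Y x)ᴴ) - Y x * (M x)⁻¹ * (Y x)ᴴ * K)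
        - Y x * (M x)⁻¹ * (Y x)ᴴ * (S * (Y x * (M x)⁻¹ * (Y x)ᴴ)
          - Y x * (M x)⁻¹ * (Y x)ᴴ * S)) x := by
  have h1 := (hY.mul (hM.inv hdet)).mul hY.conjTranspose
  have h2 := mul_inv_sub_inv_mul_of_sylvester h (hdet x)
  have h3 : Y x * (M x)⁻¹ * Λᴴ * (Y x)ᴴ = Y x * Λ * (M x)⁻¹ * (Y x)ᴴ
      - Y x * (M x)⁻¹ * (Y x)ᴴ * (Y x * (M x)⁻¹ * (Y x)ᴴ) := by
    have h4 := congrArg (fun A => Y x * A * (Y x)ᴴ) h2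
    simp only [Matrix.mul_sub, Matrix.sub_mul, ← Matrix.mul_assoc] at h4 ⊢
    rw [← h4]
    abel
  convert h1 using 1
  simp only [Matrix.conjTranspose_add, Matrix.conjTranspose_mul, hSH, hKH]
  have h5 := congrArg (fun A => A * S) h3
  simp only [Matrix.mul_sub, Matrix.sub_mul, Matrix.mul_add, Matrix.add_mul, Matrix.mul_neg,
    Matrix.neg_mul, Matrix.mul_assoc] at h5 ⊢
  rw [h5]
  abel

/-- The derivative in time of `P = Y M⁻¹ Yᴴ`, in terms of the spatial derivatives `Y'`, `M'` of `Y`,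
`M`. -/
lemma hasMatDerivAt_dressing_snd (hbH : bᴴ = -b) {Y' : Matrix ι (Fin N) ℂ}
    {M' : Matrix (Fin N) (Fin N) ℂ}
    (h : M x * Λ - Λᴴ * M x = (Y x)ᴴ * Y x) (hdet : ∀ y, (M y).det ≠ 0)
    (hY : HasMatDerivAt Y (Y' * Λ + b * Y x) x)
    (hM : HasMatDerivAt M (Λᴴ * M' + (Y x)ᴴ * Y') x) :
    HasMatDerivAt (fun y => Y y * (M y)⁻¹ * (Y y)ᴴ)
      ((Y' * Λ * (M x)⁻¹ + Y x * Λ * -((M x)⁻¹ * M' * (M x)⁻¹)) * (Y x)ᴴ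
        + Y x * Λ * (M x)⁻¹ * Y'ᴴ
        - Y x * (M x)⁻¹ * (Y x)ᴴ * ((Y' * (M x)⁻¹ + Y x * -((M x)⁻¹ * M' * (M x)⁻¹)) * (Y x)ᴴ
          + Y x * (M x)⁻¹ * Y'ᴴ)
        + (b * (Y x * (M x)⁻¹ * (Y x)ᴴ) - Y x * (M x)⁻¹ * (Y x)ᴴ * b)) x := by
  have h1 := (hY.mul (hM.inv hdet)).mul hY.conjTranspose
  have h2 := mul_inv_sub_inv_mul_of_sylvester h (hdet x)
  have h3 : ∀ A : Matrix (Fin N) ι ℂ, Y x * ((M x)⁻¹ * (Λᴴ * A)) = Y x * (Λ * ((M x)⁻¹ * A))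
      - Y x * ((M x)⁻¹ * ((Y x)ᴴ * (Y x * ((M x)⁻¹ * A)))) := by
    intro A
    have h4 := congrArg (fun B => Y x * B * A) h2
    simp only [Matrix.mul_sub, Matrix.sub_mul, Matrix.mul_assoc] at h4 ⊢
    rw [← h4]
    abel
  convert h1 using 1
  simp only [Matrix.conjTranspose_add, Matrix.conjTranspose_mul, hbH]
  simp only [Matrix.mul_add, Matrix.add_mul, Matrix.mul_neg,
    Matrix.neg_mul, Matrix.mul_assoc]
  rw [h3, h3]
  abel

end

/-! ### The NLS equation in matrix form -/

section

variable {n : ℕ}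

lemma potential_apply_zero_zero (q : EuclideanSpace ℂ (Fin n)) : potential q 0 0 = 0 := rfl

lemma potential_apply_zero_succ (q : EuclideanSpace ℂ (Fin n)) (k : Fin n) :
    potential q 0 k.succ = star (q k) := rfl

lemma potential_apply_succ_zero (q : EuclideanSpace ℂ (Fin n)) (j : Fin n) :
    potential q j.succ 0 = q j := rfl

lemma potential_apply_succ_succ (q : EuclideanSpace ℂ (Fin n)) (j k : Fin n) :
    potential q j.succ k.succ = 0 := rfl

lemma matrix_fin_succ_ext {A B : Matrix (Fin (n + 1)) (Fin (n + 1)) ℂ} (h₀ : A 0 0 = B 0 0)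
    (h₁ : ∀ k : Fin n, A 0 k.succ = B 0 k.succ) (h₂ : ∀ j : Fin n, A j.succ 0 = B j.succ 0)
    (h₃ : ∀ j k : Fin n, A j.succ k.succ = B j.succ k.succ) : A = B := by
  ext i j
  refine Fin.cases ?_ (fun i => ?_) i <;> refine Fin.cases ?_ (fun j => ?_) j
  exacts [h₀, h₁ j, h₂ i, h₃ i j]

lemma potential_conjTranspose (q : EuclideanSpace ℂ (Fin n)) : (potential q)ᴴ = potential q :=
  matrix_fin_succ_ext (star_zero _) (fun _ => rfl) (fun _ => star_star _) fun _ _ => star_zero _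

lemma potential_add (q r : EuclideanSpace ℂ (Fin n)) :
    potential (q + r) = potential q + potential r :=
  matrix_fin_succ_ext (add_zero _).symm (fun _ => star_add _ _) (fun _ => rfl)
    fun _ _ => (add_zero _).symm

lemma potential_smul {c : ℂ} (hc : star c = c) (q : EuclideanSpace ℂ (Fin n)) :
    potential (c • q) = c • potential q := by
  refine matrix_fin_succ_ext (mul_zero _).symm (fun k => ?_) (fun _ => rfl)
    fun _ _ => (mul_zero _).symm
  rw [Matrix.smul_apply, potential_apply_zero_succ, potential_apply_zero_succ, PiLp.smul_apply,
    smul_eq_mul, star_mul', hc, smul_eq_mul]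

lemma potential_eq_zero_iff {q : EuclideanSpace ℂ (Fin n)} : potential q = 0 ↔ q = 0 := by
  constructor
  · intro h
    ext j
    rw [← potential_apply_succ_zero, h]
    rfl
  · rintro rfl
    exact matrix_fin_succ_ext rfl (fun _ => star_zero _) (fun _ => rfl) fun _ _ => rfl

lemma sigma3_mul_self : sigma3 n * sigma3 n = 1 := by
  rw [sigma3, Matrix.diagonal_mul_diagonal, ← Matrix.diagonal_one]
  congr 1
  ext i
  refine Fin.cases ?_ (fun i => ?_) i <;> simp

lemma sigma3_conjTranspose : (sigma3 n)ᴴ = sigma3 n := by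
  rw [sigma3, Matrix.diagonal_conjTranspose]
  congr 1
  ext i
  refine Fin.cases ?_ (fun i => ?_) i <;> simp

lemma sigma3_mul_apply_zero (A : Matrix (Fin (n + 1)) (Fin (n + 1)) ℂ) (k : Fin (n + 1)) :
    (sigma3 n * A) 0 k = A 0 k := by
  simp [sigma3, Matrix.diagonal_mul]

lemma sigma3_mul_apply_succ (A : Matrix (Fin (n + 1)) (Fin (n + 1)) ℂ) (j : Fin n)
    (k : Fin (n + 1)) : (sigma3 n * A) j.succ k = -A j.succ k := by
  simp [sigma3, Matrix.diagonal_mul]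

lemma mul_sigma3_apply_zero (A : Matrix (Fin (n + 1)) (Fin (n + 1)) ℂ) (j : Fin (n + 1)) :
    (A * sigma3 n) j 0 = A j 0 := by
  simp [sigma3, Matrix.mul_diagonal]

lemma mul_sigma3_apply_succ (A : Matrix (Fin (n + 1)) (Fin (n + 1)) ℂ) (j : Fin (n + 1))
    (k : Fin n) : (A * sigma3 n) j k.succ = -A j k.succ := by
  simp [sigma3, Matrix.mul_diagonal]

lemma sigma3_mul_potential (q : EuclideanSpace ℂ (Fin n)) :
    sigma3 n * potential q = -(potential q * sigma3 n) := by
  apply matrix_fin_succ_ext <;> intros <;>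
    simp only [Matrix.neg_apply, sigma3_mul_apply_zero, sigma3_mul_apply_succ,
      mul_sigma3_apply_zero, mul_sigma3_apply_succ, potential_apply_zero_zero,
      potential_apply_succ_succ, neg_zero, neg_neg]

lemma neg_I_smul_sigma3_mul_potential (q : EuclideanSpace ℂ (Fin n)) :
    -Complex.I • (sigma3 n * potential q) = potential (Complex.I • q) := by
  apply matrix_fin_succ_ext <;> intros <;>
    simp [sigma3_mul_apply_zero, sigma3_mul_apply_succ, potential_apply_zero_zero,
      potential_apply_succ_succ, potential_apply_zero_succ, potential_apply_succ_zero]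

lemma norm_sq_eq_sum_star_mul (q : EuclideanSpace ℂ (Fin n)) :
    ((‖q‖ ^ 2 : ℝ) : ℂ) = ∑ j, star (q j) * q j := by
  rw [EuclideanSpace.norm_sq_eq]
  push_cast
  refine Finset.sum_congr rfl fun j _ => ?_
  rw [← Complex.conj_mul', Complex.star_def]

lemma potential_sq_apply_zero_zero (q : EuclideanSpace ℂ (Fin n)) :
    (potential q * potential q) 0 0 = ((‖q‖ ^ 2 : ℝ) : ℂ) := by
  rw [norm_sq_eq_sum_star_mul, Matrix.mul_apply, Fin.sum_univ_succ, potential_apply_zero_zero,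
    zero_mul, zero_add]
  rfl

lemma potential_sq_apply_zero_succ (q : EuclideanSpace ℂ (Fin n)) (k : Fin n) :
    (potential q * potential q) 0 k.succ = 0 := by
  rw [Matrix.mul_apply, Fin.sum_univ_succ, potential_apply_zero_zero, zero_mul, zero_add]
  exact Finset.sum_eq_zero fun j _ => mul_zero _

lemma potential_sq_apply_succ_zero (q : EuclideanSpace ℂ (Fin n)) (j : Fin n) :
    (potential q * potential q) j.succ 0 = 0 := by
  rw [Matrix.mul_apply, Fin.sum_univ_succ, potential_apply_zero_zero, mul_zero, zero_add]
  exact Finset.sum_eq_zero fun j _ => zero_mul _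

lemma potential_sq_apply_succ_succ (q : EuclideanSpace ℂ (Fin n)) (j k : Fin n) :
    (potential q * potential q) j.succ k.succ = q j * star (q k) := by
  rw [Matrix.mul_apply, Fin.sum_univ_succ]
  simp only [potential_apply_succ_succ, potential_apply_succ_zero, potential_apply_zero_succ]
  simp

lemma trace_potential_sq (q : EuclideanSpace ℂ (Fin n)) :
    (potential q * potential q).trace = 2 * ((‖q‖ ^ 2 : ℝ) : ℂ) := by
  rw [Matrix.trace, Fin.sum_univ_succ]
  simp only [Matrix.diag_apply, potential_sq_apply_zero_zero, potential_sq_apply_succ_succ]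
  rw [two_mul, norm_sq_eq_sum_star_mul]
  simp only [mul_comm]

lemma potential_cube (q : EuclideanSpace ℂ (Fin n)) :
    potential q * potential q * potential q = ((‖q‖ ^ 2 : ℝ) : ℂ) • potential q := by
  apply matrix_fin_succ_ext <;> intros <;> rw [Matrix.mul_apply, Fin.sum_univ_succ] <;>
    simp only [potential_sq_apply_zero_zero, potential_sq_apply_zero_succ,
      potential_sq_apply_succ_zero, potential_sq_apply_succ_succ, potential_apply_zero_zero,
      potential_apply_succ_zero, potential_apply_zero_succ, potential_apply_succ_succ,
      Matrix.smul_apply, smul_eq_mul, mul_zero, zero_mul, zero_add, add_zero,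
      Finset.sum_const_zero]
  simp only [norm_sq_eq_sum_star_mul, Finset.sum_mul]
  exact Finset.sum_congr rfl fun j _ => by ring

/-- `iσ₃`. -/
noncomputable def iSigma (n : ℕ) : Matrix (Fin (n + 1)) (Fin (n + 1)) ℂ := Complex.I • sigma3 n

/-- `iQ`. -/
noncomputable def iPotential (q : EuclideanSpace ℂ (Fin n)) :
    Matrix (Fin (n + 1)) (Fin (n + 1)) ℂ := Complex.I • potential q

lemma iSigma_mul_self : iSigma n * iSigma n = -1 := by
  rw [iSigma, smul_mul_smul_comm, sigma3_mul_self, Complex.I_mul_I, neg_one_smul]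

lemma iSigma_conjTranspose : (iSigma n)ᴴ = -iSigma n := by
  rw [iSigma, Matrix.conjTranspose_smul, sigma3_conjTranspose, Complex.star_def, Complex.conj_I,
    neg_smul]

lemma iPotential_conjTranspose (q : EuclideanSpace ℂ (Fin n)) :
    (iPotential q)ᴴ = -iPotential q := by
  rw [iPotential, Matrix.conjTranspose_smul, potential_conjTranspose, Complex.star_def,
    Complex.conj_I, neg_smul]

lemma iSigma_mul_iPotential (q : EuclideanSpace ℂ (Fin n)) :
    iSigma n * iPotential q = -(iPotential q * iSigma n) := by
  rw [iSigma, iPotential, smul_mul_smul_comm, smul_mul_smul_comm, sigma3_mul_potential, smul_neg]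

/-- The NLS expression `i q_t + ½ q_xx + ‖q‖² q`, in terms of `S = iσ₃` and `K = iQ`. -/
lemma nls_iPotential (q qt qxx : EuclideanSpace ℂ (Fin n)) :
    -2 * (iSigma n * iPotential qt) + iPotential qxx
        - 2 * (iPotential q * iPotential q * iPotential q)
      = (2 * Complex.I) • potential (Complex.I • qt + (1 / 2 : ℂ) • qxx
          + ((‖q‖ ^ 2 : ℝ) : ℂ) • q) := by
  have h1 : star (1 / 2 : ℂ) = 1 / 2 := by
    simp
  have h2 : star ((‖q‖ ^ 2 : ℝ) : ℂ) = ((‖q‖ ^ 2 : ℝ) : ℂ) := Complex.conj_ofReal _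
  rw [potential_add, potential_add, potential_smul h1, potential_smul h2, ← potential_cube,
    ← neg_I_smul_sigma3_mul_potential]
  simp only [iSigma, iPotential, neg_mul, two_mul, Matrix.smul_mul, Matrix.mul_smul, smul_smul,
    Complex.I_mul_I]
  match_scalars <;> simp [Complex.ext_iff] <;> norm_num

lemma nls_iff_iPotential (q qt qxx : EuclideanSpace ℂ (Fin n)) :
    Complex.I • qt + (1 / 2 : ℂ) • qxx + ((‖q‖ ^ 2 : ℝ) : ℂ) • q = 0 ↔
      -2 * (iSigma n * iPotential qt) + iPotential qxx
        - 2 * (iPotential q * iPotential q * iPotential q) = 0 := by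
  rw [nls_iPotential, smul_eq_zero, potential_eq_zero_iff]
  simp

lemma hasMatDerivAt_iPotential {q : ℝ → EuclideanSpace ℂ (Fin n)} {q' : EuclideanSpace ℂ (Fin n)}
    {x : ℝ} (h : HasDerivAt q q' x) :
    HasMatDerivAt (fun y => iPotential (q y)) (iPotential q') x := by
  have h1 := hasDerivAt_euclideanSpace.1 h
  refine HasMatDerivAt.const_smul _ fun i j => ?_
  refine Fin.cases ?_ (fun i => ?_) i <;> refine Fin.cases ?_ (fun j => ?_) j
  · exact hasDerivAt_const _ _
  · exact (h1 j).star
  · exact h1 i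
  · exact hasDerivAt_const _ _

end

/-! ### The rogue wave solves the NLS equation -/

section

variable {n N : ℕ} {lam0 : ℂ}

lemma nls_background (n : ℕ) (lam0 : ℂ) (x t : ℝ) :
    Complex.I • (WithLp.toLp 2 fun j : Fin n =>
        Complex.I * frequency n lam0 j.succ * background n lam0 x t j : EuclideanSpace ℂ (Fin n))
      + (1 / 2 : ℂ) • (WithLp.toLp 2 fun j : Fin n => Complex.I * waveNumber n lam0 j.succ *
        (Complex.I * waveNumber n lam0 j.succ * background n lam0 x t j) :
          EuclideanSpace ℂ (Fin n))
      + ((‖background n lam0 x t‖ ^ 2 : ℝ) : ℂ) • background n lam0 x t = 0 := by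
  have h1 : ((‖background n lam0 x t‖ ^ 2 : ℝ) : ℂ) = ((‖amp n lam0‖ ^ 2 : ℝ) : ℂ) := by
    rw [norm_sq_eq_sum_star_mul, ← sum_amp_sq]
    exact Finset.sum_congr rfl fun j _ => star_background_mul_self n lam0 x t j
  rw [h1]
  ext j
  simp only [PiLp.add_apply, PiLp.smul_apply, smul_eq_mul, PiLp.zero_apply, waveNumber, frequency,
    Matrix.cons_val_succ]
  push_cast
  linear_combination ((‖amp n lam0‖ : ℂ) ^ 2) * background n lam0 x t j * Complex.I_sq

lemma hasDerivAt_background_fst_fst (n : ℕ) (lam0 : ℂ) (x t : ℝ) :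
    HasDerivAt (fun y => (WithLp.toLp 2 fun j : Fin n =>
        Complex.I * waveNumber n lam0 j.succ * background n lam0 y t j : EuclideanSpace ℂ (Fin n)))
      (WithLp.toLp 2 fun j : Fin n => Complex.I * waveNumber n lam0 j.succ *
        (Complex.I * waveNumber n lam0 j.succ * background n lam0 x t j)) x :=
  hasDerivAt_euclideanSpace.2 fun j =>
    (hasDerivAt_euclideanSpace.1 (hasDerivAt_background_fst n lam0 x t) j).const_mul _

variable {μ : Fin (n + 1) → ℂ → ℂ}
  {γ : ℕ → Matrix (Fin (n + 1)) (Fin (n + 1)) ℂ} {β : Fin (n + 1) → ℂ}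

lemma mul_matY_apply (A : Matrix (Fin (n + 1)) (Fin (n + 1)) ℂ) (x t : ℝ) (i : Fin (n + 1))
    (k : Fin N) : (A * matY n N lam0 μ γ β x t) i k = (A *ᵥ PhiTilde n lam0 μ γ β k x t) i := rfl

lemma mul_matY_mul_shift_apply (A : Matrix (Fin (n + 1)) (Fin (n + 1)) ℂ) (x t : ℝ)
    (i : Fin (n + 1)) (k : Fin N) :
    (A * matY n N lam0 μ γ β x t * shift N) i k
      = (A *ᵥ delay 1 (fun k => PhiTilde n lam0 μ γ β k x t) k) i := by
  have h := mul_shift_apply (fun i k => (A *ᵥ PhiTilde n lam0 μ γ β k x t) i) i k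
  rw [show A * matY n N lam0 μ γ β x t = Matrix.of fun i (k : Fin N) =>
    (A *ᵥ PhiTilde n lam0 μ γ β k x t) i from rfl, h]
  unfold delay
  split_ifs <;> simp

lemma mul_matY_mul_shift_mul_shift_apply (A : Matrix (Fin (n + 1)) (Fin (n + 1)) ℂ) (x t : ℝ)
    (i : Fin (n + 1)) (k : Fin N) :
    (A * matY n N lam0 μ γ β x t * shift N * shift N) i k
      = (A *ᵥ delay 2 (fun k => PhiTilde n lam0 μ γ β k x t) k) i := by
  rw [show A * matY n N lam0 μ γ β x t * shift N = Matrix.of fun i (k : Fin N) =>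
    (A *ᵥ delay 1 (fun k => PhiTilde n lam0 μ γ β k x t) k) i from
      Matrix.ext fun i k => mul_matY_mul_shift_apply A x t i k,
    mul_shift_apply (fun i k => (A *ᵥ delay 1 (fun k => PhiTilde n lam0 μ γ β k x t) k) i)]
  unfold delay
  by_cases h1 : 1 ≤ (k : ℕ) <;> by_cases h2 : 2 ≤ (k : ℕ)
  · rw [if_pos h1, if_pos h2]
    dsimp only
    rw [if_pos (by omega), Nat.sub_sub]
  · rw [if_pos h1, if_neg h2]
    dsimp only
    rw [if_neg (by omega)]
  · omega
  · rw [if_neg h1, if_neg h2]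
    simp

/-- The confluent form `Y_x = SYΛ + KY` of the spatial part of the Lax pair. -/
lemma IsEigenvalueBranches.hasMatDerivAt_matY_fst (hre : lam0.re = 0) (him : lam0.im ≠ 0)
    (hμ : IsEigenvalueBranches n lam0 μ) (x t : ℝ) :
    HasMatDerivAt (fun y => matY n N lam0 μ γ β y t)
      (iSigma n * matY n N lam0 μ γ β x t * jordan N lam0
        + iPotential (background n lam0 x t) * matY n N lam0 μ γ β x t) x := by
  intro i k
  refine (hμ.hasDerivAt_PhiTilde_fst hre him γ β k x t i).congr_deriv ?_
  have h1 : iSigma n * matY n N lam0 μ γ β x t * jordan N lam0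
        + iPotential (background n lam0 x t) * matY n N lam0 μ γ β x t
      = laxU (background n lam0) lam0 x t * matY n N lam0 μ γ β x t
        + ((Complex.I * lam0) • sigma3 n) * matY n N lam0 μ γ β x t * shift N := by
    simp only [iSigma, iPotential, jordan, laxU, Matrix.mul_smul, Matrix.mul_add, Matrix.mul_one,
      Matrix.smul_mul, Matrix.add_mul, smul_add, smul_smul, mul_comm lam0]
    abel
  rw [h1, Matrix.add_apply, mul_matY_apply, mul_matY_mul_shift_apply, Pi.add_apply]

/-- The confluent form `Y_t = Y_x Λ + ½ S (K² - K_x) Y` of the temporal part of the Lax pair. -/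
lemma IsEigenvalueBranches.hasMatDerivAt_matY_snd (hre : lam0.re = 0) (him : lam0.im ≠ 0)
    (hμ : IsEigenvalueBranches n lam0 μ) (x t : ℝ) :
    HasMatDerivAt (fun τ => matY n N lam0 μ γ β x τ)
      ((iSigma n * matY n N lam0 μ γ β x t * jordan N lam0
        + iPotential (background n lam0 x t) * matY n N lam0 μ γ β x t) * jordan N lam0
        + (1 / 2 : ℂ) • (iSigma n * (iPotential (background n lam0 x t)
            * iPotential (background n lam0 x t)
          - iPotential (WithLp.toLp 2 fun j : Fin n =>
              Complex.I * waveNumber n lam0 j.succ * background n lam0 x t j)))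
          * matY n N lam0 μ γ β x t) t := by
  intro i k
  refine (hμ.hasDerivAt_PhiTilde_snd hre him γ β k x t i).congr_deriv ?_
  set A : Matrix (Fin (n + 1)) (Fin (n + 1)) ℂ :=
    Complex.I • ((2 * lam0 ^ 2) • sigma3 n + lam0 • potential (background n lam0 x t)) with hA
  have h1 : (iSigma n * matY n N lam0 μ γ β x t * jordan N lam0
        + iPotential (background n lam0 x t) * matY n N lam0 μ γ β x t) * jordan N lam0
        + (1 / 2 : ℂ) • (iSigma n * (iPotential (background n lam0 x t)
            * iPotential (background n lam0 x t)
          - iPotential (WithLp.toLp 2 fun j : Fin n =>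
              Complex.I * waveNumber n lam0 j.succ * background n lam0 x t j)))
          * matY n N lam0 μ γ β x t
      = laxV (background n lam0) lam0 x t * matY n N lam0 μ γ β x t
        + A * matY n N lam0 μ γ β x t * shift N
        + ((Complex.I * lam0 ^ 2) • sigma3 n) * matY n N lam0 μ γ β x t * shift N * shift N := by
    rw [hA]
    simp only [iSigma, iPotential, jordan, laxV, (hasDerivAt_background_fst n lam0 x t).deriv,
      Matrix.mul_smul, Matrix.mul_add, Matrix.mul_one, Matrix.smul_mul, Matrix.add_mul,
      Matrix.sub_mul, Matrix.mul_sub, smul_add, smul_sub, smul_smul, pow_two (potential _),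
      Matrix.mul_assoc]
    match_scalars <;> ring_nf <;> simp [Complex.I_pow_three] <;> ring
  rw [h1, Matrix.add_apply, Matrix.add_apply, mul_matY_apply, mul_matY_mul_shift_apply,
    mul_matY_mul_shift_mul_shift_apply, Pi.add_apply, Pi.add_apply]

end

/-! ### Derivatives of the dressing matrix -/

section

variable {n N : ℕ} {lam0 : ℂ} {μ : Fin (n + 1) → ℂ → ℂ}
  {γ : ℕ → Matrix (Fin (n + 1)) (Fin (n + 1)) ℂ} {β : Fin (n + 1) → ℂ}

lemma exists_hasMatDerivAt_matM {X T : ℝ → ℝ} {r : ℝ}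
    (h : ∀ k i, DifferentiableAt ℝ (fun r => PhiTilde n lam0 μ γ β k (X r) (T r) i) r) :
    ∃ D, HasMatDerivAt (fun r => matM n N lam0 μ γ β (X r) (T r)) D r := by
  have h1 : ∀ m k : Fin N, DifferentiableAt ℝ (fun r => matM n N lam0 μ γ β (X r) (T r) m k) r := by
    intro m k
    simp only [matM, Matrix.of_apply, dotProduct, Pi.star_apply]
    exact (DifferentiableAt.fun_sum fun s _ => DifferentiableAt.fun_sum fun l _ =>
      (DifferentiableAt.fun_sum fun i _ => (h _ i).star.fun_mul (h _ i)).const_mul _).const_mul _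
  exact ⟨Matrix.of fun m k => deriv (fun r => matM n N lam0 μ γ β (X r) (T r) m k) r,
    fun m k => (h1 m k).hasDerivAt⟩

lemma IsEigenvalueBranches.hasMatDerivAt_matM_fst (hre : lam0.re = 0) (him : lam0.im ≠ 0)
    (hμ : IsEigenvalueBranches n lam0 μ) (x t : ℝ) :
    HasMatDerivAt (fun y => matM n N lam0 μ γ β y t)
      ((matY n N lam0 μ γ β x t)ᴴ * iSigma n * matY n N lam0 μ γ β x t) x := by
  obtain ⟨D, hD⟩ := exists_hasMatDerivAt_matM (n := n) (N := N) (lam0 := lam0) (μ := μ) (γ := γ)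
    (β := β) (X := fun y => y) (T := fun _ => t) (r := x)
    fun k i => (hμ.hasDerivAt_PhiTilde_fst hre him γ β k x t i).differentiableAt
  refine HasMatDerivAt.of_sylvester hre him (fun y => matM_sylvester hre him y t) hD
    (hμ.hasMatDerivAt_matY_fst hre him x t) ?_
  simp only [Matrix.conjTranspose_add, Matrix.conjTranspose_mul, iSigma_conjTranspose,
    iPotential_conjTranspose, Matrix.add_mul, Matrix.mul_add, Matrix.mul_neg, Matrix.neg_mul,
    Matrix.mul_assoc]
  abel

lemma halfSigma_conjTranspose (q qx : EuclideanSpace ℂ (Fin n)) :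
    ((1 / 2 : ℂ) • (iSigma n * (iPotential q * iPotential q - iPotential qx)))ᴴ
      = -((1 / 2 : ℂ) • (iSigma n * (iPotential q * iPotential q - iPotential qx))) := by
  have h1 : star (1 / 2 : ℂ) = 1 / 2 := by simp
  rw [Matrix.conjTranspose_smul, h1, Matrix.conjTranspose_mul, Matrix.conjTranspose_sub,
    Matrix.conjTranspose_mul, iSigma_conjTranspose, iPotential_conjTranspose,
    iPotential_conjTranspose, ← smul_neg]
  have e : ∀ r : EuclideanSpace ℂ (Fin n), iPotential r * iSigma n = -(iSigma n * iPotential r) :=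
    fun r => by rw [iSigma_mul_iPotential, neg_neg]
  have e' : ∀ (r : EuclideanSpace ℂ (Fin n)) (A : Matrix (Fin (n + 1)) (Fin (n + 1)) ℂ),
      iPotential r * (iSigma n * A) = -(iSigma n * (iPotential r * A)) := fun r A => by
    rw [← mul_assoc, e, neg_mul, mul_assoc]
  congr 1
  simp only [mul_neg, neg_mul, neg_neg, add_mul, sub_neg_eq_add, mul_assoc, e, e', mul_sub]
  abel

lemma IsEigenvalueBranches.hasMatDerivAt_matM_snd (hre : lam0.re = 0) (him : lam0.im ≠ 0)
    (hμ : IsEigenvalueBranches n lam0 μ) (x t : ℝ) :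
    HasMatDerivAt (fun τ => matM n N lam0 μ γ β x τ)
      ((jordan N lam0)ᴴ * ((matY n N lam0 μ γ β x t)ᴴ * iSigma n * matY n N lam0 μ γ β x t)
        + (matY n N lam0 μ γ β x t)ᴴ * (iSigma n * matY n N lam0 μ γ β x t * jordan N lam0
        + iPotential (background n lam0 x t) * matY n N lam0 μ γ β x t)) t := by
  obtain ⟨D, hD⟩ := exists_hasMatDerivAt_matM (n := n) (N := N) (lam0 := lam0) (μ := μ) (γ := γ)
    (β := β) (X := fun _ => x) (T := fun τ => τ) (r := t)
    fun k i => (hμ.hasDerivAt_PhiTilde_snd hre him γ β k x t i).differentiableAt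
  refine HasMatDerivAt.of_sylvester hre him (fun τ => matM_sylvester hre him x τ) hD
    (hμ.hasMatDerivAt_matY_snd hre him x t) ?_
  rw [Matrix.conjTranspose_add, Matrix.conjTranspose_mul _ (matY n N lam0 μ γ β x t),
    halfSigma_conjTranspose]
  simp only [Matrix.conjTranspose_add, Matrix.conjTranspose_mul, iSigma_conjTranspose,
    iPotential_conjTranspose, Matrix.add_mul, Matrix.mul_add, Matrix.mul_neg, Matrix.neg_mul,
    Matrix.mul_assoc]
  abel

/-- The dressing matrix `P = Y M⁻¹ Yᴴ`. -/
noncomputable def dressing (n N : ℕ) (lam0 : ℂ) (μ : Fin (n + 1) → ℂ → ℂ)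
    (γ : ℕ → Matrix (Fin (n + 1)) (Fin (n + 1)) ℂ) (β : Fin (n + 1) → ℂ) (x t : ℝ) :
    Matrix (Fin (n + 1)) (Fin (n + 1)) ℂ :=
  matY n N lam0 μ γ β x t * (matM n N lam0 μ γ β x t)⁻¹ * (matY n N lam0 μ γ β x t)ᴴ

/-- The matrix `Y Λ M⁻¹ Yᴴ`. -/
noncomputable def dressing₁ (n N : ℕ) (lam0 : ℂ) (μ : Fin (n + 1) → ℂ → ℂ)
    (γ : ℕ → Matrix (Fin (n + 1)) (Fin (n + 1)) ℂ) (β : Fin (n + 1) → ℂ) (x t : ℝ) :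
    Matrix (Fin (n + 1)) (Fin (n + 1)) ℂ :=
  matY n N lam0 μ γ β x t * jordan N lam0 * (matM n N lam0 μ γ β x t)⁻¹
    * (matY n N lam0 μ γ β x t)ᴴ

lemma dressing_conjTranspose (hre : lam0.re = 0) (him : lam0.im ≠ 0) (x t : ℝ) :
    (dressing n N lam0 μ γ β x t)ᴴ = -dressing n N lam0 μ γ β x t := by
  have h1 := conjTranspose_eq_neg_of_sylvester hre him
    (matM_sylvester (n := n) (N := N) (μ := μ) (γ := γ) (β := β) hre him x t)
  have h2 : ∀ A : Matrix (Fin N) (Fin N) ℂ, (-A)⁻¹ = -A⁻¹ := by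
    intro A
    by_cases hA : IsUnit A.det
    · refine Matrix.inv_eq_right_inv ?_
      rw [neg_mul_neg, Matrix.mul_nonsing_inv _ hA]
    · have hA' : ¬ IsUnit (-A).det := by
        rw [Matrix.det_neg]
        intro h
        exact hA (isUnit_of_mul_isUnit_right h)
      rw [Matrix.nonsing_inv_apply_not_isUnit _ hA, Matrix.nonsing_inv_apply_not_isUnit _ hA',
        neg_zero]
  simp only [dressing, Matrix.conjTranspose_mul, Matrix.conjTranspose_conjTranspose,
    Matrix.conjTranspose_nonsing_inv, h1, h2, Matrix.mul_neg, Matrix.neg_mul, Matrix.mul_assoc]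

/-- `iQ^{[N]} = K + [S, P]`. -/
lemma iPotential_rogueWave (hre : lam0.re = 0) (him : lam0.im ≠ 0) {x t : ℝ}
    (hM : (matM n N lam0 μ γ β x t).det ≠ 0) :
    iPotential (rogueWave n N lam0 μ γ β x t) = iPotential (background n lam0 x t)
      + (iSigma n * dressing n N lam0 μ γ β x t - dressing n N lam0 μ γ β x t * iSigma n) := by
  have h1 : potential (rogueWave n N lam0 μ γ β x t) = potential (background n lam0 x t)
      + (sigma3 n * dressing n N lam0 μ γ β x t - dressing n N lam0 μ γ β x t * sigma3 n) := by
    apply matrix_fin_succ_ext <;> intros <;>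
      simp only [Matrix.add_apply, Matrix.sub_apply, sigma3_mul_apply_zero, sigma3_mul_apply_succ,
        mul_sigma3_apply_zero, mul_sigma3_apply_succ, potential_apply_zero_zero,
        potential_apply_succ_succ, potential_apply_zero_succ, potential_apply_succ_zero,
        rogueWave_apply hM]
    · simp
    · rename_i k
      have h2 := congrFun (congrFun (dressing_conjTranspose (n := n) (N := N) (μ := μ) (γ := γ)
        (β := β) hre him x t) 0) k.succ
      rw [Matrix.conjTranspose_apply, Matrix.neg_apply] at h2
      rw [star_sub, star_mul', ← dressing, h2]
      simp
      ring
    · rw [← dressing]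
      ring
    · simp
  simp only [iPotential, iSigma, h1, smul_add, smul_sub, Matrix.smul_mul, Matrix.mul_smul]

lemma IsEigenvalueBranches.hasMatDerivAt_dressing_fst (hre : lam0.re = 0) (him : lam0.im ≠ 0)
    (hμ : IsEigenvalueBranches n lam0 μ) (hγ : γ 0 *ᵥ β ≠ 0) (x t : ℝ) :
    HasMatDerivAt (fun y => dressing n N lam0 μ γ β y t)
      (iSigma n * dressing₁ n N lam0 μ γ β x t - dressing₁ n N lam0 μ γ β x t * iSigma n
        + (iPotential (background n lam0 x t) * dressing n N lam0 μ γ β x t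
          - dressing n N lam0 μ γ β x t * iPotential (background n lam0 x t))
        - dressing n N lam0 μ γ β x t * (iSigma n * dressing n N lam0 μ γ β x t
          - dressing n N lam0 μ γ β x t * iSigma n)) x :=
  NNLS.hasMatDerivAt_dressing_fst iSigma_conjTranspose (iPotential_conjTranspose _)
    (matM_sylvester hre him x t) (fun y => hμ.det_matM_ne_zero N hre him hγ y t)
    (hμ.hasMatDerivAt_matY_fst hre him x t) (hμ.hasMatDerivAt_matM_fst hre him x t)

lemma IsEigenvalueBranches.hasMatDerivAt_dressing_snd (hre : lam0.re = 0) (him : lam0.im ≠ 0)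
    (hμ : IsEigenvalueBranches n lam0 μ) (hγ : γ 0 *ᵥ β ≠ 0) (x t : ℝ) :
    ∃ P1x Pt : Matrix (Fin (n + 1)) (Fin (n + 1)) ℂ,
      HasMatDerivAt (fun y => dressing₁ n N lam0 μ γ β y t) P1x x ∧
      HasMatDerivAt (fun τ => dressing n N lam0 μ γ β x τ) Pt t ∧
      ∀ Px, HasMatDerivAt (fun y => dressing n N lam0 μ γ β y t) Px x →
        2 * Pt = 2 * P1x - 2 * (dressing n N lam0 μ γ β x t * Px)
          + (iSigma n * (iPotential (background n lam0 x t) * iPotential (background n lam0 x t)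
              - iPotential (WithLp.toLp 2 fun j : Fin n =>
                Complex.I * waveNumber n lam0 j.succ * background n lam0 x t j))
              * dressing n N lam0 μ γ β x t
            - dressing n N lam0 μ γ β x t * (iSigma n * (iPotential (background n lam0 x t)
              * iPotential (background n lam0 x t) - iPotential (WithLp.toLp 2 fun j : Fin n =>
                Complex.I * waveNumber n lam0 j.succ * background n lam0 x t j)))) := by
  have hYx := hμ.hasMatDerivAt_matY_fst (N := N) (γ := γ) (β := β) hre him x t
  have hMx := (hμ.hasMatDerivAt_matM_fst (N := N) (γ := γ) (β := β) hre him x t).inv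
    fun y => hμ.det_matM_ne_zero N hre him hγ y t
  have hPx := (hYx.mul hMx).mul hYx.conjTranspose
  have hP1x := ((hYx.mul_const (jordan N lam0)).mul hMx).mul hYx.conjTranspose
  have hPt := NNLS.hasMatDerivAt_dressing_snd (halfSigma_conjTranspose _ _)
    (matM_sylvester hre him x t) (fun τ => hμ.det_matM_ne_zero N hre him hγ x τ)
    (hμ.hasMatDerivAt_matY_snd hre him x t) (hμ.hasMatDerivAt_matM_snd hre him x t)
  refine ⟨_, _, hP1x, hPt, fun Px h => ?_⟩
  rw [h.unique hPx]
  unfold dressing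
  simp only [Matrix.smul_mul, Matrix.mul_smul, two_mul]
  module

end

/-! ### The differential equations of the rogue wave -/

section

variable {n N : ℕ} {lam0 : ℂ} {μ : Fin (n + 1) → ℂ → ℂ}
  {γ : ℕ → Matrix (Fin (n + 1)) (Fin (n + 1)) ℂ} {β : Fin (n + 1) → ℂ}

/-- The rogue wave solves the NLS equations. The derivatives of `iQ^{[N]} = K + [S, P]` are those of
the plane wave corrected by `[S, P_xx]` and `[S, P_t]`, and `dressing_identity` relates the two
corrections. -/
lemma IsEigenvalueBranches.exists_hasDerivAt_rogueWave (hre : lam0.re = 0) (him : lam0.im ≠ 0)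
    (hμ : IsEigenvalueBranches n lam0 μ) (hγ : γ 0 *ᵥ β ≠ 0) (x t : ℝ) :
    ∃ (qx : ℝ → EuclideanSpace ℂ (Fin n)) (qxx qt : EuclideanSpace ℂ (Fin n)),
      (∀ y, HasDerivAt (fun y => rogueWave n N lam0 μ γ β y t) (qx y) y) ∧
      HasDerivAt qx qxx x ∧
      HasDerivAt (fun τ => rogueWave n N lam0 μ γ β x τ) qt t ∧
      Complex.I • qt + (1 / 2 : ℂ) • qxx
        + ((‖rogueWave n N lam0 μ γ β x t‖ ^ 2 : ℝ) : ℂ) • rogueWave n N lam0 μ γ β x t = 0 := by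
  have hdet := hμ.det_matM_ne_zero N hre him hγ
  set S := iSigma n with hS
  let kx : ℝ → EuclideanSpace ℂ (Fin n) := fun y => WithLp.toLp 2 fun j =>
    Complex.I * waveNumber n lam0 j.succ * background n lam0 y t j
  let kxx : EuclideanSpace ℂ (Fin n) := WithLp.toLp 2 fun j => Complex.I * waveNumber n lam0 j.succ
    * (Complex.I * waveNumber n lam0 j.succ * background n lam0 x t j)
  let kt : EuclideanSpace ℂ (Fin n) := WithLp.toLp 2 fun j =>
    Complex.I * frequency n lam0 j.succ * background n lam0 x t j
  have hkx : ∀ y, HasDerivAt (fun y => background n lam0 y t) (kx y) y :=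
    fun y => hasDerivAt_background_fst n lam0 y t
  have hkxx : HasDerivAt kx kxx x := hasDerivAt_background_fst_fst n lam0 x t
  have hkt : HasDerivAt (fun τ => background n lam0 x τ) kt t :=
    hasDerivAt_background_snd n lam0 x t
  let P : ℝ → Matrix (Fin (n + 1)) (Fin (n + 1)) ℂ := fun y => dressing n N lam0 μ γ β y t
  let P1 : ℝ → Matrix (Fin (n + 1)) (Fin (n + 1)) ℂ := fun y => dressing₁ n N lam0 μ γ β y t
  let K : ℝ → Matrix (Fin (n + 1)) (Fin (n + 1)) ℂ := fun y => iPotential (background n lam0 y t)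
  let Px : ℝ → Matrix (Fin (n + 1)) (Fin (n + 1)) ℂ := fun y =>
    S * P1 y - P1 y * S + (K y * P y - P y * K y) - P y * (S * P y - P y * S)
  have hP : ∀ y, HasMatDerivAt P (Px y) y :=
    fun y => hμ.hasMatDerivAt_dressing_fst hre him hγ y t
  obtain ⟨P1x, Pt, hP1, hPt, hPt2⟩ := hμ.hasMatDerivAt_dressing_snd (N := N) hre him hγ x t
  have hK : HasMatDerivAt K (iPotential (kx x)) x := hasMatDerivAt_iPotential (hkx x)
  have hPxx : HasMatDerivAt Px (S * P1x - P1x * S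
      + ((iPotential (kx x) * P x + K x * Px x) - (Px x * K x + P x * iPotential (kx x)))
      - (Px x * (S * P x - P x * S) + P x * (S * Px x - Px x * S))) x :=
    (((hP1.const_mul S).sub (hP1.mul_const S)).add ((hK.mul (hP x)).sub ((hP x).mul hK))).sub
      ((hP x).mul (((hP x).const_mul S).sub ((hP x).mul_const S)))
  set Pxx := S * P1x - P1x * S
      + ((iPotential (kx x) * P x + K x * Px x) - (Px x * K x + P x * iPotential (kx x)))
      - (Px x * (S * P x - P x * S) + P x * (S * Px x - Px x * S)) with hPxxdef
  let qx : ℝ → EuclideanSpace ℂ (Fin n) := fun y => WithLp.toLp 2 fun j =>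
    kx y j - 2 * Px y j.succ 0
  let qxx : EuclideanSpace ℂ (Fin n) := WithLp.toLp 2 fun j => kxx j - 2 * Pxx j.succ 0
  let qt : EuclideanSpace ℂ (Fin n) := WithLp.toLp 2 fun j => kt j - 2 * Pt j.succ 0
  have hqx : ∀ y, HasDerivAt (fun y => rogueWave n N lam0 μ γ β y t) (qx y) y := by
    refine fun y => hasDerivAt_euclideanSpace.2 fun j => ?_
    simp only [rogueWave_apply (hdet _ _)]
    exact (hasDerivAt_euclideanSpace.1 (hkx y) j).fun_sub ((hP y j.succ 0).const_mul 2)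
  have hqxx : HasDerivAt qx qxx x := hasDerivAt_euclideanSpace.2 fun j =>
    (hasDerivAt_euclideanSpace.1 hkxx j).fun_sub ((hPxx j.succ 0).const_mul 2)
  have hqt : HasDerivAt (fun τ => rogueWave n N lam0 μ γ β x τ) qt t := by
    refine hasDerivAt_euclideanSpace.2 fun j => ?_
    simp only [rogueWave_apply (hdet _ _)]
    exact (hasDerivAt_euclideanSpace.1 hkt j).fun_sub ((hPt j.succ 0).const_mul 2)
  refine ⟨qx, qxx, qt, hqx, hqxx, hqt, ?_⟩
  rw [nls_iff_iPotential]
  have e1 : ∀ y, iPotential (qx y) = iPotential (kx y) + (S * Px y - Px y * S) := by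
    intro y
    have h1 := hasMatDerivAt_iPotential (hqx y)
    simp only [iPotential_rogueWave hre him (hdet _ _)] at h1
    exact h1.unique ((hasMatDerivAt_iPotential (hkx y)).add (((hP y).const_mul S).sub ((hP y).mul_const S)))
  have e2 : iPotential qxx = iPotential kxx + (S * Pxx - Pxx * S) := by
    have h1 := hasMatDerivAt_iPotential hqxx
    simp only [e1] at h1
    exact h1.unique ((hasMatDerivAt_iPotential hkxx).add ((hPxx.const_mul S).sub (hPxx.mul_const S)))
  have e3 : iPotential qt = iPotential kt + (S * Pt - Pt * S) := by
    have h1 := hasMatDerivAt_iPotential hqt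
    simp only [iPotential_rogueWave hre him (hdet _ _)] at h1
    exact h1.unique ((hasMatDerivAt_iPotential hkt).add ((hPt.const_mul S).sub (hPt.mul_const S)))
  have key := dressing_identity (S := S) (K := K x) (Kx := iPotential (kx x))
    (Kt := iPotential kt) (Kxx := iPotential kxx) (P := P x) (P1 := P1 x) (P1x := P1x)
    (Px := Px x) (Pt2 := 2 * Pt) (Pxx := Pxx) iSigma_mul_self (iSigma_mul_iPotential _)
    (iSigma_mul_iPotential _) rfl (hPt2 _ (hP x)) (by rw [hPxxdef]; abel)
    ((nls_iff_iPotential _ _ _).1 (nls_background n lam0 x t))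
  rw [e2, e3, iPotential_rogueWave hre him (hdet x t), ← hS, ← key]
  simp only [P, K]
  noncomm_ring

/-- The spatial derivative of `ln det M` is the trace of `S P`. -/
lemma IsEigenvalueBranches.hasDerivAt_det_matM (hre : lam0.re = 0) (him : lam0.im ≠ 0)
    (hμ : IsEigenvalueBranches n lam0 μ) (hγ : γ 0 *ᵥ β ≠ 0) (x t : ℝ) :
    HasDerivAt (fun y => (matM n N lam0 μ γ β y t).det)
      ((matM n N lam0 μ γ β x t).det * (iSigma n * dressing n N lam0 μ γ β x t).trace) x := by
  have hdet := hμ.det_matM_ne_zero N hre him hγ x t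
  refine (hμ.hasMatDerivAt_matM_fst hre him x t).det.congr_deriv ?_
  have h1 : (matM n N lam0 μ γ β x t).adjugate
      = (matM n N lam0 μ γ β x t).det • (matM n N lam0 μ γ β x t)⁻¹ := by
    rw [Matrix.inv_def, smul_smul, Ring.inverse_eq_inv', mul_inv_cancel₀ hdet, one_smul]
  rw [h1, Matrix.smul_mul, Matrix.trace_smul, smul_eq_mul, dressing, Matrix.trace_mul_comm (iSigma n),
    ← Matrix.mul_assoc, Matrix.trace_mul_comm _ (matY n N lam0 μ γ β x t)]
  simp only [Matrix.mul_assoc]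

/-- `(tr SP)_x = ‖q^{[N]}‖² - ‖q^{bg}‖²`. -/
lemma IsEigenvalueBranches.hasDerivAt_trace_dressing (hre : lam0.re = 0) (him : lam0.im ≠ 0)
    (hμ : IsEigenvalueBranches n lam0 μ) (hγ : γ 0 *ᵥ β ≠ 0) (x t : ℝ) :
    HasDerivAt (fun y => (iSigma n * dressing n N lam0 μ γ β y t).trace)
      (((‖rogueWave n N lam0 μ γ β x t‖ ^ 2 : ℝ) : ℂ) - ((‖amp n lam0‖ ^ 2 : ℝ) : ℂ)) x := by
  refine ((hμ.hasMatDerivAt_dressing_fst hre him hγ x t).const_mul (iSigma n)).trace.congr_deriv ?_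
  have h1 : ∀ q : EuclideanSpace ℂ (Fin n),
      ((‖q‖ ^ 2 : ℝ) : ℂ) = -(1 / 2) * (iPotential q * iPotential q).trace := by
    intro q
    rw [iPotential, smul_mul_smul_comm, Complex.I_mul_I, Matrix.trace_smul, trace_potential_sq,
      smul_eq_mul]
    ring
  have h2 : ((‖amp n lam0‖ ^ 2 : ℝ) : ℂ) = ((‖background n lam0 x t‖ ^ 2 : ℝ) : ℂ) := by
    rw [norm_sq_eq_sum_star_mul, ← sum_amp_sq]
    exact (Finset.sum_congr rfl fun j _ => star_background_mul_self n lam0 x t j).symm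
  rw [h2, h1, h1, iPotential_rogueWave hre him (hμ.det_matM_ne_zero N hre him hγ x t)]
  have hS := iSigma_mul_self (n := n)
  have hK := iSigma_mul_iPotential (background n lam0 x t)
  set S := iSigma n
  set K := iPotential (background n lam0 x t)
  set P := dressing n N lam0 μ γ β x t
  set P1 := dressing₁ n N lam0 μ γ β x t
  have hS' : ∀ A, S * (S * A) = -A := fun A => by rw [← mul_assoc, hS, neg_one_mul]
  have hK' : ∀ A, S * (K * A) = -(K * (S * A)) := fun A => by
    rw [← mul_assoc, hK, neg_mul, mul_assoc]
  have t1 : (S * (P1 * S)).trace = -P1.trace := by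
    rw [Matrix.trace_mul_comm, mul_assoc, hS, mul_neg_one, Matrix.trace_neg]
  have t2 : (K * (P * S)).trace = -(K * (S * P)).trace := by
    rw [← mul_assoc, Matrix.trace_mul_comm, hK', Matrix.trace_neg]
  have t3 : (S * (P * K)).trace = (K * (S * P)).trace := by
    rw [← mul_assoc, Matrix.trace_mul_comm]
  have t4 : (S * (P * (P * S))).trace = -(P * P).trace := by
    rw [Matrix.trace_mul_comm, mul_assoc, mul_assoc, hS, mul_neg_one, mul_neg, Matrix.trace_neg]
  have t5 : (P * (S * (P * S))).trace = (S * (P * (S * P))).trace := by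
    rw [Matrix.trace_mul_comm]
    simp only [mul_assoc]
  have t6 : (P * (S * K)).trace = -(K * (S * P)).trace := by
    rw [hK, mul_neg, Matrix.trace_neg, Matrix.trace_mul_comm, mul_assoc]
  simp only [mul_add, add_mul, mul_sub, sub_mul, mul_assoc, hS', hK', Matrix.trace_add,
    Matrix.trace_sub, Matrix.trace_neg, mul_neg, t1, t2, t3, t4, t5, t6]
  ring

end

/-! ### Rationality and smoothness -/

section

lemma star_eval_ofReal (p : MvPolynomial (Fin 2) ℂ) (x t : ℝ) :
    star (MvPolynomial.eval ![(x : ℂ), (t : ℂ)] p)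
      = MvPolynomial.eval ![(x : ℂ), (t : ℂ)] (MvPolynomial.map (starRingEnd ℂ) p) := by
  induction p using MvPolynomial.induction_on with
  | C a => simp
  | add p q hp hq => simp only [map_add, star_add, hp, hq]
  | mul_X p i hp =>
    simp only [map_mul, star_mul', hp, MvPolynomial.eval_X, MvPolynomial.map_X]
    congr 1
    fin_cases i <;> simp

lemma contDiff_eval (p : MvPolynomial (Fin 2) ℂ) :
    ContDiff ℝ ∞ fun r : ℝ × ℝ => MvPolynomial.eval ![(r.1 : ℂ), (r.2 : ℂ)] p := by
  induction p using MvPolynomial.induction_on with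
  | C a => simpa using contDiff_const
  | add p q hp hq => simpa only [map_add] using hp.add hq
  | mul_X p i hp =>
    simp only [map_mul, MvPolynomial.eval_X]
    refine hp.mul ?_
    fin_cases i
    · exact Complex.ofRealCLM.contDiff.comp contDiff_fst
    · exact Complex.ofRealCLM.contDiff.comp contDiff_snd

lemma contDiff_exp_linear (A B : ℂ) :
    ContDiff ℝ ∞ fun r : ℝ × ℝ => Complex.exp (A * (r.1 : ℂ) + B * (r.2 : ℂ)) :=
  ((contDiff_const.mul (Complex.ofRealCLM.contDiff.comp contDiff_fst)).add
    (contDiff_const.mul (Complex.ofRealCLM.contDiff.comp contDiff_snd))).cexp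

variable {n N : ℕ} {lam0 : ℂ} {μ : Fin (n + 1) → ℂ → ℂ}
  {γ : ℕ → Matrix (Fin (n + 1)) (Fin (n + 1)) ℂ} {β : Fin (n + 1) → ℂ}

/-- The exponential factor common to all entries of `Y`. -/
noncomputable def commonFactor (n : ℕ) (lam0 : ℂ) (x t : ℝ) : ℂ :=
  Complex.exp (expX lam0 (z0 n lam0) * x + expT n lam0 lam0 (z0 n lam0) * t)

/-- The diagonal entries of `G`. -/
noncomputable def gauge (n : ℕ) (lam0 : ℂ) (i : Fin (n + 1)) (x t : ℝ) : ℂ :=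
  Complex.exp (Complex.I * waveNumber n lam0 i * x + Complex.I * frequency n lam0 i * t)

lemma star_gauge_mul_gauge (i : Fin (n + 1)) (x t : ℝ) :
    star (gauge n lam0 i x t) * gauge n lam0 i x t = 1 := by
  simp only [gauge, Complex.star_def, ← Complex.exp_conj, map_add, map_mul, Complex.conj_I,
    Complex.conj_ofReal, ← Complex.exp_add]
  rw [← Complex.exp_zero]
  congr 1
  ring

lemma gauge_zero (x t : ℝ) : gauge n lam0 0 x t = 1 := by
  simp [gauge, waveNumber, frequency]

lemma background_eq_gauge (x t : ℝ) (j : Fin n) :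
    background n lam0 x t j = (amp n lam0 j : ℂ) * gauge n lam0 j.succ x t :=
  background_apply n lam0 x t j

/-- Up to exponential factors, the entries of `Y` are polynomials: all exponents agree at
`ε = 0`. -/
lemma IsEigenvalueBranches.exists_polynomial_PhiTilde (hre : lam0.re = 0) (him : lam0.im ≠ 0)
    (hμ : IsEigenvalueBranches n lam0 μ) (k : ℕ) (i : Fin (n + 1)) :
    ∃ p : MvPolynomial (Fin 2) ℂ, ∀ x t : ℝ, PhiTilde n lam0 μ γ β k x t i
      = commonFactor n lam0 x t * gauge n lam0 i x t * MvPolynomial.eval ![(x : ℂ), (t : ℂ)] p := by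
  have h1 : ∀ (j : ℕ) (s : Fin (n + 1)), ∃ p : MvPolynomial (Fin 2) ℂ, ∀ x t : ℝ,
      Phi0Deriv n lam0 μ j x t i s
        = commonFactor n lam0 x t * gauge n lam0 i x t
          * MvPolynomial.eval ![(x : ℂ), (t : ℂ)] p := by
    intro j s
    obtain ⟨p, hp⟩ := exists_polynomial_iteratedDeriv_exp
      (hμ.analyticAt_expX s (Complex.I * waveNumber n lam0 i))
      (hμ.analyticAt_expT s (Complex.I * frequency n lam0 i)) j _
      (hμ.analyticAt_weight hre him s i)
    refine ⟨p, fun x t => ?_⟩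
    rw [Phi0Deriv_apply, hp, (hμ.equation hre him s).1, mul_comm, commonFactor, gauge,
      ← Complex.exp_add]
    have h2 : lamEps n lam0 0 = lam0 := by simp [lamEps]
    rw [h2]
    congr 2
    ring
  choose p hp using h1
  refine ⟨∑ s ∈ Finset.range (k + 1), ∑ l : Fin (n + 1), (∑ r, p (s * n + s + l) r
    * MvPolynomial.C (matR n lam0 r l)) * MvPolynomial.C (((s * n + s + l).factorial : ℂ)⁻¹)
      * MvPolynomial.C ((γ (k - s) *ᵥ β) l), fun x t => ?_⟩
  simp only [PhiTilde, Finset.sum_apply, Matrix.mulVec, dotProduct, PhiHat, Matrix.of_apply, hp,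
    map_sum, map_mul, MvPolynomial.eval_C, Finset.mul_sum, Finset.sum_mul, Finset.sum_div]
  refine Finset.sum_congr rfl fun s _ => Finset.sum_congr rfl fun l _ =>
    Finset.sum_congr rfl fun r _ => Finset.sum_congr rfl fun l' _ => ?_
  ring

/-- The determinant of `M` and the ratios `q_j^{[N]} / q_j^{bg}` in terms of polynomials. -/
lemma IsEigenvalueBranches.exists_polynomial_rogueWave (hre : lam0.re = 0) (him : lam0.im ≠ 0)
    (hμ : IsEigenvalueBranches n lam0 μ) (hγ : γ 0 *ᵥ β ≠ 0) :
    ∃ D : MvPolynomial (Fin 2) ℂ,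
      (∀ x t : ℝ, (matM n N lam0 μ γ β x t).det
        = (star (commonFactor n lam0 x t) * commonFactor n lam0 x t) ^ N
          * MvPolynomial.eval ![(x : ℂ), (t : ℂ)] D) ∧
      ∀ j : Fin n, ∃ P : MvPolynomial (Fin 2) ℂ, ∀ x t : ℝ,
        rogueWave n N lam0 μ γ β x t j = background n lam0 x t j *
          (MvPolynomial.eval ![(x : ℂ), (t : ℂ)] P / MvPolynomial.eval ![(x : ℂ), (t : ℂ)] D) := by
  choose p hp using fun k i => hμ.exists_polynomial_PhiTilde (γ := γ) (β := β) hre him k i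
  let Mp : Matrix (Fin N) (Fin N) (MvPolynomial (Fin 2) ℂ) := Matrix.of fun m k =>
    MvPolynomial.C (1 / (Complex.I * ((n : ℂ) + 1) * (zeta n lam0 : ℂ))) *
      ∑ s ∈ Finset.range ((m : ℕ) + 1), ∑ l ∈ Finset.range ((k : ℕ) + 1),
        MvPolynomial.C ((-1 / 2 : ℂ) ^ (s + l) * ((s + l).choose l : ℂ)) *
          ∑ i : Fin (n + 1), MvPolynomial.map (starRingEnd ℂ) (p (m - s) i) * p (k - l) i
  have hM : ∀ x t : ℝ, matM n N lam0 μ γ β x t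
      = (star (commonFactor n lam0 x t) * commonFactor n lam0 x t) •
        (MvPolynomial.eval ![(x : ℂ), (t : ℂ)]).mapMatrix Mp := by
    intro x t
    ext m k
    simp only [matM, Mp, Matrix.of_apply, Matrix.smul_apply, smul_eq_mul, RingHom.mapMatrix_apply,
      Matrix.map_apply, map_mul, map_sum, MvPolynomial.eval_C, ← star_eval_ofReal, dotProduct,
      Pi.star_apply, hp, star_mul']
    rw [mul_left_comm]
    congr 1
    rw [Finset.mul_sum]
    refine Finset.sum_congr rfl fun s _ => ?_
    rw [Finset.mul_sum]
    refine Finset.sum_congr rfl fun l _ => ?_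
    rw [mul_left_comm]
    congr 1
    rw [Finset.mul_sum]
    refine Finset.sum_congr rfl fun i _ => ?_
    linear_combination (star (commonFactor n lam0 x t) * commonFactor n lam0 x t
      * star (MvPolynomial.eval ![(x : ℂ), (t : ℂ)] (p (m - s) i))
      * MvPolynomial.eval ![(x : ℂ), (t : ℂ)] (p (k - l) i))
        * star_gauge_mul_gauge (n := n) (lam0 := lam0) i x t
  have hD : ∀ x t : ℝ, (matM n N lam0 μ γ β x t).det
      = (star (commonFactor n lam0 x t) * commonFactor n lam0 x t) ^ N
        * MvPolynomial.eval ![(x : ℂ), (t : ℂ)] Mp.det := by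
    intro x t
    rw [hM, Matrix.det_smul, Fintype.card_fin, RingHom.map_det]
  refine ⟨Mp.det, hD, fun j => ⟨Mp.det - MvPolynomial.C (2 / (amp n lam0 j : ℂ)) *
    ∑ m : Fin N, ∑ k : Fin N, p k j.succ * Mp.adjugate k m * MvPolynomial.map (starRingEnd ℂ) (p m 0),
    fun x t => ?_⟩⟩
  have hdet := hμ.det_matM_ne_zero N hre him hγ x t
  have hDne : MvPolynomial.eval ![(x : ℂ), (t : ℂ)] Mp.det ≠ 0 := by
    intro h
    rw [hD, h, mul_zero] at hdet
    exact hdet rfl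
  have hc : commonFactor n lam0 x t ≠ 0 := Complex.exp_ne_zero _
  have hc' : star (commonFactor n lam0 x t) ≠ 0 := star_ne_zero.2 hc
  have hcc := mul_ne_zero hc' hc
  have ha : (amp n lam0 j : ℂ) ≠ 0 := Complex.ofReal_ne_zero.2 (amp_ne_zero him j)
  have hinv : ∀ k m, (matM n N lam0 μ γ β x t)⁻¹ k m
      = (star (commonFactor n lam0 x t) * commonFactor n lam0 x t)⁻¹
        * ((MvPolynomial.eval ![(x : ℂ), (t : ℂ)] Mp.det)⁻¹
          * MvPolynomial.eval ![(x : ℂ), (t : ℂ)] (Mp.adjugate k m)) := by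
    intro k m
    have hu : IsUnit ((MvPolynomial.eval ![(x : ℂ), (t : ℂ)]).mapMatrix Mp).det := by
      rw [← RingHom.map_det]
      exact hDne.isUnit
    have h1 : (matM n N lam0 μ γ β x t)⁻¹
        = (star (commonFactor n lam0 x t) * commonFactor n lam0 x t)⁻¹ •
          ((MvPolynomial.eval ![(x : ℂ), (t : ℂ)]).mapMatrix Mp)⁻¹ := by
      refine Matrix.inv_eq_right_inv ?_
      rw [hM, smul_mul_smul_comm, Matrix.mul_nonsing_inv _ hu, mul_inv_cancel₀ hcc, one_smul]
    rw [h1, Matrix.inv_def, Ring.inverse_eq_inv', ← RingHom.map_det, ← RingHom.map_adjugate]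
    rfl
  rw [rogueWave_apply hdet, background_eq_gauge, Matrix.mul_apply]
  simp only [Matrix.mul_apply, hinv, matY, Matrix.of_apply, Matrix.conjTranspose_apply, hp,
    star_mul', gauge_zero, star_one, map_sub, map_mul, map_sum, MvPolynomial.eval_C,
    ← star_eval_ofReal]
  have h2 : ∑ m : Fin N, (∑ k : Fin N, commonFactor n lam0 x t * gauge n lam0 j.succ x t
        * MvPolynomial.eval ![(x : ℂ), (t : ℂ)] (p k j.succ)
        * ((star (commonFactor n lam0 x t) * commonFactor n lam0 x t)⁻¹
          * ((MvPolynomial.eval ![(x : ℂ), (t : ℂ)] Mp.det)⁻¹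
          * MvPolynomial.eval ![(x : ℂ), (t : ℂ)] (Mp.adjugate k m))))
        * (star (commonFactor n lam0 x t) * 1
          * star (MvPolynomial.eval ![(x : ℂ), (t : ℂ)] (p m 0)))
      = gauge n lam0 j.succ x t * (MvPolynomial.eval ![(x : ℂ), (t : ℂ)] Mp.det)⁻¹
        * ∑ m : Fin N, ∑ k : Fin N, MvPolynomial.eval ![(x : ℂ), (t : ℂ)] (p k j.succ)
          * MvPolynomial.eval ![(x : ℂ), (t : ℂ)] (Mp.adjugate k m)
          * star (MvPolynomial.eval ![(x : ℂ), (t : ℂ)] (p m 0)) := by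
    simp only [Finset.mul_sum, Finset.sum_mul]
    refine Finset.sum_congr rfl fun m _ => Finset.sum_congr rfl fun k _ => ?_
    field_simp
  rw [h2]
  field_simp

lemma contDiff_commonFactor_sq (n : ℕ) (lam0 : ℂ) : ContDiff ℝ ∞ fun r : ℝ × ℝ =>
    star (commonFactor n lam0 r.1 r.2) * commonFactor n lam0 r.1 r.2 := by
  have h1 : ContDiff ℝ ∞ fun r : ℝ × ℝ => commonFactor n lam0 r.1 r.2 := contDiff_exp_linear _ _
  exact (Complex.conjCLE.contDiff.comp h1).mul h1

lemma contDiff_background (n : ℕ) (lam0 : ℂ) (j : Fin n) : ContDiff ℝ ∞ fun r : ℝ × ℝ =>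
    background n lam0 r.1 r.2 j := by
  simp only [background_apply]
  exact contDiff_const.mul (contDiff_exp_linear _ _)

lemma IsEigenvalueBranches.contDiff_det_matM (hre : lam0.re = 0) (him : lam0.im ≠ 0)
    (hμ : IsEigenvalueBranches n lam0 μ) (hγ : γ 0 *ᵥ β ≠ 0) :
    ContDiff ℝ ∞ fun r : ℝ × ℝ => (matM n N lam0 μ γ β r.1 r.2).det := by
  obtain ⟨D, hD, -⟩ := hμ.exists_polynomial_rogueWave (N := N) hre him hγ
  simp only [hD]
  exact ((contDiff_commonFactor_sq n lam0).pow N).mul (contDiff_eval D)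

lemma IsEigenvalueBranches.isSolution_rogueWave (hre : lam0.re = 0) (him : lam0.im ≠ 0)
    (hμ : IsEigenvalueBranches n lam0 μ) (hγ : γ 0 *ᵥ β ≠ 0) :
    IsSolution (rogueWave n N lam0 μ γ β) := by
  refine ⟨(contDiff_piLp 2).2 fun j => ?_, fun x t => ?_⟩
  · obtain ⟨D, hD, hP⟩ := hμ.exists_polynomial_rogueWave (N := N) hre him hγ
    obtain ⟨P, hP⟩ := hP j
    simp only [hP, div_eq_mul_inv]
    refine (contDiff_background n lam0 j).mul ((contDiff_eval P).mul ((contDiff_eval D).inv ?_))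
    intro r h
    refine hμ.det_matM_ne_zero N hre him hγ r.1 r.2 ?_
    rw [hD, h, mul_zero]
  · obtain ⟨qx, qxx, qt, hqx, hqxx, hqt, h⟩ :=
      hμ.exists_hasDerivAt_rogueWave (N := N) hre him hγ x t
    have h1 : deriv (fun y => rogueWave n N lam0 μ γ β y t) = qx := funext fun y => (hqx y).deriv
    rw [hqt.deriv, iteratedDeriv_succ, iteratedDeriv_one, h1, hqxx.deriv]
    exact h

/-! ### The logarithm of the determinant -/

/-- As `M` is skew-hermitian and nowhere singular, `det M` keeps its direction in the complex
plane. -/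
lemma IsEigenvalueBranches.exists_det_matM_eq (hre : lam0.re = 0) (him : lam0.im ≠ 0)
    (hμ : IsEigenvalueBranches n lam0 μ) (hγ : γ 0 *ᵥ β ≠ 0) :
    ∃ (d : ℂ) (ρ : ℝ × ℝ → ℝ), d ≠ 0 ∧ ContDiff ℝ ∞ ρ ∧ (∀ r, 0 < ρ r) ∧
      ∀ r : ℝ × ℝ, (matM n N lam0 μ γ β r.1 r.2).det = (ρ r : ℂ) * d := by
  have hdet := hμ.det_matM_ne_zero N hre him hγ
  set d := (matM n N lam0 μ γ β 0 0).det with hd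
  have hstar : ∀ x t : ℝ, star (matM n N lam0 μ γ β x t).det
      = (-1) ^ N * (matM n N lam0 μ γ β x t).det := by
    intro x t
    rw [← Matrix.det_conjTranspose, conjTranspose_eq_neg_of_sylvester hre him
      (matM_sylvester hre him x t), Matrix.det_neg, Fintype.card_fin]
  have hreal : ∀ r : ℝ × ℝ, (((matM n N lam0 μ γ β r.1 r.2).det / d).re : ℂ)
      = (matM n N lam0 μ γ β r.1 r.2).det / d := by
    intro r
    rw [← Complex.conj_eq_iff_re, ← Complex.star_def, star_div₀, hd, hstar, hstar]
    exact mul_div_mul_left _ _ (pow_ne_zero _ (neg_ne_zero.2 one_ne_zero))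
  have hsm : ContDiff ℝ ∞ fun r : ℝ × ℝ => ((matM n N lam0 μ γ β r.1 r.2).det / d).re :=
    Complex.reCLM.contDiff.comp ((hμ.contDiff_det_matM hre him hγ).div_const d)
  have hne : ∀ r : ℝ × ℝ, ((matM n N lam0 μ γ β r.1 r.2).det / d).re ≠ 0 := by
    intro r h
    have h1 := hreal r
    rw [h, Complex.ofReal_zero] at h1
    exact div_ne_zero (hdet _ _) (hdet 0 0) h1.symm
  refine ⟨d, fun r => ((matM n N lam0 μ γ β r.1 r.2).det / d).re, hdet 0 0, hsm, fun r => ?_,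
    fun r => ?_⟩
  · by_contra! h
    have h0 : (0 : ℝ) ≤ ((matM n N lam0 μ γ β (0 : ℝ × ℝ).1 (0 : ℝ × ℝ).2).det / d).re := by
      have h2 : (matM n N lam0 μ γ β (0 : ℝ × ℝ).1 (0 : ℝ × ℝ).2).det / d = 1 :=
        div_self (hdet 0 0)
      rw [h2]
      simp
    obtain ⟨r', hr'⟩ := mem_range_of_exists_le_of_exists_ge hsm.continuous ⟨r, h⟩ ⟨0, h0⟩
    exact hne r' hr'
  · rw [hreal r, div_mul_cancel₀ _ (hdet 0 0)]

lemma IsEigenvalueBranches.contDiff_log_det_matM (hre : lam0.re = 0) (him : lam0.im ≠ 0)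
    (hμ : IsEigenvalueBranches n lam0 μ) (hγ : γ 0 *ᵥ β ≠ 0) :
    ContDiff ℝ ∞ fun r : ℝ × ℝ => Complex.log (matM n N lam0 μ γ β r.1 r.2).det := by
  obtain ⟨d, ρ, hd, hρ, hpos, h⟩ := hμ.exists_det_matM_eq (N := N) hre him hγ
  simp only [h, Complex.log_ofReal_mul (hpos _) hd]
  exact (Complex.ofRealCLM.contDiff.comp (hρ.log fun r => (hpos r).ne')).add contDiff_const

lemma IsEigenvalueBranches.hasDerivAt_log_det_matM (hre : lam0.re = 0) (him : lam0.im ≠ 0)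
    (hμ : IsEigenvalueBranches n lam0 μ) (hγ : γ 0 *ᵥ β ≠ 0) (x t : ℝ) :
    HasDerivAt (fun y => Complex.log (matM n N lam0 μ γ β y t).det)
      (iSigma n * dressing n N lam0 μ γ β x t).trace x := by
  obtain ⟨d, ρ, hd, hρ, hpos, h⟩ := hμ.exists_det_matM_eq (N := N) hre him hγ
  have h1 : ∀ y : ℝ, (ρ (y, t) : ℂ) = (matM n N lam0 μ γ β y t).det / d := fun y => by
    rw [h (y, t), mul_div_cancel_right₀ _ hd]
  have h2 : ∀ y : ℝ, Complex.log (matM n N lam0 μ γ β y t).det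
      = Complex.log ((matM n N lam0 μ γ β y t).det / d) + Complex.log d := fun y => by
    rw [h (y, t), Complex.log_ofReal_mul (hpos _) hd, mul_div_cancel_right₀ _ hd,
      Complex.ofReal_log (hpos _).le]
  simp only [h2]
  have h3 : (matM n N lam0 μ γ β x t).det / d ∈ Complex.slitPlane := by
    rw [← h1]
    exact Complex.ofReal_mem_slitPlane.2 (hpos _)
  have hdet := hμ.det_matM_ne_zero N hre him hγ x t
  refine ((((hμ.hasDerivAt_det_matM hre him hγ x t).div_const d).clog_real h3).add_const
    _).congr_deriv ?_
  field_simp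

/-- The intensity formula. -/
lemma IsEigenvalueBranches.norm_sq_rogueWave (hre : lam0.re = 0) (him : lam0.im ≠ 0)
    (hμ : IsEigenvalueBranches n lam0 μ) (hγ : γ 0 *ᵥ β ≠ 0) (x t : ℝ) :
    ((‖rogueWave n N lam0 μ γ β x t‖ ^ 2 : ℝ) : ℂ) = ((‖amp n lam0‖ ^ 2 : ℝ) : ℂ)
      + iteratedDeriv 2 (fun y : ℝ => Complex.log (matM n N lam0 μ γ β y t).det) x := by
  have h1 : deriv (fun y : ℝ => Complex.log (matM n N lam0 μ γ β y t).det)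
      = fun y => (iSigma n * dressing n N lam0 μ γ β y t).trace :=
    funext fun y => (hμ.hasDerivAt_log_det_matM hre him hγ y t).deriv
  rw [iteratedDeriv_succ, iteratedDeriv_one, h1,
    (hμ.hasDerivAt_trace_dressing hre him hγ x t).deriv]
  ring

end

end NNLS

theorem mainTheorem2 (n N : ℕ) (hn : 1 ≤ n) (hN : 1 ≤ N)
    (lam0 : ℂ) (hre : lam0.re = 0) (him : lam0.im ≠ 0)
    (γ : ℕ → Matrix (Fin (n + 1)) (Fin (n + 1)) ℂ) (β : Fin (n + 1) → ℂ)
    (hγ : γ 0 *ᵥ β ≠ 0) :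
    -- the eigenvalue branches exist
    (∃ μ : Fin (n + 1) → ℂ → ℂ, NNLS.IsEigenvalueBranches n lam0 μ) ∧
    ∀ μ : Fin (n + 1) → ℂ → ℂ, NNLS.IsEigenvalueBranches n lam0 μ →
      -- the inverse-function formula for their Taylor coefficients
      (∀ s, μ s 0 = NNLS.z0 n lam0 ∧
        ∀ i : ℕ, 1 ≤ i →
          iteratedDeriv i (μ s) 0
            = iteratedDeriv (i - 1) (fun z => NNLS.g n lam0 s z ^ i) (NNLS.z0 n lam0)) ∧
      -- the columns of Φ₀(ε) solve the Lax pair on the background, and so does Φ̃(ε),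
      -- whose Taylor coefficients in ε^(n+1) are the vectors Φ̃_k
      (∀ᶠ ε in 𝓝[≠] (0 : ℂ),
        (∀ s, NNLS.IsLaxSolution (NNLS.background n lam0) (NNLS.lamEps n lam0 ε)
          (NNLS.h n lam0 (NNLS.lamEps n lam0 ε) (μ s ε))) ∧
        NNLS.IsLaxSolution (NNLS.background n lam0) (NNLS.lamEps n lam0 ε)
          (NNLS.PhiTildeFun n N lam0 μ γ β ε)) ∧
      (∀ x t : ℝ,
        (fun ε : ℂ => NNLS.PhiTildeFun n N lam0 μ γ β ε x t
            - ∑ k ∈ Finset.range N, ε ^ (k * (n + 1)) • NNLS.PhiTilde n lam0 μ γ β k x t)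
          =O[𝓝[≠] (0 : ℂ)] fun ε : ℂ => ε ^ (N * (n + 1))) ∧
      -- the denominator of the determinant formula vanishes nowhere
      (∀ x t : ℝ, (NNLS.matM n N lam0 μ γ β x t).det ≠ 0) ∧
      -- the formula gives the limit of the N-fold Darboux transforms of the background
      (∀ x t : ℝ,
        Tendsto
          (fun ε : Fin N → ℂ =>
            NNLS.darboux (NNLS.background n lam0 x t) (fun i => NNLS.lamEps n lam0 (ε i))
              (fun i => NNLS.PhiTildeFun n N lam0 μ γ β (ε i) x t))
          (𝓝[{ε : Fin N → ℂ | (∀ i, ε i ≠ 0) ∧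
              Function.Injective fun i => NNLS.lamEps n lam0 (ε i)}] 0)
          (𝓝 (NNLS.rogueWave n N lam0 μ γ β x t))) ∧
      -- it is a solution of the n-component NLS equations
      NNLS.IsSolution (NNLS.rogueWave n N lam0 μ γ β) ∧
      -- it is rational, up to the plane-wave factors
      (∃ D : MvPolynomial (Fin 2) ℂ,
        (∀ x t : ℝ, MvPolynomial.eval ![(x : ℂ), (t : ℂ)] D ≠ 0) ∧
        ∀ j : Fin n, ∃ P : MvPolynomial (Fin 2) ℂ, ∀ x t : ℝ,
          NNLS.rogueWave n N lam0 μ γ β x t j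
            = NNLS.background n lam0 x t j *
              (MvPolynomial.eval ![(x : ℂ), (t : ℂ)] P
                / MvPolynomial.eval ![(x : ℂ), (t : ℂ)] D)) ∧
      -- the intensity formula
      ContDiff ℝ ∞ (fun p : ℝ × ℝ => Complex.log (NNLS.matM n N lam0 μ γ β p.1 p.2).det) ∧
      ∀ x t : ℝ,
        ((‖NNLS.rogueWave n N lam0 μ γ β x t‖ ^ 2 : ℝ) : ℂ)
          = ((‖NNLS.amp n lam0‖ ^ 2 : ℝ) : ℂ)
            + iteratedDeriv 2
                (fun y : ℝ => Complex.log (NNLS.matM n N lam0 μ γ β y t).det) x := by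
  refine ⟨NNLS.exists_isEigenvalueBranches n hre him, fun μ hμ => ?_⟩
  have hdet := hμ.det_matM_ne_zero N hre him hγ
  refine ⟨fun s => ?_, ?_, hμ.isBigO_PhiTildeFun N hre him γ β, hdet,
    hμ.tendsto_darboux hN hre him hγ, hμ.isSolution_rogueWave hre him hγ, ?_,
    hμ.contDiff_log_det_matM hre him hγ, hμ.norm_sq_rogueWave hre him hγ⟩
  · obtain ⟨h0, hE⟩ := hμ.equation hre him s
    exact ⟨h0, fun i hi =>
      NNLS.iteratedDeriv_lagrange (NNLS.analyticAt_g him s) (hμ.analytic s) h0 hE hi⟩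
  · have h1 : ∀ᶠ ε in 𝓝 (0 : ℂ), ∀ s, NNLS.IsLaxSolution (NNLS.background n lam0)
        (NNLS.lamEps n lam0 ε) (NNLS.h n lam0 (NNLS.lamEps n lam0 ε) (μ s ε)) :=
      Filter.eventually_all.2 fun s => hμ.isLaxSolution_h hre him s
    exact (h1.filter_mono nhdsWithin_le_nhds).mono fun ε hε =>
      ⟨hε, NNLS.isLaxSolution_PhiTildeFun N γ β hε⟩
  · obtain ⟨D, hD, hP⟩ := hμ.exists_polynomial_rogueWave (N := N) hre him hγ
    refine ⟨D, fun x t h => hdet x t ?_, hP⟩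
    rw [hD, h, mul_zero]
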